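/- Let $n\ge 1$, let $\mathbb{B}_n$ and $\mathbb{S}_n$ be the open unit ball and the unit sphere of $\mathbb{C}^n$, $\langle z,w\rangle=\sum_j z_j\overline{w_j}$, and let $V_n$ and $\sigma$ be Lebesgue measure on $\mathbb{B}_n$ and surface measure on $\mathbb{S}_n$, both normalized to have total mass one. Fix an aperture $\gamma\ge 2$ and put $$\Gamma(\zeta)=\{z\in\mathbb{B}_n:\ |1-\langle z,\zeta\rangle|<\tfrac{\gamma}{2}(1-|z|^2)\}\quad(\zeta\in\mathbb{S}_n),$$ $Q(u)=\{z\in\mathbb{B}_n:\ |1-\langle z,u/|u|\rangle|<1-|u|^2\}$ for $0\ne u\in\mathbb{B}_n$, and $Q(0)=\mathbb{B}_n$. Let $1<q<\infty$ and $\alpha>-n-1$. The space $T^\infty_{q,\alpha}(\mathbb{B}_n)$ consists of the measurable $f:\mathbb{B}_n\to\mathbb{C}$ with $$\|f\|_{T^\infty_{q,\alpha}}=\operatorname*{ess\,sup}_{\zeta\in\mathbb{S}_n}\Big(\sup_{u\in\Gamma(\zeta)}\frac{1}{(1-|u|^2)^n}\int_{Q(u)}|f(z)|^q(1-|z|^2)^{n+\alpha}\,dV_n(z)\Big)^{1/q}<\infty,$$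 and $T^1_{q,\alpha}(\mathbb{B}_n)$ of the measurable $f$ with $$\|f\|_{T^1_{q,\alpha}}=\int_{\mathbb{S}_n}\Big(\int_{\Gamma(\zeta)}|f(z)|^q(1-|z|^2)^{\alpha}\,dV_n(z)\Big)^{1/q}d\sigma(\zeta)<\infty.$$ Let $\mathcal{CT}_{q,\alpha}(\mathbb{B}_n)$ and $\mathcal{HT}^1_{q,\alpha}(\mathbb{B}_n)$ be their subspaces of holomorphic functions, with the same norms. The Bergman projection is $$P_{n+\alpha}f(z)=\frac{\Gamma(2n+\alpha+1)}{n!\,\Gamma(n+\alpha+1)}\int_{\mathbb{B}_n}\frac{(1-|u|^2)^{n+\alpha}}{(1-\langle z,u\rangle)^{1+2n+\alpha}}\,f(u)\,dV_n(u),\qquad z\in\mathbb{B}_n .$$ A positive Borel measure $\mu$ on $\mathbb{B}_n$ is a Carleson measure if there is $C<\infty$ with $\mu(\{z\in\mathbb{B}_n:|1-\langle z,\zeta\rangle|<\delta\})\le C\delta^n$ for all $\zeta\in\mathbb{S}_n$ and $\delta>0$. Then: 1. For $f\in T^\infty_{q,\alpha}(\mathbb{B}_n)$ the integral defining $P_{n+\alpha}f(z)$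 converges absolutely for every $z\in\mathbb{B}_n$, and $P_{n+\alpha}:T^\infty_{q,\alpha}(\mathbb{B}_n)\to\mathcal{CT}_{q,\alpha}(\mathbb{B}_n)$ is bounded and onto. 2. A measurable $f$ belongs to $T^\infty_{q,\alpha}(\mathbb{B}_n)$ if and only if $|f(z)|^q(1-|z|^2)^{n+\alpha}dV_n(z)$ is a Carleson measure; and if this holds for $f$, then $|P_{n+\alpha}f(z)|^q(1-|z|^2)^{n+\alpha}dV_n(z)$ is a Carleson measure as well. 3. For $f\in T^1_{q,\alpha}(\mathbb{B}_n)$ the integral defining $P_{n+\alpha}f(z)$ converges absolutely for every $z\in\mathbb{B}_n$, and $P_{n+\alpha}:T^1_{q,\alpha}(\mathbb{B}_n)\to\mathcal{HT}^1_{q,\alpha}(\mathbb{B}_n)$ is bounded and onto. -/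

import Mathlib

open MeasureTheory Metric Set
open scoped ENNReal NNReal

noncomputable section

namespace TentBall

/-- The Euclidean space `ℂⁿ`. -/
abbrev Cn (n : ℕ) : Type := EuclideanSpace ℂ (Fin n)

/-- The Hermitian product `⟨z, w⟩ = z₁ w̄₁ + ⋯ + zₙ w̄ₙ`, linear in the first variable
(Mathlib's `inner` is linear in the second one). -/
def herm {n : ℕ} (z w : Cn n) : ℂ := inner ℂ w z

/-- The open unit ball `𝔹ₙ`. -/
def unitBall (n : ℕ) : Set (Cn n) := ball 0 1

/-- Lebesgue measure on `𝔹ₙ`, normalized to total mass one, as a measure on `ℂⁿ`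
carried by `𝔹ₙ`. -/
def V (n : ℕ) : Measure (Cn n) :=
  (volume (unitBall n))⁻¹ • volume.restrict (unitBall n)

/-- Surface measure on the unit sphere `𝕊ₙ`, normalized to total mass one. -/
def σ (n : ℕ) : Measure (sphere (0 : Cn n) 1) :=
  ((volume : Measure (Cn n)).toSphere univ)⁻¹ • (volume : Measure (Cn n)).toSphere

/-- The Korányi approach region `Γ_γ(ζ)`. -/
def korRegion {n : ℕ} (γ : ℝ) (ζ : Cn n) : Set (Cn n) :=
  {z | z ∈ unitBall n ∧ ‖1 - herm z ζ‖ < γ / 2 * (1 - ‖z‖ ^ 2)}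

open Classical in
/-- The nonisotropic tent `Q(u)` over `ζ_u = u / |u|`, with `Q(0) = 𝔹ₙ`. -/
def tent {n : ℕ} (u : Cn n) : Set (Cn n) :=
  if u = 0 then unitBall n
  else {z | z ∈ unitBall n ∧ ‖1 - herm z (((‖u‖⁻¹ : ℝ) : ℂ) • u)‖ < 1 - ‖u‖ ^ 2}

/-- The density `|f(z)|^q (1 - |z|²)^β`, for `z` in the ball. -/
def wDensity {n : ℕ} (q β : ℝ) (f : Cn n → ℂ) (z : Cn n) : ℝ≥0∞ :=
  ‖f z‖ₑ ^ q * ENNReal.ofReal ((1 - ‖z‖ ^ 2) ^ β)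

/-- The tent (quasi)norm on `T^p_{q,α}(𝔹ₙ)`, `0 < p, q < ∞`, with aperture `γ`. -/
def tentNorm (n : ℕ) (γ p q α : ℝ) (f : Cn n → ℂ) : ℝ≥0∞ :=
  (∫⁻ ζ : sphere (0 : Cn n) 1,
    (∫⁻ z in korRegion γ (ζ : Cn n), wDensity q α f z ∂(V n)) ^ (p / q) ∂(σ n)) ^ (1 / p)

/-- The norm on `T^∞_{q,α}(𝔹ₙ)`, with aperture `γ`. -/
def tentNormTop (n : ℕ) (γ q α : ℝ) (f : Cn n → ℂ) : ℝ≥0∞ :=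
  essSup (fun ζ : sphere (0 : Cn n) 1 =>
    (⨆ u ∈ korRegion γ (ζ : Cn n),
      (ENNReal.ofReal ((1 - ‖u‖ ^ 2) ^ n))⁻¹ *
        ∫⁻ z in tent u, wDensity q (n + α) f z ∂(V n)) ^ (1 / q)) (σ n)

/-- `f ∈ T^p_{q,α}(𝔹ₙ)`; only the values of `f` on the ball matter. -/
def MemT (n : ℕ) (γ p q α : ℝ) (f : Cn n → ℂ) : Prop :=
  AEMeasurable f (V n) ∧ tentNorm n γ p q α f < ∞

/-- `f ∈ T^∞_{q,α}(𝔹ₙ)`. -/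
def MemTTop (n : ℕ) (γ q α : ℝ) (f : Cn n → ℂ) : Prop :=
  AEMeasurable f (V n) ∧ tentNormTop n γ q α f < ∞

/-- `f ∈ HT^p_{q,α}(𝔹ₙ)`: `f` is holomorphic on `𝔹ₙ` and belongs to `T^p_{q,α}(𝔹ₙ)`. -/
def MemHT (n : ℕ) (γ p q α : ℝ) (f : Cn n → ℂ) : Prop :=
  DifferentiableOn ℂ f (unitBall n) ∧ MemT n γ p q α f

/-- `f ∈ CT_{q,α}(𝔹ₙ)`: `f` is holomorphic on `𝔹ₙ` and belongs to `T^∞_{q,α}(𝔹ₙ)`. -/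
def MemCT (n : ℕ) (γ q α : ℝ) (f : Cn n → ℂ) : Prop :=
  DifferentiableOn ℂ f (unitBall n) ∧ MemTTop n γ q α f

/-- The measure `|f(z)|^q (1 - |z|²)^β dV(z)` on the ball. -/
def wMeasure (n : ℕ) (q β : ℝ) (f : Cn n → ℂ) : Measure (Cn n) :=
  (V n).withDensity (wDensity q β f)

/-- A positive measure `μ` on `𝔹ₙ` is a Carleson measure if the nonisotropic balls
`{z ∈ 𝔹ₙ : |1 - ⟨z, ζ⟩| < δ}`, `ζ ∈ 𝕊ₙ`, `δ > 0`, have `μ`-measure at most `C δⁿ`. -/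
def IsCarleson {n : ℕ} (μ : Measure (Cn n)) : Prop :=
  ∃ C : ℝ≥0, ∀ ζ ∈ sphere (0 : Cn n) 1, ∀ δ : ℝ, 0 < δ →
    μ {z | z ∈ unitBall n ∧ ‖1 - herm z ζ‖ < δ} ≤ C * ENNReal.ofReal (δ ^ n)

/-- The constant `c(n,β) = Γ(n+β+1) / (n! Γ(β+1))`. -/
def cConst (n : ℕ) (β : ℝ) : ℝ :=
  Real.Gamma (n + β + 1) / (n.factorial * Real.Gamma (β + 1))

/-- The integrand `(1 - |u|²)^β (1 - ⟨z,u⟩)^{-(1+n+β)} f(u)` of the Bergman projection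
(principal branch: `1 - ⟨z,u⟩` has positive real part for `z, u` in the ball). -/
def bergmanIntegrand (n : ℕ) (β : ℝ) (f : Cn n → ℂ) (z u : Cn n) : ℂ :=
  (((1 - ‖u‖ ^ 2) ^ β : ℝ) : ℂ) / (1 - herm z u) ^ ((1 + n + β : ℝ) : ℂ) * f u

/-- The Bergman projection `P_β`. -/
def bergmanProj (n : ℕ) (β : ℝ) (f : Cn n → ℂ) (z : Cn n) : ℂ :=
  (cConst n β : ℂ) * ∫ u, bergmanIntegrand n β f z u ∂(V n)

end TentBall

end

/-!
The Bergman projection is dominated pointwise by the positive operator `posBergman` with kernel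
`|1 - ⟨z, u⟩|^{-(1+n+β)}`, `β = n + α`, so that both boundedness statements are proved for that
operator, acting on nonnegative functions. The geometry enters only through the gauge
`|1 - ⟨z, w⟩|`, which satisfies a quasi-triangle inequality (`gauge_triangle`), and through the
measures of its balls: `σ` of a spherical ball of radius `δ` is comparable to `δⁿ`
(`sigma_cap_le`, `le_sigma_cap`), and the volume with weight `(1 - |z|²)^t` of a ball centred at the
sphere is `O(δ^{n+1+t})` (`weightedV_cap_le`). The latter gives the Forelli–Rudin estimate
(`forelli_rudin`).

*Carleson measures and `T^∞`.* A tent over `u ≠ 0` is a gauge ball of radius `1 - |u|²`, and the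
points whose approach region contains `u` form a set of positive measure; hence the essential
supremum defining the norm of `T^∞` controls every gauge ball of radius less than one. Finitely many
balls of radius one cover the punctured ball, which takes care of large radii. So the norm is
equivalent to the `q`-th root of the Carleson constant (`tentNormTop_le`,
`carlesonBound_tentNormTop`).
A Schur test with the weight `(1 - |u|²)^s` for small `s > 0` shows that `posBergman` preserves
Carleson measures (`CarlesonBound.posBergman`): the part of the measure near a gauge ball is treated
by Forelli–Rudin, and far away the kernel is essentially constant on the ball.

*The space `T^1`.* Boundedness on `T^1` follows by duality, `posBergman` being symmetric. The two
ingredients are the pairing inequality `∫ φ ψ ≤ C ‖φ‖_{T^1_q} ‖ψ‖_{T^∞_{q'}}`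
(`lintegral_mul_le_tentOne`), proved by a stopping-time argument on approach regions, and the
existence of norming functions (`exists_norming`). Truncations with finite area function and
monotone convergence complete the argument (`tentOne_posBergman_le`).

*Surjectivity.* Functions of `T^∞` and `T^1` are integrable for `(1 - |z|²)^β dV`, and the Bergman
projection reproduces integrable holomorphic functions (`bergmanProj_eq_self`), so every element of
the target is its own preimage. For the reproducing formula, a unitary map puts `z` on a coordinate
axis; averaging over the rotations of the other coordinates leaves a function of one variable, and
averaging over rotations of that variable isolates the Taylor coefficients, whose moments
(`ball_moment`) cancel the binomial coefficients of the kernel.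
-/

namespace TentBall

variable {n : ℕ}

/-! ### The nonisotropic gauge -/

/-- The nonisotropic gauge `|1 - ⟨z, w⟩|`. -/
noncomputable def gauge (z w : Cn n) : ℝ := ‖1 - herm z w‖

/-- The nonisotropic ball `{z ∈ 𝔹ₙ : |1 - ⟨z, ζ⟩| < δ}`. -/
def cap (ζ : Cn n) (δ : ℝ) : Set (Cn n) := {z | z ∈ unitBall n ∧ gauge z ζ < δ}

lemma mem_unitBall {z : Cn n} : z ∈ unitBall n ↔ ‖z‖ < 1 := by
  simp [unitBall]

lemma norm_herm_le (z w : Cn n) : ‖herm z w‖ ≤ ‖z‖ * ‖w‖ := by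
  rw [mul_comm]; exact norm_inner_le_norm w z

lemma herm_smul_left (a : ℂ) (z w : Cn n) : herm (a • z) w = a * herm z w :=
  inner_smul_right _ _ _

lemma herm_smul_right (a : ℂ) (z w : Cn n) : herm z (a • w) = (starRingEnd ℂ) a * herm z w :=
  inner_smul_left _ _ _

lemma herm_self (z : Cn n) : herm z z = ((‖z‖ ^ 2 : ℝ) : ℂ) := by
  simp [herm, inner_self_eq_norm_sq_to_K]

lemma herm_conj (z w : Cn n) : (starRingEnd ℂ) (herm z w) = herm w z :=
  inner_conj_symm _ _

lemma gauge_nonneg (z w : Cn n) : 0 ≤ gauge z w := norm_nonneg _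

lemma gauge_comm (z w : Cn n) : gauge z w = gauge w z := by
  unfold gauge
  rw [← herm_conj w z, ← Complex.norm_conj]
  simp

lemma continuous_herm : Continuous fun p : Cn n × Cn n => herm p.1 p.2 := by
  unfold herm; fun_prop

lemma continuous_gauge : Continuous fun p : Cn n × Cn n => gauge p.1 p.2 := by
  unfold gauge
  exact (continuous_const.sub continuous_herm).norm

lemma measurable_gauge_left (w : Cn n) : Measurable fun z : Cn n => gauge z w :=
  (continuous_gauge.comp (by fun_prop : Continuous fun z : Cn n => (z, w))).measurable

lemma measurable_gauge : Measurable fun p : Cn n × Cn n => gauge p.1 p.2 :=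
  continuous_gauge.measurable

@[fun_prop]
lemma measurable_gauge_comp {X : Type*} [MeasurableSpace X] {f g : X → Cn n}
    (hf : Measurable f) (hg : Measurable g) : Measurable fun x => gauge (f x) (g x) := by
  have h := measurable_gauge (n := n)
  have h2 := h.comp (hf.prodMk hg)
  exact h2

lemma measurableSet_unitBall : MeasurableSet (unitBall n) := measurableSet_ball

lemma measurableSet_cap (ζ : Cn n) (δ : ℝ) : MeasurableSet (cap ζ δ) :=
  measurableSet_unitBall.inter (measurableSet_lt (measurable_gauge_left ζ) measurable_const)

lemma gauge_le_two {z w : Cn n} (hz : ‖z‖ ≤ 1) (hw : ‖w‖ ≤ 1) : gauge z w ≤ 2 := by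
  have h1 : ‖herm z w‖ ≤ 1 := (norm_herm_le z w).trans (mul_le_one₀ hz (norm_nonneg _) hw)
  have h2 : ‖1 - herm z w‖ ≤ ‖(1 : ℂ)‖ + ‖herm z w‖ := norm_sub_le _ _
  rw [norm_one] at h2
  unfold gauge; linarith

lemma one_sub_norm_le_gauge {z w : Cn n} (hw : ‖w‖ ≤ 1) : 1 - ‖z‖ ≤ gauge z w := by
  have h1 : ‖herm z w‖ ≤ ‖z‖ :=
    (norm_herm_le z w).trans (mul_le_of_le_one_right (norm_nonneg _) hw)
  have h2 : ‖(1 : ℂ)‖ - ‖herm z w‖ ≤ ‖1 - herm z w‖ := norm_sub_norm_le _ _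
  rw [norm_one] at h2
  unfold gauge; linarith

lemma one_sub_norm_sq_pos {z : Cn n} (hz : ‖z‖ < 1) : 0 < 1 - ‖z‖ ^ 2 := by
  have := norm_nonneg z
  nlinarith

lemma one_sub_norm_sq_le_gauge {z w : Cn n} (hz : ‖z‖ ≤ 1) (hw : ‖w‖ ≤ 1) :
    1 - ‖z‖ ^ 2 ≤ 2 * gauge z w := by
  have h1 := one_sub_norm_le_gauge (z := z) hw
  have := norm_nonneg z
  nlinarith

/-- The component of `a` orthogonal to a unit vector `c` is controlled by the gauge. -/
lemma norm_sub_herm_smul_sq_le {a c : Cn n} (ha : ‖a‖ ≤ 1) (hc : ‖c‖ = 1) :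
    ‖a - herm a c • c‖ ^ 2 ≤ 2 * gauge a c := by
  have h1 : ‖a - herm a c • c‖ ^ 2 = ‖a‖ ^ 2 - ‖herm a c‖ ^ 2 := by
    have h := @norm_sub_sq ℂ (Cn n) _ _ _ a (herm a c • c)
    rw [h]
    have h2 : inner ℂ a (herm a c • c) = ((‖herm a c‖ ^ 2 : ℝ) : ℂ) := by
      rw [inner_smul_right, show inner ℂ a c = (starRingEnd ℂ) (herm a c) from
        (herm_conj a c).symm, Complex.mul_conj, Complex.normSq_eq_norm_sq]
    rw [h2, norm_smul, hc]
    simp only [RCLike.re_to_complex, Complex.ofReal_re, mul_one]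
    ring
  have h3 : ‖(1 : ℂ)‖ - ‖herm a c‖ ≤ ‖1 - herm a c‖ := norm_sub_norm_le _ _
  rw [norm_one] at h3
  have h4 : ‖herm a c‖ ≤ 1 := (norm_herm_le a c).trans (by rw [hc, mul_one]; exact ha)
  have := norm_nonneg a
  have := norm_nonneg (herm a c)
  unfold gauge
  rw [h1]
  nlinarith

/-- Quasi-triangle inequality through a point of the sphere. -/
lemma gauge_triangle_sphere {a b c : Cn n} (ha : ‖a‖ ≤ 1) (hb : ‖b‖ ≤ 1) (hc : ‖c‖ = 1) :
    gauge a b ≤ 2 * (gauge a c + gauge c b) := by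
  set a' := a - herm a c • c with ha'
  set b' := b - herm b c • c with hb'
  have hcc : herm c c = 1 := by rw [herm_self, hc]; simp
  have key : 1 - herm a b = (1 - herm a c) + herm a c * (1 - herm c b) - herm a' b' := by
    have : herm a' b' = herm a b - herm a c * herm c b := by
      simp only [ha', hb']
      have e1 : ∀ x y w : Cn n, herm (x - y) w = herm x w - herm y w := fun x y w =>
        inner_sub_right _ _ _
      have e2 : ∀ w x y : Cn n, herm w (x - y) = herm w x - herm w y := fun w x y =>
        inner_sub_left _ _ _
      rw [e1, e2, e2, herm_smul_left, herm_smul_right, herm_smul_left, herm_smul_right, hcc,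
        herm_conj]
      ring
    rw [this]; ring
  have h1 := norm_sub_herm_smul_sq_le ha hc
  have h2 := norm_sub_herm_smul_sq_le hb hc
  have h3 : ‖herm a' b'‖ ≤ gauge a c + gauge c b := by
    refine (norm_herm_le _ _).trans ?_
    rw [gauge_comm c b]
    have := norm_nonneg a'
    have := norm_nonneg b'
    nlinarith [sq_nonneg (‖a'‖ - ‖b'‖)]
  have h4 : ‖herm a c‖ ≤ 1 := (norm_herm_le a c).trans (by rw [hc, mul_one]; exact ha)
  have h5 : ‖herm a c * (1 - herm c b)‖ ≤ gauge c b := by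
    rw [norm_mul]
    exact mul_le_of_le_one_left (norm_nonneg _) h4
  have h6 : gauge a b ≤ gauge a c + gauge c b + (gauge a c + gauge c b) := by
    have : gauge a b = ‖(1 - herm a c) + herm a c * (1 - herm c b) - herm a' b'‖ := by
      rw [← key]; rfl
    rw [this]
    refine (norm_sub_le _ _).trans (add_le_add ((norm_add_le _ _).trans ?_) h3)
    exact add_le_add le_rfl h5
  linarith

/-- Replacing `c` by its radial projection at most doubles the gauge. -/
lemma gauge_normalize_le {a c : Cn n} (ha : ‖a‖ ≤ 1) (hc : ‖c‖ ≤ 1) {η : Cn n} (hη : ‖η‖ = 1)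
    (h : c = ((‖c‖ : ℝ) : ℂ) • η) : gauge a η ≤ 2 * gauge a c := by
  have h1 := one_sub_norm_le_gauge (z := c) ha
  rw [gauge_comm] at h1
  have h2 : herm a c = (‖c‖ : ℂ) * herm a η := by
    conv_lhs => rw [h]
    rw [herm_smul_right, Complex.conj_ofReal]
  have h4 : ‖herm a η‖ ≤ 1 := (norm_herm_le a η).trans (by rw [hη, mul_one]; exact ha)
  have h3 : 1 - herm a η = (1 - herm a c) - ((1 - ‖c‖ : ℝ) : ℂ) * herm a η := by
    rw [h2]; push_cast; ring
  unfold gauge at *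
  rw [h3]
  refine (norm_sub_le _ _).trans ?_
  rw [norm_mul, Complex.norm_real, Real.norm_of_nonneg (by linarith)]
  have : (1 - ‖c‖) * ‖herm a η‖ ≤ 1 - ‖c‖ := mul_le_of_le_one_right (by linarith) h4
  linarith

lemma exists_normalize {c : Cn n} (hc : c ≠ 0) :
    ∃ η : Cn n, ‖η‖ = 1 ∧ c = ((‖c‖ : ℝ) : ℂ) • η ∧ η = ((‖c‖⁻¹ : ℝ) : ℂ) • c := by
  have h0 : ‖c‖ ≠ 0 := norm_ne_zero_iff.2 hc
  refine ⟨((‖c‖⁻¹ : ℝ) : ℂ) • c, ?_, ?_, rfl⟩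
  · rw [norm_smul, Complex.norm_real, norm_inv, norm_norm, inv_mul_cancel₀ h0]
  · rw [smul_smul, ← Complex.ofReal_mul, mul_inv_cancel₀ h0]; simp

/-- The gauge satisfies a quasi-triangle inequality on the closed ball. -/
lemma gauge_triangle {a b c : Cn n} (ha : ‖a‖ ≤ 1) (hb : ‖b‖ ≤ 1) (hc : ‖c‖ ≤ 1) :
    gauge a b ≤ 4 * (gauge a c + gauge c b) := by
  rcases eq_or_ne c 0 with rfl | h0
  · have := gauge_le_two ha hb
    have h1 : gauge a 0 = 1 := by simp [gauge, herm]
    have h2 : gauge (0 : Cn n) b = 1 := by simp [gauge, herm]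
    rw [h1, h2]; linarith
  · obtain ⟨η, hη, h, -⟩ := exists_normalize h0
    have h1 := gauge_normalize_le ha hc hη h
    have h2 := gauge_normalize_le hb hc hη h
    have h3 := gauge_triangle_sphere ha hb hη
    rw [gauge_comm η b] at h3
    rw [gauge_comm c b]
    linarith

/-- Moving a point of the ball radially to the sphere at most doubles the gauge. -/
lemma gauge_le_of_smul {η ζ : Cn n} (hη : ‖η‖ = 1) (hζ : ‖ζ‖ = 1) {r : ℝ} (h0 : 0 ≤ r)
    (h1 : r ≤ 1) : gauge η ζ ≤ 2 * gauge ((r : ℂ) • η) ζ := by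
  have hr : ‖(r : ℂ) • η‖ = r := by
    rw [norm_smul, hη, Complex.norm_real, Real.norm_of_nonneg h0, mul_one]
  have := gauge_normalize_le (a := ζ) (c := (r : ℂ) • η) hζ.le (hr.le.trans h1) hη (by rw [hr])
  rwa [gauge_comm, gauge_comm _ ζ]

/-! ### Measures of nonisotropic balls -/

lemma finrank_Cn : Module.finrank ℝ (Cn n) = 2 * n := by
  rw [← Module.finrank_mul_finrank ℝ ℂ]; simp

lemma volume_unitBall_ne_zero : (volume : Measure (Cn n)) (unitBall n) ≠ 0 :=
  (measure_ball_pos volume 0 one_pos).ne'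

lemma volume_unitBall_ne_top : (volume : Measure (Cn n)) (unitBall n) ≠ ∞ :=
  measure_ball_lt_top.ne

instance : IsProbabilityMeasure (V n) := by
  refine ⟨?_⟩
  simp only [V, Measure.smul_apply, Measure.restrict_apply_univ, smul_eq_mul]
  exact ENNReal.inv_mul_cancel volume_unitBall_ne_zero volume_unitBall_ne_top

lemma ae_V_mem : ∀ᵐ z ∂(V n), z ∈ unitBall n :=
  Measure.ae_smul_measure (ae_restrict_mem measurableSet_unitBall) _

open scoped Pointwise in
/-- The normalized surface measure of a set is the normalized volume of the cone over it. -/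
lemma sigma_apply (hn : 1 ≤ n) {A : Set (sphere (0 : Cn n) 1)} (hA : MeasurableSet A) :
    σ n A = (volume (unitBall n))⁻¹ *
      volume (Ioo (0 : ℝ) 1 • ((↑) '' A : Set (Cn n))) := by
  have h1 : ((Module.finrank ℝ (Cn n) : ℕ) : ℝ≥0∞) ≠ 0 := by
    rw [finrank_Cn]; simp; omega
  have h2 : ((Module.finrank ℝ (Cn n) : ℕ) : ℝ≥0∞) ≠ ∞ := by simp
  simp only [σ, Measure.smul_apply, smul_eq_mul]
  rw [Measure.toSphere_apply' _ hA, Measure.toSphere_apply_univ]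
  change ((Module.finrank ℝ (Cn n) : ℝ≥0∞) * volume (unitBall n))⁻¹ * _ = _
  rw [ENNReal.mul_inv (Or.inl h1) (Or.inl h2), mul_mul_mul_comm, ENNReal.inv_mul_cancel h1 h2,
    one_mul]

lemma isProbabilityMeasure_sigma (hn : 1 ≤ n) : IsProbabilityMeasure (σ n) := by
  refine ⟨?_⟩
  simp only [σ, Measure.smul_apply, smul_eq_mul]
  refine ENNReal.inv_mul_cancel ?_ (measure_ne_top _ _)
  rw [Measure.toSphere_apply_univ, finrank_Cn]
  refine mul_ne_zero ?_ volume_unitBall_ne_zero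
  simp; omega

instance : SFinite (σ n) := by unfold σ; infer_instance

/-- A unitary change of coordinates making `⟨u, η⟩` a coordinate. -/
lemma exists_unitary_coord (i₀ : Fin n) {η : Cn n} (hη : ‖η‖ = 1) :
    ∃ e : Cn n ≃ₗᵢ[ℂ] Cn n, ∀ u, (e u) i₀ = herm u η := by
  have hv : Orthonormal ℂ (({i₀} : Set (Fin n)).domRestrict fun _ : Fin n => η) := by
    refine ⟨fun i => hη, fun i j hij => (hij (Subsingleton.elim i j)).elim⟩
  obtain ⟨b, hb⟩ := hv.exists_orthonormalBasis_extension_of_card_eq (by simp)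
  refine ⟨b.repr, fun u => ?_⟩
  rw [OrthonormalBasis.repr_apply_apply, hb i₀ rfl]; rfl

lemma measurePreserving_unitary (e : Cn n ≃ₗᵢ[ℂ] Cn n) :
    MeasurePreserving e (volume : Measure (Cn n)) volume :=
  LinearIsometryEquiv.measurePreserving (E := Cn n) (F := Cn n)
    { e.toLinearEquiv.restrictScalars ℝ with norm_map' := e.norm_map }

/-- In coordinates, volume on `ℂⁿ` is a multiple of the product measure. -/
lemma exists_map_ofLp_volume (n : ℕ) : ∃ c : ℝ≥0, c ≠ 0 ∧
    Measure.map (WithLp.ofLp : Cn n → Fin n → ℂ) volume = (c : ℝ≥0∞) • volume := by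
  let L : Cn n ≃L[ℝ] (Fin n → ℂ) := (PiLp.continuousLinearEquiv 2 ℝ (fun _ : Fin n => ℂ))
  have hL : (WithLp.ofLp : Cn n → Fin n → ℂ) = L := rfl
  rw [hL]
  have : (Measure.map L (volume : Measure (Cn n))).IsAddHaarMeasure :=
    L.isAddHaarMeasure_map _
  refine ⟨Measure.addHaarScalarFactor (Measure.map L volume) volume,
    (Measure.addHaarScalarFactor_pos_of_isAddHaarMeasure _ _).ne', ?_⟩
  exact Measure.isAddLeftInvariant_eq_smul _ _

lemma exists_volume_box (n : ℕ) : ∃ c : ℝ≥0, c ≠ 0 ∧ ∀ B : Fin n → Set ℂ,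
    (∀ i, MeasurableSet (B i)) →
      volume {u : Cn n | ∀ i, u i ∈ B i} = (c : ℝ≥0∞) * ∏ i, volume (B i) := by
  obtain ⟨c, hc, h⟩ := exists_map_ofLp_volume n
  refine ⟨c, hc, fun B hB => ?_⟩
  have hm : MeasurableSet (Set.pi univ B) := MeasurableSet.univ_pi hB
  have : {u : Cn n | ∀ i, u i ∈ B i} = WithLp.ofLp ⁻¹' (Set.pi univ B) := by
    ext u; simp
  rw [this, ← Measure.map_apply (by fun_prop) hm, h, Measure.smul_apply, volume_pi_pi,
    smul_eq_mul]

lemma volume_reProdIm (s t : Set ℝ) : volume (s ×ℂ t) = volume s * volume t := by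
  have h : s ×ℂ t = Complex.measurableEquivRealProd ⁻¹' (s ×ˢ t) := by
    ext z; simp [Complex.mem_reProdIm, Complex.measurableEquivRealProd]
  rw [h, Complex.volume_preserving_equiv_real_prod.measure_preimage_equiv, Measure.volume_eq_prod,
    Measure.prod_prod]

lemma measurableSet_sphere_cap (η : Cn n) (δ : ℝ) :
    MeasurableSet {ζ : sphere (0 : Cn n) 1 | gauge η ζ < δ} :=
  measurableSet_lt (continuous_gauge.comp
    (by fun_prop : Continuous fun ζ : sphere (0 : Cn n) 1 => (η, (ζ : Cn n)))).measurable
    measurable_const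

open scoped Pointwise in
/-- The open cone over the spherical cap `{ζ : |1 - ⟨η, ζ⟩| < δ}`. -/
lemma cone_sphere_cap (η : Cn n) (δ : ℝ) :
    Ioo (0 : ℝ) 1 • ((↑) '' {ζ : sphere (0 : Cn n) 1 | gauge η ζ < δ} : Set (Cn n)) =
      {u | u ≠ 0 ∧ ‖u‖ < 1 ∧ ‖((‖u‖ : ℝ) : ℂ) - herm u η‖ < δ * ‖u‖} := by
  have key : ∀ (r : ℝ) (ζ : Cn n), 0 < r →
      ‖(r : ℂ) - herm ((r : ℂ) • ζ) η‖ = r * gauge η ζ := by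
    intro r ζ hr
    rw [herm_smul_left, gauge_comm, gauge, ← mul_one_sub, norm_mul, Complex.norm_real,
      Real.norm_of_nonneg hr.le]
  ext u
  constructor
  · rintro ⟨r, hr, -, ⟨ζ, hζ, rfl⟩, rfl⟩
    have h1 : ‖(ζ : Cn n)‖ = 1 := by simp
    have h2 : ‖r • (ζ : Cn n)‖ = r := by rw [norm_smul, h1, mul_one, Real.norm_of_nonneg hr.1.le]
    refine ⟨?_, ?_, ?_⟩
    · rw [← norm_ne_zero_iff, h2]; exact hr.1.ne'
    · change ‖r • (ζ : Cn n)‖ < 1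
      rw [h2]; exact hr.2
    · change ‖((‖r • (ζ : Cn n)‖ : ℝ) : ℂ) - herm (r • (ζ : Cn n)) η‖ < δ * ‖r • (ζ : Cn n)‖
      rw [h2, ← Complex.coe_smul, key r ζ hr.1, mul_comm]
      exact mul_lt_mul_of_pos_right hζ hr.1
  · rintro ⟨h0, h1, h2⟩
    obtain ⟨ζ, hζ, h, -⟩ := exists_normalize h0
    have hpos : 0 < ‖u‖ := norm_pos_iff.2 h0
    refine ⟨‖u‖, ⟨hpos, h1⟩, ζ, ⟨⟨ζ, by simp [hζ]⟩, ?_, rfl⟩, ?_⟩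
    · have h3 := key ‖u‖ ζ hpos
      rw [← h] at h3
      rw [h3, mul_comm] at h2
      exact lt_of_mul_lt_mul_right h2 hpos.le
    · change ‖u‖ • ζ = u
      rw [← Complex.coe_smul]; exact h.symm

lemma norm_sq_eq_add_sum_erase (i₀ : Fin n) (u : Cn n) :
    ‖u‖ ^ 2 = ‖u i₀‖ ^ 2 + ∑ i ∈ Finset.univ.erase i₀, ‖u i‖ ^ 2 := by
  rw [EuclideanSpace.norm_sq_eq, ← Finset.add_sum_erase _ _ (Finset.mem_univ i₀)]

lemma prod_box (i₀ : Fin n) (a b : ℝ≥0∞) :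
    ∏ i : Fin n, (if i = i₀ then a else b) = a * b ^ (n - 1) := by
  rw [← Finset.mul_prod_erase _ _ (Finset.mem_univ i₀), if_pos rfl]
  congr 1
  rw [Finset.prod_congr rfl (fun i hi => if_neg (Finset.ne_of_mem_erase hi)), Finset.prod_const,
    Finset.card_erase_of_mem (Finset.mem_univ _)]
  simp

/-- A measurable box in `ℂⁿ` with one distinguished coordinate. -/
lemma exists_volume_box' (n : ℕ) : ∃ c : ℝ≥0, c ≠ 0 ∧ ∀ (i₀ : Fin n) (A B : Set ℂ),
    MeasurableSet A → MeasurableSet B → ∀ e : Cn n ≃ₗᵢ[ℂ] Cn n,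
      volume (e ⁻¹' {u : Cn n | ∀ i, u i ∈ if i = i₀ then A else B}) =
        (c : ℝ≥0∞) * (volume A * volume B ^ (n - 1)) := by
  obtain ⟨c, hc, h⟩ := exists_volume_box n
  refine ⟨c, hc, fun i₀ A B hA hB e => ?_⟩
  have hm : ∀ i : Fin n, MeasurableSet (if i = i₀ then A else B) := by
    intro i; split_ifs <;> assumption
  have hm' : MeasurableSet {u : Cn n | ∀ i, u i ∈ if i = i₀ then A else B} := by
    have : {u : Cn n | ∀ i, u i ∈ if i = i₀ then A else B} =
        WithLp.ofLp ⁻¹' (Set.pi univ fun i => if i = i₀ then A else B) := by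
      ext u; simp
    rw [this]
    exact (by fun_prop : Measurable (WithLp.ofLp : Cn n → Fin n → ℂ)) (MeasurableSet.univ_pi hm)
  rw [(measurePreserving_unitary e).measure_preimage hm'.nullMeasurableSet, h _ hm]
  congr 1
  rw [← prod_box i₀]
  refine Finset.prod_congr rfl fun i _ => ?_
  split_ifs <;> rfl

/-- A spherical cap of gauge radius `δ` has measure `O(δⁿ)`: the cone over it lies in a box with
one side of length `O(1)`, one of length `O(δ)` and `2n - 2` of length `O(√δ)`. -/
lemma sigma_cap_le (hn : 1 ≤ n) : ∃ C : ℝ≥0, ∀ η : Cn n, ‖η‖ = 1 → ∀ δ : ℝ, 0 < δ →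
    σ n {ζ | gauge η ζ < δ} ≤ C * ENNReal.ofReal (δ ^ n) := by
  obtain ⟨c, -, hbox⟩ := exists_volume_box' n
  let i₀ : Fin n := ⟨0, hn⟩
  refine ⟨(volume (unitBall n))⁻¹.toNNReal * c * (4 * (2 * NNReal.pi) ^ (n - 1)), fun η hη δ hδ => ?_⟩
  obtain ⟨e, he⟩ := exists_unitary_coord i₀ hη
  rw [sigma_apply hn (measurableSet_sphere_cap η δ), cone_sphere_cap]
  have hsub : {u : Cn n | u ≠ 0 ∧ ‖u‖ < 1 ∧ ‖((‖u‖ : ℝ) : ℂ) - herm u η‖ < δ * ‖u‖} ⊆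
      e ⁻¹' {u : Cn n | ∀ i, u i ∈ if i = i₀ then (Icc (-1) 1 ×ℂ Icc (-δ) δ)
        else closedBall (0 : ℂ) (√(2 * δ))} := by
    rintro u ⟨-, h1, h2⟩ i
    have h3 : ‖((‖u‖ : ℝ) : ℂ) - herm u η‖ < δ := h2.trans_le (by nlinarith [norm_nonneg u])
    have h4 : ‖herm u η‖ ≤ ‖u‖ := (norm_herm_le u η).trans (by rw [hη, mul_one])
    split_ifs with hi
    · subst hi
      rw [he, Complex.mem_reProdIm]
      have hre := (Complex.abs_re_le_norm (herm u η)).trans (h4.trans h1.le)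
      have him := (Complex.abs_im_le_norm (((‖u‖ : ℝ) : ℂ) - herm u η)).trans h3.le
      simp only [Complex.sub_im, Complex.ofReal_im, zero_sub, abs_neg] at him
      exact ⟨abs_le.1 hre, abs_le.1 him⟩
    · have h5 := norm_sq_eq_add_sum_erase i₀ (e u)
      rw [e.norm_map, he] at h5
      have h6 : ‖e u i‖ ^ 2 ≤ ∑ i ∈ Finset.univ.erase i₀, ‖e u i‖ ^ 2 :=
        Finset.single_le_sum (f := fun i => ‖e u i‖ ^ 2) (fun _ _ => sq_nonneg _)
          (Finset.mem_erase.2 ⟨hi, Finset.mem_univ _⟩)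
      have h7 : ‖u‖ - ‖herm u η‖ ≤ δ := by
        have := norm_sub_norm_le ((‖u‖ : ℝ) : ℂ) (herm u η)
        rw [Complex.norm_real, norm_norm] at this
        linarith
      rw [mem_closedBall_zero_iff]
      refine Real.le_sqrt_of_sq_le ?_
      nlinarith [norm_nonneg u, norm_nonneg (herm u η)]
  have hA : MeasurableSet (Icc (-1 : ℝ) 1 ×ℂ Icc (-δ) δ) :=
    (Complex.measurable_re measurableSet_Icc).inter (Complex.measurable_im measurableSet_Icc)
  have h1 := (measure_mono hsub).trans_eq (hbox i₀ _ _ hA measurableSet_closedBall e)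
  rw [volume_reProdIm, Complex.volume_closedBall, Real.volume_Icc, Real.volume_Icc] at h1
  refine (mul_le_mul' le_rfl h1).trans (le_of_eq ?_)
  have e1 : ENNReal.ofReal √(2 * δ) ^ 2 = 2 * ENNReal.ofReal δ := by
    rw [← ENNReal.ofReal_pow (Real.sqrt_nonneg _), Real.sq_sqrt (by positivity),
      ENNReal.ofReal_mul (by norm_num)]
    simp
  have e2 : ENNReal.ofReal (1 - -1) * ENNReal.ofReal (δ - -δ) = 4 * ENNReal.ofReal δ := by
    rw [← ENNReal.ofReal_mul (by norm_num), show (1 - -1) * (δ - -δ) = 4 * δ by ring,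
      ENNReal.ofReal_mul (by norm_num)]
    simp
  rw [e1, e2, ENNReal.ofReal_pow hδ.le]
  push_cast
  rw [ENNReal.coe_toNNReal (ENNReal.inv_ne_top.2 volume_unitBall_ne_zero)]
  obtain ⟨m, rfl⟩ : ∃ m, n = m + 1 := ⟨n - 1, by omega⟩
  simp only [Nat.add_sub_cancel]
  ring

/-- A spherical cap of gauge radius `δ ≤ 1` has measure at least a multiple of `δⁿ`: the cone
over it contains a box with sides of the same orders of magnitude as in `sigma_cap_le`. -/
lemma le_sigma_cap (hn : 1 ≤ n) : ∃ c : ℝ≥0, c ≠ 0 ∧ ∀ η : Cn n, ‖η‖ = 1 → ∀ δ : ℝ, 0 < δ →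
    δ ≤ 1 → c * ENNReal.ofReal (δ ^ n) ≤ σ n {ζ | gauge η ζ < δ} := by
  obtain ⟨c, hc0, hbox⟩ := exists_volume_box' n
  let i₀ : Fin n := ⟨0, hn⟩
  have hn0 : (0 : ℝ) < n := by exact_mod_cast hn
  -- The `n - 1` coordinates orthogonal to `η` have square norms at most `κ δ`, with sum `≤ δ / 32`.
  set κ : ℝ := 1 / (32 * n) with hκ
  have hκ0 : 0 < κ := by positivity
  have hκn : n * κ = 1 / 32 := by rw [hκ]; field_simp
  have hvol : (volume (unitBall n))⁻¹.toNNReal ≠ 0 := by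
    rw [ne_eq, ENNReal.toNNReal_eq_zero_iff]
    simp [volume_unitBall_ne_zero, volume_unitBall_ne_top]
  refine ⟨(volume (unitBall n))⁻¹.toNNReal * c * ((1 / 64) *
    (κ.toNNReal * NNReal.pi) ^ (n - 1)), ?_, fun η hη δ hδ hδ1 => ?_⟩
  · have : κ.toNNReal ≠ 0 := (Real.toNNReal_pos.2 hκ0).ne'
    have := NNReal.pi_pos.ne'
    positivity
  obtain ⟨e, he⟩ := exists_unitary_coord i₀ hη
  rw [sigma_apply hn (measurableSet_sphere_cap η δ), cone_sphere_cap]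
  have hsub : e ⁻¹' {u : Cn n | ∀ i, u i ∈ if i = i₀ then
      (Ioo (1 / 4) (1 / 2) ×ℂ Ioo (-(δ / 32)) (δ / 32)) else ball (0 : ℂ) (√(κ * δ))} ⊆
      {u : Cn n | u ≠ 0 ∧ ‖u‖ < 1 ∧ ‖((‖u‖ : ℝ) : ℂ) - herm u η‖ < δ * ‖u‖} := by
    intro u hu
    have h0 := hu i₀
    rw [if_pos rfl, he, Complex.mem_reProdIm] at h0
    obtain ⟨⟨hx1, hx2⟩, hy⟩ := h0
    set x := (herm u η).re
    set y := (herm u η).im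
    have hy' : |y| < δ / 32 := abs_lt.2 hy
    have h5 := norm_sq_eq_add_sum_erase i₀ (e u)
    rw [e.norm_map, he] at h5
    set S := ∑ i ∈ Finset.univ.erase i₀, ‖e u i‖ ^ 2 with hSdef
    have hS0 : 0 ≤ S := Finset.sum_nonneg fun _ _ => sq_nonneg _
    have hS : S ≤ δ / 32 := by
      have h6 : ∀ i ∈ Finset.univ.erase i₀, ‖e u i‖ ^ 2 ≤ κ * δ := by
        intro i hi
        have h7 := hu i
        rw [if_neg (Finset.ne_of_mem_erase hi), mem_ball_zero_iff, Real.lt_sqrt (norm_nonneg _)]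
          at h7
        exact h7.le
      have h8 := Finset.sum_le_card_nsmul _ _ _ h6
      rw [Finset.card_erase_of_mem (Finset.mem_univ _), Finset.card_univ, Fintype.card_fin,
        nsmul_eq_mul, Nat.cast_sub hn, Nat.cast_one] at h8
      have : (n - 1 : ℝ) * (κ * δ) ≤ n * κ * δ := by nlinarith [mul_pos hκ0 hδ]
      rw [hκn] at this
      linarith
    have hnh : ‖herm u η‖ ^ 2 = x ^ 2 + y ^ 2 := by
      rw [← Complex.normSq_eq_norm_sq, Complex.normSq_apply]; ring
    rw [hnh] at h5
    have hy2 : y ^ 2 ≤ δ / 32 := by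
      rw [← sq_abs]; nlinarith [abs_nonneg y]
    have hu0 := norm_nonneg u
    have hux : x ≤ ‖u‖ := by nlinarith
    have hu1 : ‖u‖ < 1 := by nlinarith
    refine ⟨?_, hu1, ?_⟩
    · rw [← norm_pos_iff]; linarith
    · have h9 : ‖u‖ - x ≤ δ / 8 := by nlinarith
      have h10 : ‖((‖u‖ : ℝ) : ℂ) - herm u η‖ ≤ |‖u‖ - x| + |y| := by
        refine (Complex.norm_le_abs_re_add_abs_im _).trans (le_of_eq ?_)
        simp [x, y]
      rw [abs_of_nonneg (by linarith)] at h10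
      nlinarith
  have hA : MeasurableSet (Ioo (1 / 4 : ℝ) (1 / 2) ×ℂ Ioo (-(δ / 32)) (δ / 32)) :=
    (Complex.measurable_re measurableSet_Ioo).inter (Complex.measurable_im measurableSet_Ioo)
  have h1 := (hbox i₀ _ _ hA measurableSet_ball e).symm.le.trans (measure_mono hsub)
  rw [volume_reProdIm, Complex.volume_ball, Real.volume_Ioo, Real.volume_Ioo] at h1
  refine (le_of_eq ?_).trans (mul_le_mul' le_rfl h1)
  have e1 : ENNReal.ofReal √(κ * δ) ^ 2 = κ.toNNReal * ENNReal.ofReal δ := by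
    rw [← ENNReal.ofReal_pow (Real.sqrt_nonneg _), Real.sq_sqrt (by positivity),
      ENNReal.ofReal_mul hκ0.le]
    rfl
  have e2 : ENNReal.ofReal (1 / 2 - 1 / 4) * ENNReal.ofReal (δ / 32 - -(δ / 32)) =
      ((1 / 64 : ℝ≥0) : ℝ≥0∞) * ENNReal.ofReal δ := by
    rw [← ENNReal.ofReal_mul (by norm_num),
      show (1 / 2 - 1 / 4) * (δ / 32 - -(δ / 32)) = (1 / 64) * δ by ring,
      ENNReal.ofReal_mul (by norm_num)]
    congr 1
    rw [ENNReal.ofReal, Real.toNNReal_div (by norm_num)]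
    norm_num
  rw [e1, e2, ENNReal.ofReal_pow hδ.le]
  push_cast
  rw [ENNReal.coe_toNNReal (ENNReal.inv_ne_top.2 volume_unitBall_ne_zero)]
  obtain ⟨m, rfl⟩ : ∃ m, n = m + 1 := ⟨n - 1, by omega⟩
  simp only [Nat.add_sub_cancel]
  ring

/-! ### Polar coordinates and weighted volume of nonisotropic balls -/

lemma lintegral_polar {F : Cn n → ℝ≥0∞} (hn : 1 ≤ n) (hF : Measurable F) :
    ∫⁻ u, F u ∂(volume : Measure (Cn n)) =
      ∫⁻ ζ : sphere (0 : Cn n) 1, ∫⁻ r in Ioi (0 : ℝ),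
        ENNReal.ofReal (r ^ (2 * n - 1)) * F ((r : ℂ) • (ζ : Cn n))
        ∂volume ∂(volume : Measure (Cn n)).toSphere := by
  have : Nonempty (Fin n) := ⟨⟨0, hn⟩⟩
  have hmp := (volume : Measure (Cn n)).measurePreserving_homeomorphUnitSphereProd
  have hG : Measurable fun p : sphere (0 : Cn n) 1 × Ioi (0 : ℝ) =>
      F (((p.2 : ℝ) : ℂ) • (p.1 : Cn n)) := by fun_prop
  calc ∫⁻ u, F u ∂(volume : Measure (Cn n))
      = ∫⁻ u in ({0}ᶜ : Set (Cn n)), F u := by rw [restrict_compl_singleton]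
    _ = ∫⁻ u : ({0}ᶜ : Set (Cn n)), F u ∂((volume : Measure (Cn n)).comap (↑)) := by
        rw [lintegral_subtype_comap (measurableSet_singleton _).compl]
    _ = ∫⁻ p, F (((p.2 : ℝ) : ℂ) • (p.1 : Cn n)) ∂((volume : Measure (Cn n)).toSphere.prod
          (.volumeIoiPow (Module.finrank ℝ (Cn n) - 1))) := by
        rw [← hmp.lintegral_comp hG]
        refine lintegral_congr fun u => ?_
        congr 1
        have h0 : ‖(u : Cn n)‖ ≠ 0 := norm_ne_zero_iff.2 u.2
        simp only [homeomorphUnitSphereProd_apply_snd_coe, homeomorphUnitSphereProd_apply_fst_coe]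
        rw [Complex.coe_smul, smul_smul, mul_inv_cancel₀ h0, one_smul]
    _ = ∫⁻ ζ : sphere (0 : Cn n) 1, ∫⁻ r : Ioi (0 : ℝ), F (((r : ℝ) : ℂ) • (ζ : Cn n))
          ∂(.volumeIoiPow (Module.finrank ℝ (Cn n) - 1))
          ∂(volume : Measure (Cn n)).toSphere := lintegral_prod _ hG.aemeasurable
    _ = _ := by
        refine lintegral_congr fun ζ => ?_
        rw [Measure.volumeIoiPow, lintegral_withDensity_eq_lintegral_mul _ (by fun_prop)
          (by fun_prop), finrank_Cn]
        exact lintegral_subtype_comap measurableSet_Ioi fun r : ℝ =>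
          ENNReal.ofReal (r ^ (2 * n - 1)) * F ((r : ℂ) • (ζ : Cn n))

lemma lintegral_V_polar {F : Cn n → ℝ≥0∞} (hn : 1 ≤ n) (hF : Measurable F) :
    ∫⁻ u, F u ∂(V n) = ∫⁻ ζ : sphere (0 : Cn n) 1, ∫⁻ r in Ioo (0 : ℝ) 1,
      ENNReal.ofReal (2 * n * r ^ (2 * n - 1)) * F ((r : ℂ) • (ζ : Cn n)) ∂volume ∂(σ n) := by
  have hind : Measurable ((unitBall n).indicator F) := hF.indicator measurableSet_unitBall
  rw [V, lintegral_smul_measure, ← lintegral_indicator measurableSet_unitBall,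
    lintegral_polar hn hind, σ, lintegral_smul_measure]
  have e1 : ∀ ζ : sphere (0 : Cn n) 1, ∫⁻ r in Ioi (0 : ℝ),
      ENNReal.ofReal (r ^ (2 * n - 1)) * (unitBall n).indicator F ((r : ℂ) • (ζ : Cn n)) =
      ∫⁻ r in Ioo (0 : ℝ) 1, ENNReal.ofReal (r ^ (2 * n - 1)) * F ((r : ℂ) • (ζ : Cn n)) := by
    intro ζ
    rw [← lintegral_indicator measurableSet_Ioi, ← lintegral_indicator measurableSet_Ioo]
    refine lintegral_congr fun r => ?_
    by_cases h0 : 0 < r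
    · have hr : ‖(r : ℂ) • (ζ : Cn n)‖ = r := by
        rw [norm_smul, Complex.norm_real, Real.norm_of_nonneg h0.le]; simp
      by_cases h1 : r < 1
      · rw [indicator_of_mem (mem_Ioi.2 h0), indicator_of_mem (mem_Ioo.2 ⟨h0, h1⟩),
          indicator_of_mem (mem_unitBall.2 (hr.trans_lt h1))]
      · rw [indicator_of_mem (mem_Ioi.2 h0), indicator_of_notMem (fun h : r ∈ Ioo 0 1 => h1 h.2),
          indicator_of_notMem
            (fun h : (r : ℂ) • (ζ : Cn n) ∈ unitBall n => h1 (hr ▸ mem_unitBall.1 h)), mul_zero]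
    · rw [indicator_of_notMem (fun h : r ∈ Ioi 0 => h0 h),
        indicator_of_notMem (fun h : r ∈ Ioo 0 1 => h0 h.1)]
  simp_rw [e1]
  have e2 : ∀ ζ : sphere (0 : Cn n) 1, ∫⁻ r in Ioo (0 : ℝ) 1,
      ENNReal.ofReal (2 * n * r ^ (2 * n - 1)) * F ((r : ℂ) • (ζ : Cn n)) =
      (2 * n : ℝ≥0∞) * ∫⁻ r in Ioo (0 : ℝ) 1,
        ENNReal.ofReal (r ^ (2 * n - 1)) * F ((r : ℂ) • (ζ : Cn n)) := by
    intro ζ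
    rw [← lintegral_const_mul _ (by fun_prop)]
    refine lintegral_congr fun r => ?_
    rw [ENNReal.ofReal_mul (by positivity), ENNReal.ofReal_mul (by norm_num)]
    simp [mul_assoc]
  simp_rw [e2]
  rw [lintegral_const_mul' _ _ (by finiteness), smul_eq_mul, smul_eq_mul, ← mul_assoc,
    Measure.toSphere_apply_univ, finrank_Cn]
  congr 1
  have h1 : (2 * n : ℝ≥0∞) ≠ 0 := by simp; omega
  have h2 : (2 * n : ℝ≥0∞) ≠ ∞ := by finiteness
  push_cast
  rw [ENNReal.mul_inv (Or.inl h1) (Or.inl h2), mul_assoc, mul_comm _ (2 * n : ℝ≥0∞), ← mul_assoc,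
    ENNReal.inv_mul_cancel h1 h2, one_mul]
  rfl

/-- The weighted volume `(1 - |z|²)^t dV(z)`. -/
noncomputable def weightedV (n : ℕ) (t : ℝ) : Measure (Cn n) :=
  (V n).withDensity fun z => ENNReal.ofReal ((1 - ‖z‖ ^ 2) ^ t)

lemma measurable_weight (t : ℝ) :
    Measurable fun z : Cn n => ENNReal.ofReal ((1 - ‖z‖ ^ 2) ^ t) := by fun_prop

instance (t : ℝ) : SFinite (weightedV n t) := by unfold weightedV; infer_instance

lemma weightedV_absolutelyContinuous (t : ℝ) : weightedV n t ≪ V n :=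
  withDensity_absolutelyContinuous _ _

lemma ae_weightedV_mem (t : ℝ) : ∀ᵐ z ∂(weightedV n t), z ∈ unitBall n :=
  (weightedV_absolutelyContinuous t).ae_le ae_V_mem

lemma lintegral_weightedV (t : ℝ) (F : Cn n → ℝ≥0∞) :
    ∫⁻ z, F z ∂(weightedV n t) = ∫⁻ z, ENNReal.ofReal ((1 - ‖z‖ ^ 2) ^ t) * F z ∂(V n) :=
  lintegral_withDensity_eq_lintegral_mul_non_measurable _ (measurable_weight t)
    (Filter.Eventually.of_forall fun _ => ENNReal.ofReal_lt_top) F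

/-- Shifting powers of the weight between the measure and the integrand. -/
lemma lintegral_weightedV_add (s t : ℝ) (F : Cn n → ℝ≥0∞) :
    ∫⁻ z, F z ∂(weightedV n (s + t)) =
      ∫⁻ z, ENNReal.ofReal ((1 - ‖z‖ ^ 2) ^ s) * F z ∂(weightedV n t) := by
  rw [lintegral_weightedV, lintegral_weightedV]
  refine lintegral_congr_ae ?_
  filter_upwards [ae_V_mem] with z hz
  have h := one_sub_norm_sq_pos (mem_unitBall.1 hz)
  rw [Real.rpow_add h, ENNReal.ofReal_mul (by positivity)]
  ring

/-- Uniformly in the centre, the weighted volume of nonisotropic balls is `O(δ^{n+1+t})`. -/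
lemma weightedV_cap_le (hn : 1 ≤ n) {t : ℝ} (ht : -1 < t) : ∃ C : ℝ≥0, ∀ ζ : Cn n, ‖ζ‖ = 1 →
    ∀ δ : ℝ, 0 < δ → weightedV n t (cap ζ δ) ≤ C * ENNReal.ofReal (δ ^ (n + 1 + t)) := by
  obtain ⟨C, hC⟩ := sigma_cap_le hn
  refine ⟨C * 2 ^ n * Real.toNNReal (2 * n * 2 ^ |t| * (1 / (t + 1))), fun ζ hζ δ hδ => ?_⟩
  have hm := measurableSet_cap ζ δ
  rw [← lintegral_indicator_one hm, lintegral_weightedV, lintegral_V_polar (F := fun z =>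
      ENNReal.ofReal ((1 - ‖z‖ ^ 2) ^ t) * (cap ζ δ).indicator 1 z) hn
    ((measurable_weight t).mul (measurable_one.indicator hm))]
  set A : Set (sphere (0 : Cn n) 1) := {ζ' | gauge ζ ζ' < 2 * δ} with hA
  have hAm : MeasurableSet A := measurableSet_sphere_cap ζ (2 * δ)
  set I := ∫⁻ r in Ioo (1 - δ) 1, ENNReal.ofReal (2 * n * 2 ^ |t| * (1 - r) ^ t) with hI
  have hpt : ∀ ζ' : sphere (0 : Cn n) 1, (∫⁻ r in Ioo (0 : ℝ) 1,
      ENNReal.ofReal (2 * n * r ^ (2 * n - 1)) * (ENNReal.ofReal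
        ((1 - ‖(r : ℂ) • (ζ' : Cn n)‖ ^ 2) ^ t) * (cap ζ δ).indicator 1 ((r : ℂ) • (ζ' : Cn n))))
      ≤ A.indicator (fun _ => I) ζ' := by
    intro ζ'
    have h1 : ‖(ζ' : Cn n)‖ = 1 := by simp
    by_cases hζ' : ζ' ∈ A
    · rw [indicator_of_mem hζ', hI, ← lintegral_indicator measurableSet_Ioo,
        ← lintegral_indicator measurableSet_Ioo]
      refine lintegral_mono fun r => ?_
      by_cases hr : r ∈ Ioo (0 : ℝ) 1
      · rw [indicator_of_mem hr]
        have h2 : ‖(r : ℂ) • (ζ' : Cn n)‖ = r := by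
          rw [norm_smul, h1, mul_one, Complex.norm_real, Real.norm_of_nonneg hr.1.le]
        by_cases hz : (r : ℂ) • (ζ' : Cn n) ∈ cap ζ δ
        · have h3 := one_sub_norm_le_gauge (z := (r : ℂ) • (ζ' : Cn n)) hζ.le
          rw [h2] at h3
          rw [indicator_of_mem hz, indicator_of_mem (mem_Ioo.2 ⟨by linarith [hz.2], hr.2⟩), h2,
            Pi.one_apply, mul_one, ← ENNReal.ofReal_mul (by have := hr.1; positivity)]
          refine ENNReal.ofReal_le_ofReal ?_
          have hr1 : 0 < 1 - r := by linarith [hr.2]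
          have h4 : (1 - r ^ 2) ^ t ≤ 2 ^ |t| * (1 - r) ^ t := by
            rw [show 1 - r ^ 2 = (1 + r) * (1 - r) by ring,
              Real.mul_rpow (by linarith [hr.1]) hr1.le]
            refine mul_le_mul_of_nonneg_right ?_ (by positivity)
            calc (1 + r) ^ t ≤ (1 + r) ^ |t| :=
                  Real.rpow_le_rpow_of_exponent_le (by linarith [hr.1]) (le_abs_self t)
              _ ≤ 2 ^ |t| := Real.rpow_le_rpow (by linarith [hr.1]) (by linarith [hr.2])
                  (abs_nonneg t)
          have h5 : r ^ (2 * n - 1) ≤ 1 := pow_le_one₀ hr.1.le hr.2.le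
          have h6 : 0 ≤ (1 - r ^ 2) ^ t := Real.rpow_nonneg (by nlinarith [hr.1]) _
          calc 2 * n * r ^ (2 * n - 1) * (1 - r ^ 2) ^ t
              ≤ 2 * n * 1 * (1 - r ^ 2) ^ t := by gcongr
            _ ≤ 2 * n * 1 * (2 ^ |t| * (1 - r) ^ t) := by gcongr
            _ = _ := by ring
        · rw [indicator_of_notMem hz, mul_zero, mul_zero]
          exact zero_le
      · rw [indicator_of_notMem hr]; exact zero_le
    · rw [indicator_of_notMem hζ']
      refine le_of_eq ?_
      rw [setLIntegral_congr_fun measurableSet_Ioo (g := fun _ => 0), lintegral_zero]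
      intro r hr
      have hz : (r : ℂ) • (ζ' : Cn n) ∉ cap ζ δ := by
        intro hz
        refine hζ' ?_
        have := gauge_le_of_smul h1 hζ hr.1.le hr.2.le
        have h3 := hz.2
        rw [hA, mem_ofPred_eq, gauge_comm]
        linarith
      change _ * (_ * (cap ζ δ).indicator 1 ((r : ℂ) • (ζ' : Cn n))) = 0
      rw [indicator_of_notMem hz, mul_zero, mul_zero]
  refine (lintegral_mono hpt).trans ?_
  rw [lintegral_indicator_const hAm]
  have hIval : I = ENNReal.ofReal (2 * n * 2 ^ |t| * (1 / (t + 1))) * ENNReal.ofReal (δ ^ (t + 1)) := by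
    have h1 : ∫ r in (1 - δ)..1, (1 - r) ^ t = δ ^ (t + 1) / (t + 1) := by
      have h := intervalIntegral.integral_comp_sub_left (a := 1 - δ) (b := 1)
        (fun x : ℝ => x ^ t) 1
      rw [h, sub_self, sub_sub_cancel, integral_rpow (Or.inl ht), Real.zero_rpow (by linarith),
        sub_zero]
    have hint : IntervalIntegrable (fun r : ℝ => (1 - r) ^ t) volume (1 - δ) 1 := by
      have h := (intervalIntegral.intervalIntegrable_rpow' (a := 0) (b := δ) ht).comp_sub_left 1
      simpa using h.symm
    rw [hI, ← ofReal_integral_eq_lintegral_ofReal, integral_const_mul, ← integral_Ioc_eq_integral_Ioo,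
      ← intervalIntegral.integral_of_le (by linarith), h1, ← ENNReal.ofReal_mul]
    · congr 1; ring
    · have : 0 < t + 1 := by linarith
      positivity
    · refine Integrable.const_mul ?_ _
      rw [intervalIntegrable_iff_integrableOn_Ioo_of_le (by linarith)] at hint
      exact hint
    · filter_upwards [ae_restrict_mem measurableSet_Ioo] with r hr
      have : 0 ≤ (1 - r) ^ t := Real.rpow_nonneg (by linarith [hr.2]) _
      positivity
  have h2 := hC ζ hζ (2 * δ) (by linarith)
  rw [hIval]
  calc _ ≤ ENNReal.ofReal (2 * n * 2 ^ |t| * (1 / (t + 1))) * ENNReal.ofReal (δ ^ (t + 1)) *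
        (C * ENNReal.ofReal ((2 * δ) ^ n)) := by gcongr
    _ = _ := by
      have : δ ^ (n + 1 + t) = δ ^ n * δ ^ (t + 1) := by
        rw [← Real.rpow_natCast δ n, ← Real.rpow_add hδ]; ring_nf
      rw [this, mul_pow, ENNReal.ofReal_mul (p := 2 ^ n) (by positivity),
        ENNReal.ofReal_mul (p := δ ^ n) (by positivity), ENNReal.ofReal_pow (p := 2) (by norm_num),
        ENNReal.ofReal_ofNat]
      generalize 2 * (n : ℝ) * 2 ^ |t| * (1 / (t + 1)) = K
      push_cast
      simp only [ENNReal.ofReal]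
      ring

/-! ### Integrals of powers of the gauge -/

lemma lintegral_Ioi_rpow {a c : ℝ} (ha : a < -1) (hc : 0 < c) :
    ∫⁻ r in Ioi c, ENNReal.ofReal (r ^ a) = ENNReal.ofReal (-c ^ (a + 1) / (a + 1)) := by
  rw [← ofReal_integral_eq_lintegral_ofReal (integrableOn_Ioi_rpow_of_lt ha hc),
    integral_Ioi_rpow_of_lt ha hc]
  filter_upwards [ae_restrict_mem measurableSet_Ioi] with r hr
  exact Real.rpow_nonneg (hc.le.trans (le_of_lt hr)) _

/-- Layer-cake bound: if the sublevel sets `{d < r}` have mass `O(r^m)` for `r ≥ δ`, then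
`d ^ (-p)`, `p > m`, has integral `O(δ ^ (m - p))` over `{d ≥ δ}`. -/
lemma lintegral_rpow_neg_le {X : Type*} [MeasurableSpace X] {μ : Measure X} [SFinite μ]
    {d : X → ℝ} (hd : Measurable d) {m p δ : ℝ} (hδ : 0 < δ) (hmp : m < p) (hp : 0 < p)
    {K : ℝ≥0∞} (h : ∀ r, δ ≤ r → μ {x | d x < r} ≤ K * ENNReal.ofReal (r ^ m)) :
    ∫⁻ x in {x | δ ≤ d x}, ENNReal.ofReal (d x ^ (-p)) ∂μ ≤
      K * ENNReal.ofReal (p / (p - m) * δ ^ (m - p)) := by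
  have hE : MeasurableSet {x | δ ≤ d x} := measurableSet_le measurable_const hd
  set f : ℝ → ℝ≥0∞ := fun r => ENNReal.ofReal p * ENNReal.ofReal (r ^ (-p - 1)) with hf
  have hfm : Measurable f := by fun_prop
  have h1 : ∀ x, δ ≤ d x → ENNReal.ofReal (d x ^ (-p)) ≤
      ∫⁻ r in Ioi δ, {q : X × ℝ | d q.1 < q.2}.indicator (fun q => f q.2) (x, r) := by
    intro x hx
    have hdx : 0 < d x := hδ.trans_le hx
    have e1 : ∫⁻ r in Ioi (d x), f r = ENNReal.ofReal (d x ^ (-p)) := by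
      rw [hf, lintegral_const_mul _ (by fun_prop), lintegral_Ioi_rpow (by linarith) hdx,
        ← ENNReal.ofReal_mul hp.le]
      congr 1
      rw [show -p - 1 + 1 = -p by ring]
      field_simp
    rw [← e1, ← lintegral_indicator measurableSet_Ioi, ← lintegral_indicator measurableSet_Ioi]
    refine lintegral_mono fun r => ?_
    by_cases hr : r ∈ Ioi (d x)
    · rw [indicator_of_mem hr, indicator_of_mem (show r ∈ Ioi δ from hx.trans_lt hr),
        indicator_of_mem (show (x, r) ∈ {q : X × ℝ | d q.1 < q.2} from hr)]
    · rw [indicator_of_notMem hr]; exact zero_le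
  have hm : Measurable ({q : X × ℝ | d q.1 < q.2}.indicator fun q => f q.2) :=
    (hfm.comp measurable_snd).indicator
      (measurableSet_lt (hd.comp measurable_fst) measurable_snd)
  calc ∫⁻ x in {x | δ ≤ d x}, ENNReal.ofReal (d x ^ (-p)) ∂μ
      ≤ ∫⁻ x in {x | δ ≤ d x}, ∫⁻ r in Ioi δ,
          {q : X × ℝ | d q.1 < q.2}.indicator (fun q => f q.2) (x, r) ∂volume ∂μ :=
        setLIntegral_mono' hE h1
    _ ≤ ∫⁻ x, ∫⁻ r in Ioi δ,
          {q : X × ℝ | d q.1 < q.2}.indicator (fun q => f q.2) (x, r) ∂volume ∂μ :=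
        setLIntegral_le_lintegral _ _
    _ = ∫⁻ r in Ioi δ, ∫⁻ x,
          {q : X × ℝ | d q.1 < q.2}.indicator (fun q => f q.2) (x, r) ∂μ ∂volume :=
        lintegral_lintegral_swap (f := fun x r =>
          {q : X × ℝ | d q.1 < q.2}.indicator (fun q => f q.2) (x, r)) hm.aemeasurable
    _ = ∫⁻ r in Ioi δ, f r * μ {x | d x < r} := by
        refine lintegral_congr fun r => ?_
        rw [← setLIntegral_const, ← lintegral_indicator (measurableSet_lt hd measurable_const)]
        rfl
    _ ≤ ∫⁻ r in Ioi δ, K * ENNReal.ofReal p * ENNReal.ofReal (r ^ (m - p - 1)) := by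
        refine setLIntegral_mono' measurableSet_Ioi fun r hr => ?_
        have hr0 : 0 < r := hδ.trans hr
        refine (mul_le_mul' le_rfl (h r (le_of_lt hr))).trans (le_of_eq ?_)
        rw [show m - p - 1 = (-p - 1) + m by ring, Real.rpow_add hr0,
          ENNReal.ofReal_mul (by positivity)]
        ring
    _ = _ := by
        rw [lintegral_const_mul _ (by fun_prop), lintegral_Ioi_rpow (by linarith) hδ, mul_assoc,
          ← ENNReal.ofReal_mul hp.le]
        congr 2
        rw [show m - p - 1 + 1 = -(p - m) by ring, show m - p = -(p - m) by ring]
        have : p - m ≠ 0 := by linarith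
        field_simp

lemma exists_norm_eq_one (hn : 1 ≤ n) : ∃ η : Cn n, ‖η‖ = 1 :=
  ⟨EuclideanSpace.single ⟨0, hn⟩ 1, by simp⟩

/-- Gauge balls about interior points lie in gauge balls about boundary points. -/
lemma exists_gauge_lt (hn : 1 ≤ n) {z : Cn n} (hz : ‖z‖ < 1) : ∃ η : Cn n, ‖η‖ = 1 ∧
    ∀ u, ‖u‖ ≤ 1 → ∀ r, 1 - ‖z‖ ≤ r → gauge z u < r → gauge u η < 3 * r := by
  rcases eq_or_ne z 0 with rfl | h0
  · obtain ⟨η, hη⟩ := exists_norm_eq_one hn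
    refine ⟨η, hη, fun u hu r hr _ => ?_⟩
    have := gauge_le_two hu hη.le
    rw [norm_zero] at hr
    linarith
  · obtain ⟨η, hη, h, -⟩ := exists_normalize h0
    refine ⟨η, hη, fun u hu r hr hg => ?_⟩
    have := gauge_normalize_le hu hz.le hη h
    rw [gauge_comm u z] at this
    linarith

/-- The Forelli–Rudin estimate. -/
lemma forelli_rudin (hn : 1 ≤ n) {t s : ℝ} (ht : -1 < t) (hs : 0 < s) : ∃ C : ℝ≥0,
    ∀ z : Cn n, ‖z‖ < 1 → ∫⁻ u, ENNReal.ofReal (gauge z u ^ (-(1 + n + t + s))) ∂(weightedV n t) ≤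
      C * ENNReal.ofReal ((1 - ‖z‖ ^ 2) ^ (-s)) := by
  obtain ⟨C, hC⟩ := weightedV_cap_le hn ht
  have hn0 : (0 : ℝ) ≤ n := n.cast_nonneg
  refine ⟨C * (3 ^ ((n : ℝ) + 1 + t)) * Real.toNNReal ((1 + n + t + s) / s) * 2 ^ s,
    fun z hz => ?_⟩
  obtain ⟨η, hη, hsub⟩ := exists_gauge_lt hn hz
  have hδ : 0 < 1 - ‖z‖ := by linarith
  have hd : Measurable fun u : Cn n => gauge z u := by
    simp_rw [gauge_comm z]; exact measurable_gauge_left z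
  have hfull : ∫⁻ u, ENNReal.ofReal (gauge z u ^ (-(1 + n + t + s))) ∂(weightedV n t) =
      ∫⁻ u in {u | 1 - ‖z‖ ≤ gauge z u}, ENNReal.ofReal (gauge z u ^ (-(1 + n + t + s)))
        ∂(weightedV n t) := by
    rw [Measure.restrict_eq_self_of_ae_mem]
    filter_upwards [ae_weightedV_mem t] with u hu
    exact one_sub_norm_le_gauge (mem_unitBall.1 hu).le
  have hK : ∀ r, 1 - ‖z‖ ≤ r → weightedV n t {u | gauge z u < r} ≤
      (C * ENNReal.ofReal (3 ^ (n + 1 + t))) * ENNReal.ofReal (r ^ (n + 1 + t)) := by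
    intro r hr
    have hr0 : 0 < r := hδ.trans_le hr
    have h1 : weightedV n t {u | gauge z u < r} ≤ weightedV n t (cap η (3 * r)) := by
      refine measure_mono_ae ?_
      filter_upwards [ae_weightedV_mem t] with u hu hg
      exact ⟨hu, hsub u (mem_unitBall.1 hu).le r hr hg⟩
    refine (h1.trans (hC η hη _ (by linarith))).trans (le_of_eq ?_)
    rw [Real.mul_rpow (by norm_num) hr0.le, ENNReal.ofReal_mul (by positivity), mul_assoc]
  have hmain := lintegral_rpow_neg_le hd (p := 1 + n + t + s) hδ (by linarith) (by linarith) hK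
  rw [hfull]
  refine hmain.trans ?_
  rw [show 1 + (n : ℝ) + t + s - (n + 1 + t) = s by ring,
    show (n : ℝ) + 1 + t - (1 + n + t + s) = -s by ring]
  have h2 : (1 - ‖z‖) ^ (-s) ≤ 2 ^ s * (1 - ‖z‖ ^ 2) ^ (-s) := by
    have h3 := one_sub_norm_sq_pos hz
    have h4 : (1 - ‖z‖ ^ 2) / 2 ≤ 1 - ‖z‖ := by nlinarith [norm_nonneg z]
    calc (1 - ‖z‖) ^ (-s) ≤ ((1 - ‖z‖ ^ 2) / 2) ^ (-s) :=
          Real.rpow_le_rpow_of_nonpos (by linarith) h4 (by linarith)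
      _ = _ := by
          rw [Real.div_rpow h3.le (by norm_num), Real.rpow_neg (by norm_num : (0 : ℝ) ≤ 2)]
          field_simp
  have h5 : 0 ≤ (1 + n + t + s) / s := by
    have : 0 ≤ 1 + n + t + s := by linarith
    positivity
  calc _ ≤ C * ENNReal.ofReal (3 ^ (n + 1 + t)) * ENNReal.ofReal ((1 + n + t + s) / s *
        (2 ^ s * (1 - ‖z‖ ^ 2) ^ (-s))) := by gcongr
    _ = _ := by
      rw [ENNReal.ofReal_mul h5, ENNReal.ofReal_mul (by positivity)]
      push_cast
      rw [← ENNReal.ofReal_rpow_of_pos (by norm_num), ← ENNReal.ofReal_rpow_of_pos (by norm_num),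
        ENNReal.coe_rpow_of_ne_zero (by norm_num), ENNReal.coe_rpow_of_ne_zero (by norm_num)]
      simp only [ENNReal.ofReal_ofNat, ENNReal.coe_ofNat, ENNReal.ofNNReal_toNNReal]
      ring

/-! ### The positive Bergman operator and Carleson measures -/

/-- The kernel `|1 - ⟨z, u⟩|^{-p}`. -/
noncomputable def kern (p : ℝ) (z u : Cn n) : ℝ≥0∞ := ENNReal.ofReal (gauge z u ^ (-p))

/-- The weight `(1 - |z|²)^s` as an extended nonnegative number. -/
noncomputable def weight (s : ℝ) (z : Cn n) : ℝ≥0∞ := ENNReal.ofReal ((1 - ‖z‖ ^ 2) ^ s)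

/-- The positive Bergman operator `φ ↦ ∫ φ(u) |1 - ⟨z, u⟩|^{-(1+n+β)} (1 - |u|²)^β dV(u)`. -/
noncomputable def posBergman (β : ℝ) (φ : Cn n → ℝ≥0∞) (z : Cn n) : ℝ≥0∞ :=
  ∫⁻ u, φ u * kern (1 + n + β) z u ∂(weightedV n β)

/-- `K` bounds the Carleson constant of the measure `φ^q (1 - |z|²)^β dV`. The value `K = ∞`, for
which the condition is void, is allowed. -/
def CarlesonBound (β q : ℝ) (φ : Cn n → ℝ≥0∞) (K : ℝ≥0∞) : Prop :=
  ∀ ζ : Cn n, ‖ζ‖ = 1 → ∀ δ : ℝ, 0 < δ →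
    ∫⁻ z in cap ζ δ, φ z ^ q ∂(weightedV n β) ≤ K * ENNReal.ofReal (δ ^ n)

lemma kern_comm (p : ℝ) (z u : Cn n) : kern p z u = kern p u z := by
  unfold kern; rw [gauge_comm]

lemma measurable_kern (p : ℝ) : Measurable fun x : Cn n × Cn n => kern p x.1 x.2 :=
  (measurable_gauge.pow_const _).ennreal_ofReal

@[fun_prop]
lemma measurable_kern_comp {X : Type*} [MeasurableSpace X] (p : ℝ) {f g : X → Cn n}
    (hf : Measurable f) (hg : Measurable g) : Measurable fun x => kern p (f x) (g x) := by
  have h := measurable_kern (n := n) p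
  have h2 := h.comp (hf.prodMk hg)
  exact h2

@[fun_prop]
lemma measurable_weight' (s : ℝ) : Measurable (weight s : Cn n → ℝ≥0∞) := measurable_weight s

lemma weight_add (s t : ℝ) {z : Cn n} (hz : z ∈ unitBall n) :
    weight (s + t) z = weight s z * weight t z := by
  have h := one_sub_norm_sq_pos (mem_unitBall.1 hz)
  unfold weight
  rw [Real.rpow_add h, ENNReal.ofReal_mul (by positivity)]

lemma weight_zero {z : Cn n} : weight 0 z = 1 := by simp [weight]

lemma weight_rpow (s q : ℝ) {z : Cn n} (hz : z ∈ unitBall n) :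
    weight s z ^ q = weight (s * q) z := by
  have h := one_sub_norm_sq_pos (mem_unitBall.1 hz)
  unfold weight
  rw [ENNReal.ofReal_rpow_of_pos (by positivity), ← Real.rpow_mul h.le]

lemma weight_ne_top (s : ℝ) (z : Cn n) : weight s z ≠ ∞ := ENNReal.ofReal_ne_top

lemma weight_ne_zero (s : ℝ) {z : Cn n} (hz : z ∈ unitBall n) : weight s z ≠ 0 := by
  have h := one_sub_norm_sq_pos (mem_unitBall.1 hz)
  unfold weight
  rw [ne_eq, ENNReal.ofReal_eq_zero, not_le]
  positivity

lemma lintegral_weight_mul (s t : ℝ) (F : Cn n → ℝ≥0∞) :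
    ∫⁻ z, weight s z * F z ∂(weightedV n t) = ∫⁻ z, F z ∂(weightedV n (s + t)) :=
  (lintegral_weightedV_add s t F).symm

lemma setLIntegral_weight_mul (s t : ℝ) (F : Cn n → ℝ≥0∞) {A : Set (Cn n)}
    (hA : MeasurableSet A) :
    ∫⁻ z in A, weight s z * F z ∂(weightedV n t) = ∫⁻ z in A, F z ∂(weightedV n (s + t)) := by
  rw [← lintegral_indicator hA, ← lintegral_indicator hA, ← lintegral_weight_mul]
  refine lintegral_congr fun z => ?_
  rw [indicator_mul_right]

@[fun_prop]
lemma measurable_posBergman (β : ℝ) {φ : Cn n → ℝ≥0∞} (hφ : Measurable φ) :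
    Measurable (posBergman β φ) :=
  Measurable.lintegral_prod_right' (f := fun x : Cn n × Cn n => φ x.2 * kern (1 + n + β) x.1 x.2)
    ((hφ.comp measurable_snd).mul (measurable_kern _))

lemma lintegral_kern_le (hn : 1 ≤ n) {t s : ℝ} (ht : -1 < t) (hs : 0 < s) : ∃ C : ℝ≥0,
    ∀ z ∈ unitBall n, ∫⁻ u, kern (1 + n + t + s) z u ∂(weightedV n t) ≤ C * weight (-s) z := by
  obtain ⟨C, hC⟩ := forelli_rudin hn ht hs
  exact ⟨C, fun z hz => hC z (mem_unitBall.1 hz)⟩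

/-- Schur-type pointwise bound: Hölder's inequality against the weight `(1 - |u|²)^s`, the dual
factor being estimated by Forelli–Rudin. -/
lemma posBergman_rpow_le (hn : 1 ≤ n) {β q q' s : ℝ} (hqq : q.HolderConjugate q')
    (hs : 0 < s) (hsq : s * q' < 1 + β) : ∃ C : ℝ≥0, ∀ φ : Cn n → ℝ≥0∞, Measurable φ →
      ∀ z ∈ unitBall n, posBergman β φ z ^ q ≤ C * (weight (-(s * q)) z *
        ∫⁻ u, φ u ^ q * weight (s * q) u * kern (1 + n + β) z u ∂(weightedV n β)) := by
  have hq0 : 0 < q := hqq.pos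
  have hq0' : 0 < q' := hqq.symm.pos
  obtain ⟨C, hC⟩ := lintegral_kern_le hn (t := β - s * q') (s := s * q') (by linarith)
    (by positivity)
  refine ⟨C ^ (q / q'), fun φ hφ z hz => ?_⟩
  set k : Cn n → ℝ≥0∞ := fun u => kern (1 + n + β) z u with hk
  have hkm : Measurable k := by fun_prop
  have h1 : posBergman β φ z = ∫⁻ u, ((fun u => φ u * weight s u * k u ^ (1 / q)) *
      fun u => weight (-s) u * k u ^ (1 / q')) u ∂(weightedV n β) := by
    refine lintegral_congr_ae ?_
    filter_upwards [ae_weightedV_mem β] with u hu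
    have e1 : weight s u * weight (-s) u = 1 := by
      rw [← weight_add _ _ hu, add_neg_cancel, weight_zero]
    have e2 : k u ^ (1 / q) * k u ^ (1 / q') = k u := by
      rw [← ENNReal.rpow_add_of_nonneg _ _ (by positivity) (by positivity)]
      have := hqq.inv_add_inv_eq_one
      rw [one_div, one_div, this, ENNReal.rpow_one]
    simp only [Pi.mul_apply]
    calc φ u * k u = φ u * (weight s u * weight (-s) u) * (k u ^ (1 / q) * k u ^ (1 / q')) := by
          rw [e1, e2, mul_one]
      _ = _ := by ring
  have h2 := ENNReal.lintegral_mul_le_Lp_mul_Lq (weightedV n β) hqq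
    (f := fun u => φ u * weight s u * k u ^ (1 / q))
    (g := fun u => weight (-s) u * k u ^ (1 / q')) (by fun_prop) (by fun_prop)
  have h3 : ∫⁻ u, (φ u * weight s u * k u ^ (1 / q)) ^ q ∂(weightedV n β) =
      ∫⁻ u, φ u ^ q * weight (s * q) u * k u ∂(weightedV n β) := by
    refine lintegral_congr_ae ?_
    filter_upwards [ae_weightedV_mem β] with u hu
    rw [ENNReal.mul_rpow_of_nonneg _ _ hq0.le, ENNReal.mul_rpow_of_nonneg _ _ hq0.le,
      weight_rpow _ _ hu, ← ENNReal.rpow_mul, one_div_mul_cancel hq0.ne', ENNReal.rpow_one]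
  have h4 : ∫⁻ u, (weight (-s) u * k u ^ (1 / q')) ^ q' ∂(weightedV n β) ≤
      C * weight (-(s * q')) z := by
    refine le_trans (le_of_eq ?_) (hC z hz)
    rw [show β - s * q' = -(s * q') + β by ring, ← lintegral_weight_mul]
    refine lintegral_congr_ae ?_
    filter_upwards [ae_weightedV_mem β] with u hu
    rw [ENNReal.mul_rpow_of_nonneg _ _ hq0'.le, weight_rpow _ _ hu, ← ENNReal.rpow_mul,
      one_div_mul_cancel hq0'.ne', ENNReal.rpow_one, neg_mul, hk]
    simp only
    congr 2
    ring
  rw [h1]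
  calc _ ≤ ((∫⁻ u, φ u ^ q * weight (s * q) u * k u ∂(weightedV n β)) ^ (1 / q) *
        (C * weight (-(s * q')) z) ^ (1 / q')) ^ q := by
        refine ENNReal.rpow_le_rpow (h2.trans ?_) hq0.le
        rw [h3]
        exact mul_le_mul' le_rfl (ENNReal.rpow_le_rpow h4 (by positivity))
    _ = _ := by
        rw [ENNReal.mul_rpow_of_nonneg _ _ hq0.le, ← ENNReal.rpow_mul, ← ENNReal.rpow_mul,
          one_div_mul_cancel hq0.ne', ENNReal.rpow_one, one_div_mul_eq_div,
          ENNReal.mul_rpow_of_nonneg _ _ (by positivity), weight_rpow _ _ hz,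
          ← ENNReal.coe_rpow_of_nonneg _ (by positivity)]
        rw [show -(s * q') * (q / q') = -(s * q) by field_simp]
        ring

/-- The positive Bergman operator preserves Carleson measures. After `posBergman_rpow_le` and
Tonelli's theorem, the contribution of `u` is bounded through the integral of the kernel over a
gauge ball. It is estimated by Forelli–Rudin when `u` lies in a fixed dilate of the ball and by
`gauge u ζ ^ (-p)` otherwise, with `p > n`, which the Carleson condition sums. -/
theorem CarlesonBound.posBergman (hn : 1 ≤ n) {β q : ℝ} (hβ : -1 < β) (hq : 1 < q) :
    ∃ C : ℝ≥0, ∀ φ : Cn n → ℝ≥0∞, Measurable φ → ∀ K : ℝ≥0∞, CarlesonBound β q φ K →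
      CarlesonBound β q (posBergman β φ) (C * K) := by
  obtain ⟨q', hqq⟩ : ∃ q', q.HolderConjugate q' := ⟨_, Real.HolderConjugate.conjExponent hq⟩
  have hq0 : 0 < q := hqq.pos
  have hq0' : 0 < q' := hqq.symm.pos
  -- The weights `-s q` and `-s q'` have to stay integrable against `(1 - |u|²)^β`.
  obtain ⟨s, hs, hsq, hsq'⟩ : ∃ s : ℝ, 0 < s ∧ s * q < 1 + β ∧ s * q' < 1 + β := by
    refine ⟨(1 + β) / (2 * (q + q')), ?_, ?_, ?_⟩
    · have : 0 < 1 + β := by linarith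
      positivity
    · rw [div_mul_eq_mul_div, div_lt_iff₀ (by positivity)]
      nlinarith
    · rw [div_mul_eq_mul_div, div_lt_iff₀ (by positivity)]
      nlinarith
  have hsq0 : 0 < s * q := by positivity
  obtain ⟨C₁, hC₁⟩ := posBergman_rpow_le hn hqq hs hsq'
  obtain ⟨C₂, hC₂⟩ := lintegral_kern_le hn (t := β - s * q) (s := s * q) (by linarith) hsq0
  obtain ⟨C₃, hC₃⟩ := weightedV_cap_le hn (t := β - s * q) (by linarith)
  set p : ℝ := 1 + n + β - s * q with hp
  have hn0 : (0 : ℝ) ≤ n := n.cast_nonneg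
  have hpn : (n : ℝ) < p := by linarith
  have hp0 : 0 < p := by linarith
  set c₄ : ℝ := 8 ^ (1 + n + β) * 2 ^ (s * q) * (p / (p - n) * 8 ^ (n - p)) with hc₄
  have hc₄0 : 0 ≤ c₄ := by
    have : 0 < p - n := by linarith
    positivity
  refine ⟨C₁ * (C₂ * 8 ^ n + C₃ * c₄.toNNReal), fun φ hφ K hK ζ hζ δ hδ => ?_⟩
  have hcm := measurableSet_cap ζ δ
  set J : Cn n → ℝ≥0∞ := fun u => ∫⁻ z in cap ζ δ, kern (1 + n + β) z u
    ∂(weightedV n (-(s * q) + β)) with hJ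
  have hstep : ∫⁻ z in cap ζ δ, TentBall.posBergman β φ z ^ q ∂(weightedV n β) ≤
      C₁ * ∫⁻ u, φ u ^ q * weight (s * q) u * J u ∂(weightedV n β) := by
    have hmeas : Measurable fun x : Cn n × Cn n =>
        weight (-(s * q)) x.1 * (φ x.2 ^ q * weight (s * q) x.2 * kern (1 + n + β) x.1 x.2) := by
      fun_prop
    calc _ ≤ ∫⁻ z in cap ζ δ, C₁ * ∫⁻ u, weight (-(s * q)) z * (φ u ^ q * weight (s * q) u *
          kern (1 + n + β) z u) ∂(weightedV n β) ∂(weightedV n β) := by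
          refine setLIntegral_mono' hcm fun z hz => (hC₁ φ hφ z hz.1).trans_eq ?_
          rw [lintegral_const_mul _ (by fun_prop)]
      _ = C₁ * ∫⁻ u, ∫⁻ z in cap ζ δ, weight (-(s * q)) z * (φ u ^ q * weight (s * q) u *
          kern (1 + n + β) z u) ∂(weightedV n β) ∂(weightedV n β) := by
          rw [lintegral_const_mul' _ _ (by finiteness)]
          rw [lintegral_lintegral_swap (f := fun z u => weight (-(s * q)) z *
            (φ u ^ q * weight (s * q) u * kern (1 + n + β) z u)) hmeas.aemeasurable]
      _ = _ := by
          congr 1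
          refine lintegral_congr fun u => ?_
          rw [setLIntegral_weight_mul _ _ _ hcm, lintegral_const_mul _ (by fun_prop)]
  -- Near the ball the kernel is integrated by Forelli–Rudin.
  have hnear : ∀ u ∈ unitBall n, weight (s * q) u * J u ≤ C₂ := by
    intro u hu
    have h1 : J u ≤ C₂ * weight (-(s * q)) u := by
      refine (setLIntegral_le_lintegral _ _).trans ?_
      simp_rw [kern_comm _ _ u]
      have := hC₂ u hu
      rwa [show 1 + (n : ℝ) + (β - s * q) + s * q = 1 + n + β by ring,
        show β - s * q = -(s * q) + β by ring] at this
    refine (mul_le_mul' le_rfl h1).trans (le_of_eq ?_)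
    rw [mul_left_comm, ← weight_add _ _ hu, add_neg_cancel, weight_zero, mul_one]
  -- Far from the ball the kernel is essentially constant.
  have hfar : ∀ u ∈ unitBall n, 8 * δ ≤ gauge u ζ → weight (s * q) u * J u ≤
      ENNReal.ofReal (8 ^ (1 + n + β) * 2 ^ (s * q)) * (C₃ * ENNReal.ofReal (δ ^ p)) *
        ENNReal.ofReal (gauge u ζ ^ (-p)) := by
    intro u hu hfar
    have hg : 0 < gauge u ζ := by linarith
    have hu1 := mem_unitBall.1 hu
    have h1 : J u ≤ ENNReal.ofReal (8 ^ (1 + n + β) * gauge u ζ ^ (-(1 + n + β))) *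
        (C₃ * ENNReal.ofReal (δ ^ p)) := by
      have h2 : ∀ z ∈ cap ζ δ, kern (1 + n + β) z u ≤
          ENNReal.ofReal (8 ^ (1 + n + β) * gauge u ζ ^ (-(1 + n + β))) := by
        intro z hz
        refine ENNReal.ofReal_le_ofReal ?_
        have h3 := gauge_triangle hu1.le hζ.le (mem_unitBall.1 hz.1).le
        have h4 : gauge u ζ / 8 ≤ gauge z u := by
          rw [gauge_comm z u]; linarith [hz.2]
        calc gauge z u ^ (-(1 + n + β)) ≤ (gauge u ζ / 8) ^ (-(1 + n + β)) :=
              Real.rpow_le_rpow_of_nonpos (by positivity) h4 (by linarith)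
          _ = _ := by
              rw [Real.div_rpow hg.le (by norm_num), Real.rpow_neg (by norm_num : (0 : ℝ) ≤ 8)]
              field_simp
      refine (setLIntegral_mono' hcm h2).trans ?_
      rw [setLIntegral_const]
      refine mul_le_mul' le_rfl ?_
      have := hC₃ ζ hζ δ hδ
      rwa [show β - s * q = -(s * q) + β by ring,
        show (n : ℝ) + 1 + (-(s * q) + β) = p by rw [hp]; ring] at this
    have h5 : weight (s * q) u ≤ ENNReal.ofReal (2 ^ (s * q) * gauge u ζ ^ (s * q)) := by
      refine ENNReal.ofReal_le_ofReal ?_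
      rw [← Real.mul_rpow (by norm_num) hg.le]
      exact Real.rpow_le_rpow (one_sub_norm_sq_pos hu1).le
        (one_sub_norm_sq_le_gauge hu1.le hζ.le) hsq0.le
    refine (mul_le_mul' h5 h1).trans (le_of_eq ?_)
    rw [hp, show -(1 + (n : ℝ) + β - s * q) = s * q + -(1 + n + β) by ring, Real.rpow_add hg,
      ENNReal.ofReal_mul (by positivity), ENNReal.ofReal_mul (by positivity),
      ENNReal.ofReal_mul (by positivity), ENNReal.ofReal_mul (by positivity)]
    ring
  set E : Set (Cn n) := {u | 8 * δ ≤ gauge u ζ} with hE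
  have hEm : MeasurableSet E := measurableSet_le measurable_const (measurable_gauge_left ζ)
  set ν := (weightedV n β).withDensity fun u => φ u ^ q with hν
  have hνle : ∀ r, 0 < r → ν {u | gauge u ζ < r} ≤ K * ENNReal.ofReal (r ^ (n : ℝ)) := by
    intro r hr
    rw [Real.rpow_natCast]
    refine le_trans ?_ (hK ζ hζ r hr)
    rw [hν, withDensity_apply _ (measurableSet_lt (measurable_gauge_left ζ) measurable_const)]
    refine lintegral_mono' (Measure.restrict_mono_ae ?_) le_rfl
    filter_upwards [ae_weightedV_mem β] with u hu hg
    exact ⟨hu, hg⟩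
  have hEpart : ∫⁻ u in E, φ u ^ q * weight (s * q) u * J u ∂(weightedV n β) ≤
      C₃ * ENNReal.ofReal c₄ * (K * ENNReal.ofReal (δ ^ n)) := by
    have h1 := lintegral_rpow_neg_le (μ := ν) (measurable_gauge_left ζ) (m := n) (p := p)
      (δ := 8 * δ) (by positivity) hpn hp0 (K := K) (fun r hr => hνle r (by linarith))
    rw [hν, setLIntegral_withDensity_eq_setLIntegral_mul _ (by fun_prop)
      ((measurable_gauge_left ζ).pow_const _).ennreal_ofReal hEm] at h1
    calc _ ≤ ∫⁻ u in E, ENNReal.ofReal (8 ^ (1 + n + β) * 2 ^ (s * q)) *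
          (C₃ * ENNReal.ofReal (δ ^ p)) * (φ u ^ q * ENNReal.ofReal (gauge u ζ ^ (-p)))
          ∂(weightedV n β) := by
          refine setLIntegral_mono_ae' hEm ?_
          filter_upwards [ae_weightedV_mem β] with u hu huE
          rw [mul_assoc]
          refine (mul_le_mul' le_rfl (hfar u hu huE)).trans (le_of_eq (by ring))
      _ ≤ ENNReal.ofReal (8 ^ (1 + n + β) * 2 ^ (s * q)) * (C₃ * ENNReal.ofReal (δ ^ p)) *
          (K * ENNReal.ofReal (p / (p - n) * (8 * δ) ^ (n - p))) := by
          rw [lintegral_const_mul' _ _ (by finiteness)]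
          exact mul_le_mul' le_rfl h1
      _ = _ := by
          have e1 : δ ^ n = δ ^ p * δ ^ (n - p) := by
            rw [← Real.rpow_add hδ, ← Real.rpow_natCast]; congr 1; ring
          have e2 : 0 ≤ p / (p - n) := by
            have : 0 < p - n := by linarith
            positivity
          rw [hc₄, e1, Real.mul_rpow (by norm_num) hδ.le, ← mul_assoc (p / (p - n)),
            ENNReal.ofReal_mul (q := δ ^ (n - p)) (by positivity),
            ENNReal.ofReal_mul (q := p / (p - n) * 8 ^ (n - p)) (by positivity),
            ENNReal.ofReal_mul (q := δ ^ (n - p)) (by positivity)]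
          ring
  have hEcpart : ∫⁻ u in Eᶜ, φ u ^ q * weight (s * q) u * J u ∂(weightedV n β) ≤
      C₂ * (K * ENNReal.ofReal ((8 * δ) ^ n)) := by
    calc _ ≤ ∫⁻ u in Eᶜ, C₂ * φ u ^ q ∂(weightedV n β) := by
          refine setLIntegral_mono_ae' hEm.compl ?_
          filter_upwards [ae_weightedV_mem β] with u hu _
          rw [mul_assoc, mul_comm (C₂ : ℝ≥0∞)]
          exact mul_le_mul' le_rfl (hnear u hu)
      _ = C₂ * ν Eᶜ := by
          rw [lintegral_const_mul' _ _ (by finiteness), hν, withDensity_apply _ hEm.compl]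
      _ ≤ _ := by
          have : Eᶜ = {u | gauge u ζ < 8 * δ} := by ext u; simp [hE]
          rw [this, ← Real.rpow_natCast]
          exact mul_le_mul' le_rfl (hνle _ (by positivity))
  refine hstep.trans ?_
  rw [← lintegral_add_compl _ hEm]
  refine (mul_le_mul' le_rfl (add_le_add hEpart hEcpart)).trans (le_of_eq ?_)
  rw [mul_pow, ENNReal.ofReal_mul (p := 8 ^ n) (by positivity),
    ENNReal.ofReal_pow (p := 8) (by norm_num), ENNReal.ofReal_ofNat]
  push_cast
  simp only [ENNReal.ofReal]
  ring

/-! ### Approach regions, shadows and area functions -/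

/-- The shadow of `z`: the set of `ζ` whose approach region contains `z`. -/
def shadow (γ : ℝ) (z : Cn n) : Set (sphere (0 : Cn n) 1) := {ζ | z ∈ korRegion γ (ζ : Cn n)}

/-- The `q`-th power `∫_{Γ(ζ)} φ^q (1 - |z|²)^α dV` of the area function. -/
noncomputable def areaPow (γ α q : ℝ) (φ : Cn n → ℝ≥0∞) (ζ : Cn n) : ℝ≥0∞ :=
  ∫⁻ z in korRegion γ ζ, φ z ^ q ∂(weightedV n α)

/-- The norm of `T^1_{q,α}` for nonnegative functions. -/
noncomputable def tentOne (γ α q : ℝ) (φ : Cn n → ℝ≥0∞) : ℝ≥0∞ :=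
  ∫⁻ ζ : sphere (0 : Cn n) 1, areaPow γ α q φ ζ ^ (1 / q) ∂(σ n)

lemma mem_korRegion {γ : ℝ} {ζ z : Cn n} :
    z ∈ korRegion γ ζ ↔ ‖z‖ < 1 ∧ gauge z ζ < γ / 2 * (1 - ‖z‖ ^ 2) := by
  rw [← mem_unitBall]; rfl

lemma measurableSet_korRegion_prod (γ : ℝ) :
    MeasurableSet {x : Cn n × sphere (0 : Cn n) 1 | x.1 ∈ korRegion γ (x.2 : Cn n)} := by
  have h1 : Measurable fun x : Cn n × sphere (0 : Cn n) 1 => gauge x.1 (x.2 : Cn n) := by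
    fun_prop
  have h2 : Measurable fun x : Cn n × sphere (0 : Cn n) 1 => γ / 2 * (1 - ‖x.1‖ ^ 2) := by fun_prop
  exact (measurable_fst measurableSet_unitBall).inter (measurableSet_lt h1 h2)

lemma measurableSet_korRegion (γ : ℝ) (ζ : Cn n) : MeasurableSet (korRegion γ ζ) :=
  measurableSet_unitBall.inter (measurableSet_lt (measurable_gauge_left ζ) (by fun_prop))

lemma measurableSet_shadow (γ : ℝ) (z : Cn n) : MeasurableSet (shadow γ z) :=
  (measurable_prodMk_left : Measurable fun ζ : sphere (0 : Cn n) 1 => (z, ζ))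
    (measurableSet_korRegion_prod γ)

/-- Tonelli's theorem for integrals over approach regions. -/
lemma lintegral_korRegion_swap {γ α : ℝ} {F : Cn n × sphere (0 : Cn n) 1 → ℝ≥0∞}
    (hF : Measurable F) :
    ∫⁻ ζ : sphere (0 : Cn n) 1, ∫⁻ z in korRegion γ (ζ : Cn n), F (z, ζ) ∂(weightedV n α) ∂(σ n) =
      ∫⁻ z, ∫⁻ ζ in shadow γ z, F (z, ζ) ∂(σ n) ∂(weightedV n α) := by
  have hm := hF.indicator (measurableSet_korRegion_prod γ)
  have h := lintegral_lintegral_swap (μ := weightedV n α) (ν := σ n) (f := fun z ζ =>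
    {x : Cn n × sphere (0 : Cn n) 1 | x.1 ∈ korRegion γ (x.2 : Cn n)}.indicator F (z, ζ))
    hm.aemeasurable
  convert h.symm using 1
  · refine lintegral_congr fun ζ => ?_
    rw [← lintegral_indicator (measurableSet_korRegion γ _)]
    rfl
  · refine lintegral_congr fun z => ?_
    rw [← lintegral_indicator (measurableSet_shadow γ _)]
    rfl

lemma ae_weightedV_ne_zero (hn : 1 ≤ n) (t : ℝ) : ∀ᵐ z ∂(weightedV n t), z ≠ 0 := by
  have : Nonempty (Fin n) := ⟨⟨0, hn⟩⟩
  refine (weightedV_absolutelyContinuous t).ae_le ?_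
  refine Measure.ae_smul_measure (ae_restrict_of_ae ?_) _
  exact Measure.ae_ne volume 0

/-- Shadows have measure comparable to `(1 - |z|²)ⁿ`; lower bound. The origin is excluded because
its shadow is empty for `γ = 2`. -/
lemma le_sigma_shadow (hn : 1 ≤ n) {γ : ℝ} (hγ : 2 ≤ γ) : ∃ c : ℝ≥0, c ≠ 0 ∧
    ∀ z ∈ unitBall n, z ≠ 0 → c * weight n z ≤ σ n (shadow γ z) := by
  obtain ⟨c, hc, h⟩ := le_sigma_cap hn
  refine ⟨c * (1 / 2) ^ n, by positivity, fun z hz h0 => ?_⟩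
  have hz1 := mem_unitBall.1 hz
  have hzn := norm_nonneg z
  obtain ⟨η, hη, hzη, -⟩ := exists_normalize h0
  have hsub : {ζ : sphere (0 : Cn n) 1 | gauge η ζ < 1 - ‖z‖} ⊆ shadow γ z := by
    intro ζ hζ
    refine mem_korRegion.2 ⟨hz1, ?_⟩
    have h1 : 1 - herm z ζ = ((1 - ‖z‖ : ℝ) : ℂ) + ((‖z‖ : ℝ) : ℂ) * (1 - herm η ζ) := by
      conv_lhs => rw [hzη, herm_smul_left]
      push_cast; ring
    have h2 : gauge z ζ ≤ (1 - ‖z‖) + ‖z‖ * gauge η ζ := by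
      unfold gauge
      rw [h1]
      refine (norm_add_le _ _).trans ?_
      rw [norm_mul, Complex.norm_real, Complex.norm_real, norm_norm,
        Real.norm_of_nonneg (by linarith)]
    have h3 : gauge η ζ < 1 - ‖z‖ := hζ
    have h4 : 0 < ‖z‖ := norm_pos_iff.2 h0
    have h5 : 0 < 1 - ‖z‖ ^ 2 := one_sub_norm_sq_pos hz1
    nlinarith
  refine le_trans ?_ ((h η hη (1 - ‖z‖) (by linarith) (by linarith)).trans (measure_mono hsub))
  have h6 : (1 - ‖z‖ ^ 2) ^ (n : ℝ) ≤ 2 ^ n * (1 - ‖z‖) ^ n := by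
    rw [Real.rpow_natCast, ← mul_pow]
    exact pow_le_pow_left₀ (one_sub_norm_sq_pos hz1).le (by nlinarith) n
  have h7 : weight n z ≤ 2 ^ n * ENNReal.ofReal ((1 - ‖z‖) ^ n) := by
    refine (ENNReal.ofReal_le_ofReal h6).trans (le_of_eq ?_)
    rw [ENNReal.ofReal_mul (by positivity), ENNReal.ofReal_pow (by norm_num), ENNReal.ofReal_ofNat]
  refine (mul_le_mul' le_rfl h7).trans (le_of_eq ?_)
  have h8 : ((1 / 2 : ℝ≥0) : ℝ≥0∞) ^ n * 2 ^ n = 1 := by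
    rw [← mul_pow, show ((1 / 2 : ℝ≥0) : ℝ≥0∞) * 2 = ((1 / 2 * 2 : ℝ≥0) : ℝ≥0∞) by push_cast; rfl]
    norm_num
  calc _ = c * (((1 / 2 : ℝ≥0) : ℝ≥0∞) ^ n * 2 ^ n) * ENNReal.ofReal ((1 - ‖z‖) ^ n) := by
        push_cast; ring
    _ = _ := by rw [h8, mul_one]

/-- Shadows have measure comparable to `(1 - |z|²)ⁿ`; upper bound. -/
lemma sigma_shadow_le (hn : 1 ≤ n) {γ : ℝ} (hγ : 2 ≤ γ) : ∃ C : ℝ≥0,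
    ∀ z ∈ unitBall n, z ≠ 0 → σ n (shadow γ z) ≤ C * weight n z := by
  obtain ⟨C, h⟩ := sigma_cap_le hn
  refine ⟨C * (γ ^ n).toNNReal, fun z hz h0 => ?_⟩
  have hz1 := mem_unitBall.1 hz
  obtain ⟨η, hη, hzη, -⟩ := exists_normalize h0
  have hw := one_sub_norm_sq_pos hz1
  have hsub : shadow γ z ⊆ {ζ : sphere (0 : Cn n) 1 | gauge η ζ < γ * (1 - ‖z‖ ^ 2)} := by
    intro ζ hζ
    have h1 : ‖(ζ : Cn n)‖ = 1 := by simp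
    have h2 := gauge_normalize_le h1.le hz1.le hη hzη
    have h3 := (mem_korRegion.1 hζ).2
    rw [gauge_comm] at h3
    rw [mem_ofPred_eq, gauge_comm]
    linarith
  refine ((measure_mono hsub).trans (h η hη _ (by positivity))).trans (le_of_eq ?_)
  rw [mul_pow, ENNReal.ofReal_mul (by positivity), weight, Real.rpow_natCast]
  push_cast
  rw [ENNReal.ofNNReal_toNNReal, mul_assoc]

/-- In a family of nested superlevel sets, those points whose superlevel set has mass at most `M`
form a set of mass at most `M`. -/
lemma measure_superlevel_le {X : Type*} [MeasurableSpace X] (ν : Measure X) (ρ : X → ℝ)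
    (M : ℝ≥0∞) : ν {z | ν {w | ρ z ≤ ρ w} ≤ M} ≤ M := by
  set E : Set ℝ := {t | ν {w | t ≤ ρ w} ≤ M} with hE
  have hup : ∀ s ∈ E, ∀ t, s ≤ t → t ∈ E := fun s hs t hst =>
    (measure_mono fun w (hw : t ≤ ρ w) => hst.trans hw).trans hs
  change ν {z | ρ z ∈ E} ≤ M
  by_cases hmin : ∃ a ∈ E, ∀ t ∈ E, a ≤ t
  · obtain ⟨a, ha, hle⟩ := hmin
    exact (measure_mono fun z (hz : ρ z ∈ E) => hle _ hz).trans (show ν {w | a ≤ ρ w} ≤ M from ha)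
  · push Not at hmin
    have hsub : {z | ρ z ∈ E} ⊆ ⋃ r : {r : ℚ // (r : ℝ) ∈ E}, {z | ((r : ℚ) : ℝ) ≤ ρ z} := by
      intro z hz
      obtain ⟨t, ht, htz⟩ := hmin _ hz
      obtain ⟨r, hr1, hr2⟩ := exists_rat_btwn htz
      exact mem_iUnion.2 ⟨⟨r, hup t ht _ hr1.le⟩, hr2.le⟩
    refine (measure_mono hsub).trans ?_
    rw [Directed.measure_iUnion]
    · exact iSup_le fun r => r.2
    · intro r s
      rcases le_total (r : ℚ) s with h | h
      · have h' : ((r : ℚ) : ℝ) ≤ (s : ℚ) := by exact_mod_cast h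
        exact ⟨r, subset_rfl, fun z (hz : ((s : ℚ) : ℝ) ≤ ρ z) => h'.trans hz⟩
      · have h' : ((s : ℚ) : ℝ) ≤ (r : ℚ) := by exact_mod_cast h
        exact ⟨s, fun z (hz : ((r : ℚ) : ℝ) ≤ ρ z) => h'.trans hz, subset_rfl⟩

/-! ### Duality between `T^1` and `T^∞` -/

/-- Two approach regions through `z` and a higher point `w` meet only if `w` lies in a
nonisotropic ball over `z` of comparable size. -/
lemma mem_cap_of_shadow {γ : ℝ} (hγ : 2 ≤ γ) {z w η : Cn n} (hη : ‖η‖ = 1)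
    (hz : z = ((‖z‖ : ℝ) : ℂ) • η) {ζ : sphere (0 : Cn n) 1} (h1 : ζ ∈ shadow γ z)
    (h2 : w ∈ korRegion γ (ζ : Cn n)) (hzw : ‖z‖ ≤ ‖w‖) :
    w ∈ cap η (8 * γ * (1 - ‖z‖ ^ 2)) := by
  obtain ⟨hz1, hzg⟩ := mem_korRegion.1 h1
  obtain ⟨hw1, hwg⟩ := mem_korRegion.1 h2
  have hζ : ‖(ζ : Cn n)‖ = 1 := by simp
  refine ⟨mem_unitBall.2 hw1, ?_⟩
  have h3 := gauge_triangle (a := w) (b := z) hw1.le hz1.le hζ.le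
  have h4 := gauge_normalize_le hw1.le hz1.le hη hz
  rw [gauge_comm (ζ : Cn n) z] at h3
  have h5 : 1 - ‖w‖ ^ 2 ≤ 1 - ‖z‖ ^ 2 := by nlinarith [norm_nonneg z]
  have h6 : γ / 2 * (1 - ‖w‖ ^ 2) ≤ γ / 2 * (1 - ‖z‖ ^ 2) := by gcongr
  linarith

/-- Pairing inequality `∫ φ ψ dv ≤ C ‖φ‖_{T^1_q} ‖ψ‖_{T^∞_{q'}}`. For every `z`, at least half of
the shadow of `z` consists of points at which the area function of `ψ`, truncated at the height
of `z`, is bounded by the Carleson constant; on that part Hölder's inequality applies. -/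
theorem lintegral_mul_le_tentOne (hn : 1 ≤ n) {γ α q q' : ℝ} (hγ : 2 ≤ γ)
    (hqq : q.HolderConjugate q') {K : ℝ≥0} (hK0 : K ≠ 0) : ∃ C : ℝ≥0, ∀ φ ψ : Cn n → ℝ≥0∞,
      Measurable φ → Measurable ψ → CarlesonBound (n + α) q' ψ K →
        ∫⁻ z, φ z * ψ z ∂(weightedV n (n + α)) ≤ C * tentOne γ α q φ := by
  have hq0 : 0 < q := hqq.pos
  have hq0' : 0 < q' := hqq.symm.pos
  obtain ⟨c, hc0, hc⟩ := le_sigma_shadow hn hγ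
  obtain ⟨C, hC⟩ := sigma_shadow_le hn hγ
  have := isProbabilityMeasure_sigma hn
  set R : ℝ≥0 := Real.toNNReal ((8 * γ) ^ n) with hR
  set M : ℝ≥0 := 2 * (C * R + 1) / c with hM
  have hM0 : M ≠ 0 := by positivity
  refine ⟨2 / c * (M * K) ^ (1 / q'), fun φ ψ hφ hψ hcar => ?_⟩
  -- The truncated area function.
  set T : Cn n → sphere (0 : Cn n) 1 → ℝ≥0∞ := fun z ζ =>
    ∫⁻ w in korRegion γ (ζ : Cn n), {w : Cn n | ‖z‖ ≤ ‖w‖}.indicator (fun w => ψ w ^ q') w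
      ∂(weightedV n α) with hT
  have hTm : Measurable fun x : Cn n × sphere (0 : Cn n) 1 => T x.1 x.2 := by
    have h1 : Measurable fun y : (Cn n × sphere (0 : Cn n) 1) × Cn n =>
        ({y : (Cn n × sphere (0 : Cn n) 1) × Cn n | y.2 ∈ korRegion γ (y.1.2 : Cn n)} ∩
          {y | ‖y.1.1‖ ≤ ‖y.2‖}).indicator (fun y => ψ y.2 ^ q') y := by
      refine Measurable.indicator (by fun_prop) (MeasurableSet.inter ?_ ?_)
      · exact (by fun_prop : Measurable fun y : (Cn n × sphere (0 : Cn n) 1) × Cn n =>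
          (y.2, y.1.2)) (measurableSet_korRegion_prod γ)
      · exact measurableSet_le (by fun_prop) (by fun_prop)
    have h2 := h1.lintegral_prod_right' (ν := weightedV n α)
    convert h2 using 2 with x
    simp only [hT]
    rw [← lintegral_indicator (measurableSet_korRegion γ _)]
    refine lintegral_congr fun w => ?_
    rw [← indicator_indicator]
    rfl
  have hTz : ∀ z, Measurable (T z) := fun z =>
    Measurable.of_uncurry_left (f := T) hTm
  have hTζ : ∀ ζ, Measurable fun z => T z ζ := fun ζ =>
    Measurable.of_uncurry_right (f := T) hTm
  set G : Cn n → Set (sphere (0 : Cn n) 1) := fun z => {ζ | T z ζ ≤ M * K} with hG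
  have hGm : ∀ z, MeasurableSet (G z) := fun z => measurableSet_le (hTz z) measurable_const
  -- The mean of the truncated area function over the shadow.
  have hmean : ∀ z ∈ unitBall n, z ≠ 0 →
      ∫⁻ ζ in shadow γ z, T z ζ ∂(σ n) ≤ C * R * K * weight n z := by
    intro z hz h0
    have hz1 := mem_unitBall.1 hz
    obtain ⟨η, hη, hzη, -⟩ := exists_normalize h0
    set r := 8 * γ * (1 - ‖z‖ ^ 2) with hr
    have hr0 : 0 < r := by have := one_sub_norm_sq_pos hz1; positivity
    have hSm := measurableSet_shadow γ z
    calc ∫⁻ ζ in shadow γ z, T z ζ ∂(σ n)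
        ≤ ∫⁻ ζ in shadow γ z, ∫⁻ w in korRegion γ (ζ : Cn n),
          (cap η r).indicator (fun w => ψ w ^ q') w ∂(weightedV n α) ∂(σ n) := by
          refine setLIntegral_mono' hSm fun ζ hζ => ?_
          refine setLIntegral_mono' (measurableSet_korRegion γ _) fun w hw => ?_
          by_cases hwz : w ∈ {w : Cn n | ‖z‖ ≤ ‖w‖}
          · rw [indicator_of_mem hwz, indicator_of_mem (mem_cap_of_shadow hγ hη hzη hζ hw hwz)]
          · rw [indicator_of_notMem hwz]; exact zero_le
      _ ≤ ∫⁻ ζ, ∫⁻ w in korRegion γ (ζ : Cn n),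
          (cap η r).indicator (fun w => ψ w ^ q') w ∂(weightedV n α) ∂(σ n) :=
          setLIntegral_le_lintegral _ _
      _ = ∫⁻ w, ∫⁻ ζ in shadow γ w, (cap η r).indicator (fun w => ψ w ^ q') w
          ∂(σ n) ∂(weightedV n α) :=
          lintegral_korRegion_swap (F := fun x => (cap η r).indicator (fun w => ψ w ^ q') x.1)
            (((hψ.pow_const q').indicator (measurableSet_cap η r)).comp measurable_fst)
      _ ≤ ∫⁻ w, C * (weight n w * (cap η r).indicator (fun w => ψ w ^ q') w)
          ∂(weightedV n α) := by
          refine lintegral_mono_ae ?_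
          filter_upwards [ae_weightedV_mem α, ae_weightedV_ne_zero hn α] with w hw hw0
          rw [setLIntegral_const, mul_comm, ← mul_assoc]
          exact mul_le_mul' (hC w hw hw0) le_rfl
      _ = C * ∫⁻ w in cap η r, ψ w ^ q' ∂(weightedV n (n + α)) := by
          rw [lintegral_const_mul' _ _ (by finiteness), lintegral_weight_mul,
            lintegral_indicator (measurableSet_cap η r)]
      _ ≤ C * (K * ENNReal.ofReal (r ^ n)) := mul_le_mul' le_rfl (hcar η hη r hr0)
      _ = _ := by
          rw [hr, mul_pow, ENNReal.ofReal_mul (by positivity), weight, Real.rpow_natCast, hR]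
          simp only [ENNReal.ofReal]
          ring
  -- Chebyshev's inequality on the shadow.
  have hgood : ∀ z ∈ unitBall n, z ≠ 0 →
      weight n z ≤ (2 / c : ℝ≥0) * σ n (shadow γ z ∩ G z) := by
    intro z hz h0
    have hMK : (M * K : ℝ≥0∞) ≠ 0 := by simp [hM0, hK0]
    have hbad : σ n (shadow γ z \ G z) ≤ (c / 2 : ℝ≥0) * weight n z := by
      have h1 : (M * K : ℝ≥0∞) * σ n (shadow γ z \ G z) ≤ C * R * K * weight n z := by
        calc (M * K : ℝ≥0∞) * σ n (shadow γ z \ G z)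
            = ∫⁻ ζ in shadow γ z \ G z, M * K ∂(σ n) := by rw [setLIntegral_const]
          _ ≤ ∫⁻ ζ in shadow γ z \ G z, T z ζ ∂(σ n) :=
              setLIntegral_mono' ((measurableSet_shadow γ z).diff (hGm z)) fun ζ hζ =>
                (not_le.1 hζ.2).le
          _ ≤ ∫⁻ ζ in shadow γ z, T z ζ ∂(σ n) := lintegral_mono_set sdiff_subset
          _ ≤ _ := hmean z hz h0
      have h2 : (C * R * K : ℝ≥0∞) * weight n z ≤
          (M * K) * ((c / 2 : ℝ≥0) * weight n z) := by
        rw [← mul_assoc]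
        refine mul_le_mul' ?_ le_rfl
        have : C * R * K ≤ M * K * (c / 2) := by
          have : M * K * (c / 2) = (C * R + 1) * K := by rw [hM]; field_simp
          rw [this]
          gcongr
          exact le_self_add
        exact_mod_cast this
      exact (ENNReal.mul_le_mul_iff_right hMK (by finiteness)).1 (h1.trans h2)
    have hsplit : (c : ℝ≥0∞) * weight n z ≤ σ n (shadow γ z ∩ G z) +
        (c / 2 : ℝ≥0) * weight n z := by
      refine (hc z hz h0).trans ?_
      rw [← measure_inter_add_sdiff (shadow γ z) (hGm z)]
      gcongr
    have hhalf : (c : ℝ≥0∞) * weight n z =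
        (c / 2 : ℝ≥0) * weight n z + (c / 2 : ℝ≥0) * weight n z := by
      rw [← add_mul, ← ENNReal.coe_add, add_halves]
    rw [hhalf] at hsplit
    have h3 := (ENNReal.add_le_add_iff_right (by have := weight_ne_top n z; finiteness)).1 hsplit
    calc weight n z = (2 / c : ℝ≥0) * ((c / 2 : ℝ≥0) * weight n z) := by
          rw [← mul_assoc, ← ENNReal.coe_mul, show 2 / c * (c / 2) = 1 by field_simp]
          simp
      _ ≤ _ := mul_le_mul' le_rfl h3
  -- Points of an approach region at which the truncated area function is small.
  have hnest : ∀ ζ : sphere (0 : Cn n) 1, ∫⁻ z in korRegion γ (ζ : Cn n),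
      {z | ζ ∈ G z}.indicator (fun z => ψ z ^ q') z ∂(weightedV n α) ≤ M * K := by
    intro ζ
    set ν := ((weightedV n α).restrict (korRegion γ (ζ : Cn n))).withDensity fun z => ψ z ^ q'
      with hν
    have h1 : ∀ z, T z ζ = ν {w | ‖z‖ ≤ ‖w‖} := by
      intro z
      have hm : MeasurableSet {w : Cn n | ‖z‖ ≤ ‖w‖} :=
        measurableSet_le measurable_const measurable_norm
      rw [hν, withDensity_apply _ hm, hT, ← lintegral_indicator hm]
    have h2 : MeasurableSet {z | ζ ∈ G z} :=
      measurableSet_le (hTζ ζ) measurable_const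
    have h3 := measure_superlevel_le ν (fun z => ‖z‖) (M * K)
    rw [lintegral_indicator h2, ← withDensity_apply _ h2]
    refine le_trans (measure_mono fun z hz => ?_) h3
    have : T z ζ ≤ M * K := hz
    rwa [h1] at this
  calc ∫⁻ z, φ z * ψ z ∂(weightedV n (n + α))
      = ∫⁻ z, weight n z * (φ z * ψ z) ∂(weightedV n α) := (lintegral_weight_mul _ _ _).symm
    _ ≤ ∫⁻ z, (2 / c : ℝ≥0) * ∫⁻ ζ in shadow γ z, (G z).indicator (fun _ => φ z * ψ z) ζ
          ∂(σ n) ∂(weightedV n α) := by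
        refine lintegral_mono_ae ?_
        filter_upwards [ae_weightedV_mem α, ae_weightedV_ne_zero hn α] with z hz hz0
        rw [lintegral_indicator (hGm z), setLIntegral_const, Measure.restrict_apply (hGm z),
          inter_comm]
        exact (mul_le_mul' (hgood z hz hz0) le_rfl).trans (le_of_eq (by ring))
    _ = (2 / c : ℝ≥0) * ∫⁻ ζ : sphere (0 : Cn n) 1, ∫⁻ z in korRegion γ (ζ : Cn n),
          {z | ζ ∈ G z}.indicator (fun z => φ z * ψ z) z ∂(weightedV n α) ∂(σ n) := by
        rw [lintegral_const_mul' _ _ (by finiteness)]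
        congr 1
        have hGp : MeasurableSet {x : Cn n × sphere (0 : Cn n) 1 | T x.1 x.2 ≤ M * K} :=
          measurableSet_le hTm measurable_const
        have := lintegral_korRegion_swap (γ := γ) (α := α)
          (F := {x : Cn n × sphere (0 : Cn n) 1 | T x.1 x.2 ≤ M * K}.indicator
            fun x => φ x.1 * ψ x.1) (Measurable.indicator (by fun_prop) hGp)
        exact this.symm
    _ ≤ (2 / c : ℝ≥0) * ∫⁻ ζ : sphere (0 : Cn n) 1, areaPow γ α q φ ζ ^ (1 / q) *
          ((M * K) ^ (1 / q') : ℝ≥0) ∂(σ n) := by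
        refine mul_le_mul' le_rfl (lintegral_mono fun ζ => ?_)
        have h2 : MeasurableSet {z | ζ ∈ G z} :=
          measurableSet_le (hTζ ζ) measurable_const
        have h1 := ENNReal.lintegral_mul_le_Lp_mul_Lq
          ((weightedV n α).restrict (korRegion γ (ζ : Cn n))) hqq (f := φ)
          (g := {z | ζ ∈ G z}.indicator ψ) hφ.aemeasurable (hψ.indicator h2).aemeasurable
        calc _ = ∫⁻ z in korRegion γ (ζ : Cn n), (φ * {z | ζ ∈ G z}.indicator ψ) z
              ∂(weightedV n α) := by
              refine lintegral_congr fun z => ?_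
              rw [Pi.mul_apply, indicator_mul_right]
          _ ≤ _ := h1
          _ ≤ _ := by
              refine mul_le_mul' le_rfl ?_
              rw [ENNReal.coe_rpow_of_nonneg _ (by positivity), ENNReal.coe_mul]
              refine ENNReal.rpow_le_rpow ?_ (by positivity)
              refine le_trans (le_of_eq (lintegral_congr fun z => ?_)) (hnest ζ)
              by_cases hz : z ∈ {z | ζ ∈ G z}
              · rw [indicator_of_mem hz, indicator_of_mem hz]
              · rw [indicator_of_notMem hz, indicator_of_notMem hz, ENNReal.zero_rpow_of_pos hq0']
    _ = _ := by
        rw [lintegral_mul_const' _ _ (by finiteness), tentOne]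
        push_cast
        ring

lemma measurable_areaPow {γ α q : ℝ} {φ : Cn n → ℝ≥0∞} (hφ : Measurable φ) :
    Measurable fun ζ : sphere (0 : Cn n) 1 => areaPow γ α q φ ζ := by
  have h1 : Measurable fun y : sphere (0 : Cn n) 1 × Cn n =>
      {y : sphere (0 : Cn n) 1 × Cn n | y.2 ∈ korRegion γ (y.1 : Cn n)}.indicator
        (fun y => φ y.2 ^ q) y := by
    refine Measurable.indicator (by fun_prop) ?_
    exact measurable_swap (measurableSet_korRegion_prod γ)
  have h2 := h1.lintegral_prod_right' (ν := weightedV n α)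
  convert h2 using 2 with ζ
  rw [areaPow, ← lintegral_indicator (measurableSet_korRegion γ _)]
  rfl

lemma areaPow_mono {γ α q : ℝ} (hq : 0 ≤ q) {φ ψ : Cn n → ℝ≥0∞} (h : ∀ z ∈ unitBall n, φ z ≤ ψ z)
    (ζ : Cn n) : areaPow γ α q φ ζ ≤ areaPow γ α q ψ ζ :=
  setLIntegral_mono' (measurableSet_korRegion γ ζ) fun z hz =>
    ENNReal.rpow_le_rpow (h z hz.1) hq

/-- Norming functions: if the area function of `h` is finite, its integral equals the pairing of
`h` with a function satisfying a Carleson condition with a constant independent of `h`. With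
`a` the area function of `h`, the latter is `h^{q-1}` times the average of `a^{1-q}` over
shadows, and the Carleson condition reduces to `a^{-q} a^q ≤ 1` through Jensen's inequality. -/
theorem exists_norming (hn : 1 ≤ n) {γ α q q' : ℝ} (hγ : 2 ≤ γ) (hqq : q.HolderConjugate q') :
    ∃ C : ℝ≥0, ∀ h : Cn n → ℝ≥0∞, Measurable h → (∀ ζ, areaPow γ α q h ζ ≠ ∞) →
      ∃ g : Cn n → ℝ≥0∞, Measurable g ∧ CarlesonBound (n + α) q' g C ∧
        tentOne γ α q h = ∫⁻ z, h z * g z ∂(weightedV n (n + α)) := by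
  have hq0 : 0 < q := hqq.pos
  have hq0' : 0 < q' := hqq.symm.pos
  have hq1 : 1 < q := hqq.lt
  obtain ⟨C, hC⟩ := sigma_shadow_le hn hγ
  obtain ⟨C', hC'⟩ := sigma_cap_le hn
  refine ⟨C ^ (q' / q) * (C' * Real.toNNReal ((4 * (γ + 1)) ^ n)), fun h hh hfin => ?_⟩
  set A : sphere (0 : Cn n) 1 → ℝ≥0∞ := fun ζ => areaPow γ α q h ζ with hA
  have hAm : Measurable A := measurable_areaPow hh
  set b : sphere (0 : Cn n) 1 → ℝ≥0∞ := {ζ | A ζ ≠ 0}.indicator fun ζ => A ζ ^ ((1 - q) / q) with hb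
  have hAs : MeasurableSet {ζ | A ζ ≠ 0} := (hAm (measurableSet_singleton 0)).compl
  have hbm : Measurable b := (hAm.pow_const _).indicator hAs
  set S : Cn n → ℝ≥0∞ := fun z => ∫⁻ ζ in shadow γ z, b ζ ∂(σ n) with hS
  have hmeasS : ∀ f : sphere (0 : Cn n) 1 → ℝ≥0∞, Measurable f →
      Measurable fun z : Cn n => ∫⁻ ζ in shadow γ z, f ζ ∂(σ n) := by
    intro f hf
    have h1 : Measurable fun y : Cn n × sphere (0 : Cn n) 1 =>
        {y : Cn n × sphere (0 : Cn n) 1 | y.1 ∈ korRegion γ (y.2 : Cn n)}.indicator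
          (fun y => f y.2) y :=
      Measurable.indicator (by fun_prop) (measurableSet_korRegion_prod γ)
    have h2 := h1.lintegral_prod_right' (ν := σ n)
    convert h2 using 2 with z
    rw [← lintegral_indicator (measurableSet_shadow γ _)]
    rfl
  have hSm : Measurable S := hmeasS b hbm
  refine ⟨fun z => h z ^ (q - 1) * (weight (-n) z * S z), by fun_prop, ?_, ?_⟩
  · intro ζ₀ hζ₀ δ hδ
    have hcm := measurableSet_cap ζ₀ δ
    -- Jensen's inequality for the average over the shadow.
    have hjensen : ∀ z ∈ unitBall n, z ≠ 0 →
        (h z ^ (q - 1) * (weight (-n) z * S z)) ^ q' ≤ weight (-n) z *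
          ((C ^ (q' / q) : ℝ≥0) * (h z ^ q * ∫⁻ ζ in shadow γ z, b ζ ^ q' ∂(σ n))) := by
      intro z hz h0
      have h1 : S z ≤ (C * weight n z) ^ (1 / q) *
          (∫⁻ ζ in shadow γ z, b ζ ^ q' ∂(σ n)) ^ (1 / q') := by
        have := ENNReal.lintegral_mul_le_Lp_mul_Lq ((σ n).restrict (shadow γ z)) hqq
          (f := fun _ => 1) (g := b) aemeasurable_const hbm.aemeasurable
        simp only [ENNReal.one_rpow, lintegral_const, Measure.restrict_apply_univ, one_mul] at this
        simp only [Pi.mul_apply, one_mul] at this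
        calc S z ≤ _ := this
          _ ≤ _ := by
            refine mul_le_mul' (ENNReal.rpow_le_rpow (hC z hz h0) (by positivity)) le_rfl
      have e1 : (q - 1) * q' = q := hqq.sub_one_mul_conj
      have e2 : -(n : ℝ) * q' + n * (q' / q) = -n := by
        have : q' / q = q' - 1 := by
          exact hqq.symm.div_conj_eq_sub_one
        rw [this]; ring
      calc (h z ^ (q - 1) * (weight (-n) z * S z)) ^ q'
          ≤ (h z ^ (q - 1) * (weight (-n) z * ((C * weight n z) ^ (1 / q) *
          (∫⁻ ζ in shadow γ z, b ζ ^ q' ∂(σ n)) ^ (1 / q')))) ^ q' := by gcongr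
        _ = weight (-n * q' + n * (q' / q)) z *
          ((C ^ (q' / q) : ℝ≥0) * (h z ^ q * ∫⁻ ζ in shadow γ z, b ζ ^ q' ∂(σ n))) := by
          simp only [ENNReal.mul_rpow_of_nonneg _ _ hq0'.le, ← ENNReal.rpow_mul]
          rw [e1, one_div_mul_cancel hq0'.ne', ENNReal.rpow_one, one_div_mul_eq_div,
            ENNReal.mul_rpow_of_nonneg _ _ (by positivity), weight_rpow _ _ hz,
            weight_rpow _ _ hz, weight_add _ _ hz, ENNReal.coe_rpow_of_nonneg _ (by positivity)]
          ring
        _ = _ := by rw [e2]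
    have hb1 : ∀ ζ, b ζ ^ q' * A ζ ≤ 1 := by
      intro ζ
      by_cases hζ : A ζ = 0
      · rw [hζ, mul_zero]; exact zero_le
      · rw [hb, indicator_of_mem (show ζ ∈ {ζ | A ζ ≠ 0} from hζ), ← ENNReal.rpow_mul]
        have e1 : (1 - q) / q * q' = -1 := by
          have := hqq.sub_one_mul_conj
          rw [div_mul_eq_mul_div, div_eq_iff hq0.ne']; linarith
        rw [e1, ENNReal.rpow_neg_one, ENNReal.inv_mul_cancel hζ (hfin ζ)]
    set D : Set (sphere (0 : Cn n) 1) := {ζ | gauge ζ₀ ζ < 4 * (γ + 1) * δ} with hD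
    have hDm : MeasurableSet D := measurableSet_sphere_cap _ _
    have hsub : ∀ ζ : sphere (0 : Cn n) 1, ζ ∉ D → ∀ z ∈ korRegion γ (ζ : Cn n), z ∉ cap ζ₀ δ := by
      intro ζ hζ z hz hzc
      refine hζ ?_
      obtain ⟨hz1, hzg⟩ := mem_korRegion.1 hz
      have h1 : ‖(ζ : Cn n)‖ = 1 := by simp
      have h2 := gauge_triangle hζ₀.le h1.le hz1.le
      have h3 := one_sub_norm_sq_le_gauge hz1.le hζ₀.le
      rw [gauge_comm ζ₀ z] at h2
      have h4 := hzc.2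
      rw [hD, mem_ofPred_eq]
      nlinarith
    calc ∫⁻ z in cap ζ₀ δ, (h z ^ (q - 1) * (weight (-n) z * S z)) ^ q' ∂(weightedV n (n + α))
        ≤ ∫⁻ z in cap ζ₀ δ, weight (-n) z * ((C ^ (q' / q) : ℝ≥0) * (h z ^ q *
            ∫⁻ ζ in shadow γ z, b ζ ^ q' ∂(σ n))) ∂(weightedV n (n + α)) := by
          refine setLIntegral_mono_ae' hcm ?_
          filter_upwards [ae_weightedV_ne_zero hn (n + α)] with z hz0 hz
          exact hjensen z hz.1 hz0
      _ = (C ^ (q' / q) : ℝ≥0) * ∫⁻ z in cap ζ₀ δ, h z ^ q *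
            ∫⁻ ζ in shadow γ z, b ζ ^ q' ∂(σ n) ∂(weightedV n α) := by
          rw [setLIntegral_weight_mul _ _ _ hcm, neg_add_cancel_left,
            lintegral_const_mul' _ _ (by finiteness)]
      _ = (C ^ (q' / q) : ℝ≥0) * ∫⁻ z, ∫⁻ ζ in shadow γ z,
            (cap ζ₀ δ).indicator (fun z => h z ^ q) z * b ζ ^ q' ∂(σ n) ∂(weightedV n α) := by
          congr 1
          rw [← lintegral_indicator hcm]
          refine lintegral_congr fun z => ?_
          rw [lintegral_const_mul _ (by fun_prop), indicator_mul_left]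
      _ = (C ^ (q' / q) : ℝ≥0) * ∫⁻ ζ : sphere (0 : Cn n) 1, ∫⁻ z in korRegion γ (ζ : Cn n),
            (cap ζ₀ δ).indicator (fun z => h z ^ q) z * b ζ ^ q' ∂(weightedV n α) ∂(σ n) := by
          have hFm : Measurable fun z => (cap ζ₀ δ).indicator (fun z => h z ^ q) z :=
            (hh.pow_const q).indicator hcm
          rw [lintegral_korRegion_swap (F := fun x =>
            (cap ζ₀ δ).indicator (fun z => h z ^ q) x.1 * b x.2 ^ q') (by fun_prop)]
      _ ≤ (C ^ (q' / q) : ℝ≥0) * ∫⁻ ζ, D.indicator 1 ζ ∂(σ n) := by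
          refine mul_le_mul' le_rfl (lintegral_mono fun ζ => ?_)
          by_cases hζ : ζ ∈ D
          · rw [indicator_of_mem hζ, lintegral_mul_const _ ((hh.pow_const q).indicator hcm)]
            refine le_trans ?_ (hb1 ζ)
            rw [mul_comm]
            refine mul_le_mul' le_rfl (lintegral_mono fun z => ?_)
            exact indicator_le_self _ _ _
          · rw [indicator_of_notMem hζ]
            refine le_of_eq ?_
            rw [setLIntegral_congr_fun (measurableSet_korRegion γ _) (g := fun _ => 0),
              lintegral_zero]
            intro z hz
            simp only
            rw [indicator_of_notMem (hsub ζ hζ z hz), zero_mul]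
      _ ≤ (C ^ (q' / q) : ℝ≥0) * (C' * ENNReal.ofReal ((4 * (γ + 1) * δ) ^ n)) := by
          rw [lintegral_indicator_one hDm]
          exact mul_le_mul' le_rfl (hC' ζ₀ hζ₀ _ (by positivity))
      _ = _ := by
          rw [mul_pow _ δ, ENNReal.ofReal_mul (by positivity)]
          push_cast
          simp only [ENNReal.ofReal]
          ring
  · have hpt : ∀ᵐ z ∂(weightedV n α), h z * (h z ^ (q - 1) * (weight (-n) z * S z)) =
        weight (-n) z * ∫⁻ ζ in shadow γ z, h z ^ q * b ζ ∂(σ n) := by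
      refine Filter.Eventually.of_forall fun z => ?_
      rw [lintegral_const_mul _ hbm]
      have : h z * h z ^ (q - 1) = h z ^ q := by
        conv_lhs => rw [← ENNReal.rpow_one (h z), ← ENNReal.rpow_mul, one_mul]
        rw [← ENNReal.rpow_add_of_nonneg _ _ zero_le_one (by linarith), add_sub_cancel]
      rw [← this]; ring
    rw [← lintegral_weight_mul]
    have hpt2 : ∫⁻ z, weight n z * (h z * (h z ^ (q - 1) * (weight (-n) z * S z)))
        ∂(weightedV n α) = ∫⁻ z, ∫⁻ ζ in shadow γ z, h z ^ q * b ζ ∂(σ n) ∂(weightedV n α) := by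
      refine lintegral_congr_ae ?_
      filter_upwards [hpt, ae_weightedV_mem α] with z h1 hz
      rw [h1, ← mul_assoc, ← weight_add _ _ hz, add_neg_cancel, weight_zero, one_mul]
    rw [hpt2, ← lintegral_korRegion_swap (F := fun x => h x.1 ^ q * b x.2) (by fun_prop)]
    refine lintegral_congr fun ζ => ?_
    change _ = ∫⁻ z in korRegion γ (ζ : Cn n), h z ^ q * b ζ ∂(weightedV n α)
    rw [lintegral_mul_const _ (by fun_prop)]
    change A ζ ^ (1 / q) = A ζ * b ζ
    by_cases hζ : A ζ = 0
    · rw [hζ, zero_mul, ENNReal.zero_rpow_of_pos (by positivity)]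
    · rw [hb, indicator_of_mem (show ζ ∈ {ζ | A ζ ≠ 0} from hζ)]
      conv_rhs => rw [← ENNReal.rpow_one (A ζ), ← ENNReal.rpow_mul, one_mul]
      rw [← ENNReal.rpow_add _ _ hζ (hfin ζ)]
      congr 1
      field_simp
      ring

/-- Symmetry of the positive Bergman operator. -/
lemma lintegral_posBergman_mul (β : ℝ) {φ ψ : Cn n → ℝ≥0∞} (hφ : Measurable φ)
    (hψ : Measurable ψ) : ∫⁻ z, posBergman β φ z * ψ z ∂(weightedV n β) =
      ∫⁻ z, φ z * posBergman β ψ z ∂(weightedV n β) := by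
  have e1 : ∀ z, posBergman β φ z * ψ z =
      ∫⁻ u, φ u * kern (1 + n + β) z u * ψ z ∂(weightedV n β) := fun z => by
    rw [lintegral_mul_const _ (by fun_prop)]; rfl
  have e2 : ∀ u, φ u * posBergman β ψ u =
      ∫⁻ z, φ u * (ψ z * kern (1 + n + β) u z) ∂(weightedV n β) := fun u => by
    rw [lintegral_const_mul _ (by fun_prop)]; rfl
  simp_rw [e1, e2]
  rw [lintegral_lintegral_swap (f := fun z u => φ u * kern (1 + n + β) z u * ψ z)
    (by simp only [Function.uncurry_def]; fun_prop)]
  refine lintegral_congr fun u => lintegral_congr fun z => ?_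
  rw [kern_comm _ z u]; ring

/-- A truncation making area functions finite, for every power `α` of the weight: the factor
`(1 - |z|²)^{|α|}` compensates a negative `α`. -/
lemma areaPow_min_ne_top {γ α q : ℝ} (hq : 0 < q) (φ : Cn n → ℝ≥0∞) (k : ℕ) (ζ : Cn n) :
    areaPow γ α q (fun z => min (φ z) (k * weight (|α| / q) z)) ζ ≠ ∞ := by
  have h1 : areaPow γ α q (fun z => min (φ z) (k * weight (|α| / q) z)) ζ ≤
      ∫⁻ z, (k : ℝ≥0∞) ^ q * weight |α| z ∂(weightedV n α) := by
    refine (setLIntegral_le_lintegral _ _).trans (lintegral_mono_ae ?_)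
    filter_upwards [ae_weightedV_mem α] with z hz
    refine (ENNReal.rpow_le_rpow (min_le_right _ _) hq.le).trans (le_of_eq ?_)
    rw [ENNReal.mul_rpow_of_nonneg _ _ hq.le, weight_rpow _ _ hz, div_mul_cancel₀ _ hq.ne']
  have h2 : ∫⁻ z, weight |α| z ∂(weightedV n α) ≤ 1 := by
    have := lintegral_weight_mul |α| α (fun _ : Cn n => 1)
    simp only [mul_one] at this
    rw [this, lintegral_weightedV]
    calc _ ≤ ∫⁻ _ : Cn n, 1 ∂(V n) := by
          refine lintegral_mono_ae ?_
          filter_upwards [ae_V_mem] with z hz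
          have h3 := one_sub_norm_sq_pos (mem_unitBall.1 hz)
          rw [mul_one, ENNReal.ofReal_le_one]
          exact Real.rpow_le_one h3.le (by nlinarith [norm_nonneg z])
            (by linarith [neg_abs_le α])
      _ = 1 := by simp
  refine ne_top_of_le_ne_top ?_ h1
  rw [lintegral_const_mul' _ _ (by finiteness)]
  exact ENNReal.mul_ne_top (by finiteness) (ne_top_of_le_ne_top ENNReal.one_ne_top h2)

/-- The positive Bergman operator is bounded on `T^1_{q,α}`, by duality with its action on Carleson
measures. -/
theorem tentOne_posBergman_le (hn : 1 ≤ n) {γ α q : ℝ} (hγ : 2 ≤ γ) (hq : 1 < q)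
    (hα : -(n : ℝ) - 1 < α) : ∃ C : ℝ≥0, ∀ φ : Cn n → ℝ≥0∞, Measurable φ →
      tentOne γ α q (posBergman (n + α) φ) ≤ C * tentOne γ α q φ := by
  obtain ⟨q', hqq⟩ : ∃ q', q.HolderConjugate q' := ⟨_, Real.HolderConjugate.conjExponent hq⟩
  have hq0 : 0 < q := hqq.pos
  obtain ⟨C₁, h₁⟩ := exists_norming (α := α) hn hγ hqq
  obtain ⟨C₂, h₂⟩ := CarlesonBound.posBergman hn (β := n + α) (by linarith) hqq.symm.lt
  obtain ⟨C₃, h₃⟩ := lintegral_mul_le_tentOne (α := α) hn hγ hqq (K := C₂ * C₁ + 1)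
    (by positivity)
  refine ⟨C₃, fun φ hφ => ?_⟩
  set P := TentBall.posBergman (n + α) φ with hP
  have hPm : Measurable P := measurable_posBergman _ hφ
  set h : ℕ → Cn n → ℝ≥0∞ := fun k z => min (P z) (k * weight (|α| / q) z) with hh
  have hhm : ∀ k, Measurable (h k) := fun k => by fun_prop
  have hbound : ∀ k, tentOne γ α q (h k) ≤ C₃ * tentOne γ α q φ := by
    intro k
    obtain ⟨g, hgm, hgc, hg⟩ := h₁ (h k) (hhm k) fun ζ => areaPow_min_ne_top hq0 _ _ _
    rw [hg]
    calc _ ≤ ∫⁻ z, P z * g z ∂(weightedV n (n + α)) :=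
          lintegral_mono fun z => mul_le_mul' (min_le_left _ _) le_rfl
      _ = ∫⁻ z, φ z * TentBall.posBergman (n + α) g z ∂(weightedV n (n + α)) :=
          lintegral_posBergman_mul _ hφ hgm
      _ ≤ _ := by
          refine h₃ φ _ hφ (by fun_prop) fun ζ hζ δ hδ => ?_
          refine (h₂ g hgm C₁ hgc ζ hζ δ hδ).trans (mul_le_mul' ?_ le_rfl)
          push_cast
          exact le_self_add
  have hmono : Monotone h := fun j k hjk z => by
    refine min_le_min le_rfl (mul_le_mul' ?_ le_rfl)
    exact_mod_cast hjk
  have hlim : ∀ z ∈ unitBall n, Filter.Tendsto (fun k => h k z) Filter.atTop (nhds (P z)) := by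
    intro z hz
    have h1 : Filter.Tendsto (fun k : ℕ => (k : ℝ≥0∞) * weight (|α| / q) z) Filter.atTop
        (nhds (∞ * weight (|α| / q) z)) :=
      ENNReal.Tendsto.mul_const ENNReal.tendsto_nat_nhds_top (Or.inr (weight_ne_top _ _))
    rw [ENNReal.top_mul (weight_ne_zero _ hz)] at h1
    have h2 := (tendsto_const_nhds (x := P z) (f := Filter.atTop (α := ℕ))).min h1
    rwa [min_eq_left le_top] at h2
  have hA : ∀ ζ : Cn n, Filter.Tendsto (fun k => areaPow γ α q (h k) ζ) Filter.atTop
      (nhds (areaPow γ α q P ζ)) := by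
    intro ζ
    refine lintegral_tendsto_of_tendsto_of_monotone (fun k => by fun_prop)
      (Filter.Eventually.of_forall fun z j k hjk => ENNReal.rpow_le_rpow (hmono hjk z) hq0.le) ?_
    filter_upwards [ae_restrict_mem (measurableSet_korRegion γ ζ)] with z hz
    exact (ENNReal.continuous_rpow_const.tendsto _).comp (hlim z hz.1)
  have hT : Filter.Tendsto (fun k => tentOne γ α q (h k)) Filter.atTop
      (nhds (tentOne γ α q P)) := by
    refine lintegral_tendsto_of_tendsto_of_monotone
      (fun k => ((measurable_areaPow (hhm k)).pow_const _).aemeasurable)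
      (Filter.Eventually.of_forall fun ζ j k hjk => ENNReal.rpow_le_rpow
        (areaPow_mono hq0.le (fun z _ => hmono hjk z) _) (by positivity))
      (Filter.Eventually.of_forall fun ζ => ?_)
    exact (ENNReal.continuous_rpow_const.tendsto _).comp (hA ζ)
  exact le_of_tendsto' hT hbound

/-! ### Moments of one coordinate -/

lemma lintegral_Ioi_gauss {m : ℕ} (hm : 1 ≤ m) :
    ∫⁻ r in Ioi (0 : ℝ), ENNReal.ofReal (r ^ (2 * m - 1) * Real.exp (-r ^ 2)) =
      ENNReal.ofReal (Real.Gamma m / 2) := by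
  have hs : ((2 * m - 1 : ℕ) : ℝ) = 2 * m - 1 := by
    rw [Nat.cast_sub (by omega)]; push_cast; ring
  have h0 : (-1 : ℝ) < ((2 * m - 1 : ℕ) : ℝ) := by
    have : (0 : ℝ) ≤ ((2 * m - 1 : ℕ) : ℝ) := Nat.cast_nonneg _
    linarith
  have h1 := integrableOn_rpow_mul_exp_neg_rpow (p := 2) h0 (by norm_num)
  have h2 := integral_rpow_mul_exp_neg_rpow (p := 2) (by norm_num) h0
  simp only [Real.rpow_natCast, Real.rpow_ofNat] at h1 h2
  rw [← ofReal_integral_eq_lintegral_ofReal h1, h2, hs]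
  · congr 1
    rw [show (2 * (m : ℝ) - 1 + 1) / 2 = m by ring]
    ring
  · filter_upwards [ae_restrict_mem measurableSet_Ioi] with r hr
    have : (0 : ℝ) < r := hr
    positivity

/-- The Gaussian moment of a coordinate, in Cartesian coordinates. -/
lemma exists_gauss_moment (n : ℕ) : ∃ c : ℝ≥0, ∀ (i₀ : Fin n) (j : ℕ),
    ∫⁻ u : Cn n, ENNReal.ofReal (‖u i₀‖ ^ (2 * j) * Real.exp (-‖u‖ ^ 2)) =
      c * ENNReal.ofReal (j.factorial * Real.pi ^ n) := by
  obtain ⟨c, -, hc⟩ := exists_map_ofLp_volume n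
  refine ⟨c, fun i₀ j => ?_⟩
  set f : Fin n → ℂ → ℝ := fun i w => ‖w‖ ^ (if i = i₀ then 2 * j else 0) * Real.exp (-‖w‖ ^ 2)
    with hf
  have h1 : ∀ m : ℕ, ∫ w : ℂ, ‖w‖ ^ (2 * m) * Real.exp (-‖w‖ ^ 2) = Real.pi * m.factorial := by
    intro m
    have hm : (-2 : ℝ) < ((2 * m : ℕ) : ℝ) := by
      have : (0 : ℝ) ≤ ((2 * m : ℕ) : ℝ) := Nat.cast_nonneg _
      linarith
    have := Complex.integral_rpow_mul_exp_neg_rpow (p := 2) (by norm_num) hm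
    simp only [Real.rpow_natCast, Real.rpow_ofNat] at this
    rw [this, show (((2 * m : ℕ) : ℝ) + 2) / 2 = m + 1 by push_cast; ring,
      Real.Gamma_nat_eq_factorial]
    ring
  have h2 : ∀ i, ∫ w, f i w = if i = i₀ then Real.pi * j.factorial else Real.pi := by
    intro i
    simp only [hf]
    split_ifs
    · exact h1 j
    · simpa using h1 0
  -- A Bochner integral with nonzero value is that of an integrable function.
  have hfi : ∀ i, Integrable (f i) := fun i => by
    by_contra h
    have h3 := integral_undef h
    rw [h2] at h3
    have := Real.pi_pos
    have := Nat.factorial_pos j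
    split_ifs at h3
    · exact (by positivity : Real.pi * j.factorial ≠ 0) h3
    · exact Real.pi_pos.ne' h3
  have hprod : Integrable fun x : Fin n → ℂ => ∏ i, f i (x i) := Integrable.fintype_prod hfi
  have hpt : ∀ u : Cn n, ‖u i₀‖ ^ (2 * j) * Real.exp (-‖u‖ ^ 2) = ∏ i, f i (u.ofLp i) := by
    intro u
    simp only [hf]
    rw [Finset.prod_mul_distrib, ← Real.exp_sum, EuclideanSpace.norm_sq_eq, Finset.sum_neg_distrib]
    congr 1
    rw [Finset.prod_eq_single i₀ (fun i _ hi => by rw [if_neg hi, pow_zero])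
      (fun h => (h (Finset.mem_univ _)).elim), if_pos rfl]
  have hmeas : Measurable fun x : Fin n → ℂ => ENNReal.ofReal (∏ i, f i (x i)) := by
    simp only [hf]; fun_prop
  simp_rw [hpt]
  calc ∫⁻ u : Cn n, ENNReal.ofReal (∏ i, f i (u.ofLp i))
      = ∫⁻ x, ENNReal.ofReal (∏ i, f i (x i))
          ∂(Measure.map (WithLp.ofLp : Cn n → Fin n → ℂ) volume) := by
        rw [lintegral_map hmeas (by fun_prop)]
    _ = c * ENNReal.ofReal (∏ i, ∫ w, f i w) := by
        rw [hc, lintegral_smul_measure, smul_eq_mul, ← integral_fintype_prod_volume_eq_prod,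
          ← ofReal_integral_eq_lintegral_ofReal hprod]
        refine Filter.Eventually.of_forall fun x => Finset.prod_nonneg fun i _ => ?_
        simp only [hf]; positivity
    _ = _ := by
        congr 2
        simp_rw [h2]
        rw [← Finset.mul_prod_erase _ _ (Finset.mem_univ i₀), if_pos rfl,
          Finset.prod_congr rfl (fun i hi => if_neg (Finset.ne_of_mem_erase hi)),
          Finset.prod_const, Finset.card_erase_of_mem (Finset.mem_univ _), Finset.card_univ,
          Fintype.card_fin, mul_comm Real.pi, mul_assoc, ← pow_succ',
          Nat.sub_add_cancel (Fin.pos i₀)]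

/-- Moments of a coordinate on the sphere, by comparing the Gaussian moments computed in
Cartesian and in polar coordinates. -/
lemma sphere_moment (i₀ : Fin n) (j : ℕ) :
    ∫⁻ ζ : sphere (0 : Cn n) 1, ENNReal.ofReal (‖(ζ : Cn n) i₀‖ ^ (2 * j)) ∂(σ n) =
      ENNReal.ofReal (j.factorial * Real.Gamma n / Real.Gamma (n + j)) := by
  have hn : 1 ≤ n := Fin.pos i₀
  obtain ⟨c, hc⟩ := exists_gauss_moment n
  set S : ℕ → ℝ≥0∞ := fun j => ∫⁻ ζ : sphere (0 : Cn n) 1,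
    ENNReal.ofReal (‖(ζ : Cn n) i₀‖ ^ (2 * j)) ∂(volume : Measure (Cn n)).toSphere with hS
  have hΓ : ∀ j : ℕ, 0 < Real.Gamma (n + j) := fun j => by
    apply Real.Gamma_pos_of_pos
    have : (1 : ℝ) ≤ n := by exact_mod_cast hn
    positivity
  have key : ∀ j, S j * ENNReal.ofReal (Real.Gamma (n + j) / 2) =
      c * ENNReal.ofReal (j.factorial * Real.pi ^ n) := by
    intro j
    rw [← hc i₀ j, lintegral_polar hn (by fun_prop), hS]
    simp only
    rw [← lintegral_mul_const _ (by fun_prop)]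
    refine lintegral_congr fun ζ => ?_
    have hcast : (n : ℝ) + j = ((n + j : ℕ) : ℝ) := by push_cast; ring
    rw [hcast, ← lintegral_Ioi_gauss (m := n + j) (by omega),
      ← lintegral_const_mul _ (by fun_prop)]
    refine setLIntegral_congr_fun measurableSet_Ioi fun r hr => ?_
    have hr0 : (0 : ℝ) < r := hr
    have h1 : ‖(r : ℂ) • (ζ : Cn n)‖ = r := by
      rw [norm_smul, Complex.norm_real, Real.norm_of_nonneg hr0.le]; simp
    rw [h1, PiLp.smul_apply, norm_smul, Complex.norm_real, Real.norm_of_nonneg hr0.le,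
      ← ENNReal.ofReal_mul (by positivity), ← ENNReal.ofReal_mul (by positivity)]
    congr 1
    rw [show 2 * (n + j) - 1 = (2 * n - 1) + 2 * j by omega, pow_add, mul_pow]
    ring
  have h0 := key 0
  have hS0 : S 0 = (volume : Measure (Cn n)).toSphere univ := by simp [hS]
  have hT0 : (volume : Measure (Cn n)).toSphere univ ≠ 0 := by
    rw [Measure.toSphere_apply_univ, finrank_Cn]
    refine mul_ne_zero ?_ volume_unitBall_ne_zero
    simp; omega
  rw [hS0] at h0
  have hj := key j
  have h2 : (c : ℝ≥0∞) * ENNReal.ofReal (j.factorial * Real.pi ^ n) =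
      ENNReal.ofReal j.factorial * (c * ENNReal.ofReal ((Nat.factorial 0 : ℕ) * Real.pi ^ n)) := by
    rw [ENNReal.ofReal_mul (by positivity)]
    simp only [Nat.factorial_zero, Nat.cast_one, one_mul]
    ring
  rw [h2, ← h0] at hj
  rw [σ, lintegral_smul_measure, smul_eq_mul]
  change _ * S j = _
  set T := (volume : Measure (Cn n)).toSphere univ with hT
  have hTtop : T ≠ ∞ := measure_ne_top _ _
  have h3 : T⁻¹ * S j * ENNReal.ofReal (Real.Gamma (n + j) / 2) =
      ENNReal.ofReal (j.factorial * Real.Gamma n / Real.Gamma (n + j)) *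
        ENNReal.ofReal (Real.Gamma (n + j) / 2) := by
    have hΓj := hΓ j
    have hΓ0 := hΓ 0
    simp only [Nat.cast_zero, add_zero] at hΓ0 hj
    rw [mul_assoc, hj, mul_left_comm, ← mul_assoc T⁻¹, ENNReal.inv_mul_cancel hT0 hTtop, one_mul,
      ← ENNReal.ofReal_mul (by positivity), ← ENNReal.ofReal_mul (by positivity)]
    congr 1
    field_simp
  refine (ENNReal.mul_left_inj ?_ ENNReal.ofReal_ne_top).1 h3
  rw [ne_eq, ENNReal.ofReal_eq_zero, not_le]
  have := hΓ j
  positivity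

lemma lintegral_beta {a b : ℝ} (ha : 0 < a) (hb : 0 < b) :
    ∫⁻ x in Ioo (0 : ℝ) 1, ENNReal.ofReal (x ^ (a - 1) * (1 - x) ^ (b - 1)) =
      ENNReal.ofReal (Real.Gamma a * Real.Gamma b / Real.Gamma (a + b)) := by
  have hB := ProbabilityTheory.beta_pos ha hb
  have h := ProbabilityTheory.lintegral_betaPDF_eq_one ha hb
  rw [ProbabilityTheory.lintegral_betaPDF] at h
  have h1 : ∫⁻ x in Ioo (0 : ℝ) 1, ENNReal.ofReal (x ^ (a - 1) * (1 - x) ^ (b - 1)) =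
      ENNReal.ofReal (ProbabilityTheory.beta a b) * ∫⁻ x in Ioo (0 : ℝ) 1,
        ENNReal.ofReal (1 / ProbabilityTheory.beta a b * x ^ (a - 1) * (1 - x) ^ (b - 1)) := by
    rw [← lintegral_const_mul _ (by fun_prop)]
    refine lintegral_congr fun x => ?_
    rw [← ENNReal.ofReal_mul hB.le]
    congr 1
    field_simp
  rw [h1, h, mul_one]; rfl

/-- The radial moments, by the substitution `x = r²` in the Beta integral. -/
lemma lintegral_radial {m : ℕ} (hm : 1 ≤ m) {β : ℝ} (hβ : -1 < β) :
    ∫⁻ r in Ioo (0 : ℝ) 1, ENNReal.ofReal (2 * r ^ (2 * m - 1) * (1 - r ^ 2) ^ β) =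
      ENNReal.ofReal (Real.Gamma m * Real.Gamma (β + 1) / Real.Gamma (m + β + 1)) := by
  have hm0 : (0 : ℝ) < m := by exact_mod_cast hm
  have himg : (fun r : ℝ => r ^ 2) '' Ioo 0 1 = Ioo 0 1 := by
    ext x
    constructor
    · rintro ⟨r, ⟨h0, h1⟩, rfl⟩
      exact ⟨by positivity, by simp only; nlinarith⟩
    · rintro ⟨h0, h1⟩
      refine ⟨√x, ⟨Real.sqrt_pos.2 h0, ?_⟩, Real.sq_sqrt h0.le⟩
      rw [Real.sqrt_lt' one_pos]; simpa using h1
  have h := lintegral_image_eq_lintegral_abs_deriv_mul (s := Ioo (0 : ℝ) 1)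
    (f := fun r : ℝ => r ^ 2) (f' := fun r => 2 * r) measurableSet_Ioo
    (fun x _ => by simpa using (hasDerivAt_pow 2 x).hasDerivWithinAt)
    (fun x hx y hy hxy => (pow_left_inj₀ hx.1.le hy.1.le two_ne_zero).1 hxy)
    (fun x => ENNReal.ofReal (x ^ ((m : ℝ) - 1) * (1 - x) ^ (β + 1 - 1)))
  rw [himg, lintegral_beta hm0 (by linarith), ← add_assoc] at h
  rw [h]
  refine setLIntegral_congr_fun measurableSet_Ioo fun r hr => ?_
  have hr0 := hr.1
  rw [abs_of_pos (by linarith), ← ENNReal.ofReal_mul (by linarith)]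
  congr 1
  rw [add_sub_cancel_right, ← Real.rpow_natCast r 2, ← Real.rpow_mul hr0.le]
  have e1 : r ^ (2 * m - 1) = r * r ^ (((2 : ℕ) : ℝ) * ((m : ℝ) - 1)) := by
    conv_rhs => rw [← Real.rpow_one r]
    rw [Real.rpow_one, ← Real.rpow_natCast, ← Real.rpow_one_add' hr0.le]
    · congr 1
      rw [Nat.cast_sub (by omega)]; push_cast; ring
    · push_cast
      have : (1 : ℝ) ≤ m := by exact_mod_cast hm
      linarith
  rw [e1]; ring

/-- Moments of a coordinate on the weighted ball. -/
lemma ball_moment (i₀ : Fin n) (j : ℕ) {β : ℝ} (hβ : -1 < β) :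
    ∫⁻ u, ENNReal.ofReal (‖u i₀‖ ^ (2 * j)) ∂(weightedV n β) = ENNReal.ofReal
      (n.factorial * j.factorial * Real.Gamma (β + 1) / Real.Gamma (n + j + β + 1)) := by
  have hn : 1 ≤ n := Fin.pos i₀
  have hn0 : (1 : ℝ) ≤ n := by exact_mod_cast hn
  rw [lintegral_weightedV, lintegral_V_polar (F := fun z => ENNReal.ofReal ((1 - ‖z‖ ^ 2) ^ β) *
    ENNReal.ofReal (‖z i₀‖ ^ (2 * j))) hn (by fun_prop)]
  have h1 : ∀ ζ : sphere (0 : Cn n) 1, ∫⁻ r in Ioo (0 : ℝ) 1,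
      ENNReal.ofReal (2 * n * r ^ (2 * n - 1)) * (ENNReal.ofReal
        ((1 - ‖(r : ℂ) • (ζ : Cn n)‖ ^ 2) ^ β) * ENNReal.ofReal (‖((r : ℂ) • (ζ : Cn n)) i₀‖ ^ (2 * j)))
      = ENNReal.ofReal (‖(ζ : Cn n) i₀‖ ^ (2 * j)) * (ENNReal.ofReal n * ENNReal.ofReal
        (Real.Gamma (n + j) * Real.Gamma (β + 1) / Real.Gamma (n + j + β + 1))) := by
    intro ζ
    have hcast : (n : ℝ) + j = ((n + j : ℕ) : ℝ) := by push_cast; ring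
    rw [hcast, ← lintegral_radial (m := n + j) (by omega) hβ, ← lintegral_const_mul _ (by fun_prop),
      ← lintegral_const_mul _ (by fun_prop)]
    refine setLIntegral_congr_fun measurableSet_Ioo fun r hr => ?_
    have hr0 := hr.1
    have hr1 : 0 < 1 - r ^ 2 := by nlinarith [hr.2]
    have h1 : ‖(r : ℂ) • (ζ : Cn n)‖ = r := by
      rw [norm_smul, Complex.norm_real, Real.norm_of_nonneg hr0.le]; simp
    simp only
    rw [h1, PiLp.smul_apply, norm_smul, Complex.norm_real, Real.norm_of_nonneg hr0.le,
      ← ENNReal.ofReal_mul (by positivity), ← ENNReal.ofReal_mul (by positivity),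
      ← ENNReal.ofReal_mul (by positivity), ← ENNReal.ofReal_mul (by positivity)]
    congr 1
    rw [show 2 * (n + j) - 1 = (2 * n - 1) + 2 * j by omega, pow_add, mul_pow]
    ring
  simp_rw [h1]
  have hΓn : 0 < Real.Gamma n := Real.Gamma_pos_of_pos (by linarith)
  have hΓnj : 0 < Real.Gamma (n + j) := Real.Gamma_pos_of_pos (by positivity)
  have hΓβ : 0 < Real.Gamma (β + 1) := Real.Gamma_pos_of_pos (by linarith)
  rw [lintegral_mul_const _ (by fun_prop), sphere_moment, ← ENNReal.ofReal_mul (by positivity),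
    ← ENNReal.ofReal_mul (by positivity)]
  congr 1
  have e1 : (n.factorial : ℝ) = n * Real.Gamma n := by
    rw [← Real.Gamma_add_one (by linarith), Real.Gamma_nat_eq_factorial]
  rw [e1]
  field_simp

/-! ### Rotations and averages -/

lemma measurePreserving_V (e : Cn n ≃ₗᵢ[ℂ] Cn n) : MeasurePreserving e (V n) (V n) := by
  have h := (measurePreserving_unitary e).restrict_preimage (measurableSet_unitBall (n := n))
  have h2 : e ⁻¹' unitBall n = unitBall n := by
    ext u; simp [mem_unitBall]
  rw [h2] at h
  exact h.smul_measure _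

lemma measurePreserving_weightedV (e : Cn n ≃ₗᵢ[ℂ] Cn n) (t : ℝ) :
    MeasurePreserving e (weightedV n t) (weightedV n t) := by
  have hm : Measurable e := e.continuous.measurable
  refine ⟨hm, Measure.ext fun A hA => ?_⟩
  rw [Measure.map_apply hm hA, weightedV, withDensity_apply _ (hm hA), withDensity_apply _ hA,
    ← (measurePreserving_V e).setLIntegral_comp_preimage hA (measurable_weight t)]
  simp

lemma isFiniteMeasure_weightedV (hn : 1 ≤ n) {β : ℝ} (hβ : -1 < β) :
    IsFiniteMeasure (weightedV n β) := by
  have h := ball_moment (⟨0, hn⟩ : Fin n) 0 hβ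
  simp only [mul_zero, pow_zero, ENNReal.ofReal_one, lintegral_const, one_mul] at h
  exact ⟨by rw [h]; exact ENNReal.ofReal_lt_top⟩

/-- The linear map multiplying the coordinate `i₀` by `a` and all other coordinates by `b`. -/
noncomputable def rot (i₀ : Fin n) (a b : ℂ) (u : Cn n) : Cn n :=
  WithLp.toLp 2 fun i => if i = i₀ then a * u i else b * u i

lemma norm_rot_sq (i₀ : Fin n) (a b : ℂ) (u : Cn n) : ‖rot i₀ a b u‖ ^ 2 =
    ‖a‖ ^ 2 * ‖u i₀‖ ^ 2 + ‖b‖ ^ 2 * ∑ i ∈ Finset.univ.erase i₀, ‖u i‖ ^ 2 := by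
  rw [norm_sq_eq_add_sum_erase i₀]
  simp only [rot, if_true, norm_mul, mul_pow]
  rw [Finset.mul_sum]
  congr 1
  refine Finset.sum_congr rfl fun i hi => ?_
  rw [if_neg (Finset.ne_of_mem_erase hi), norm_mul, mul_pow]

lemma norm_rot_le (i₀ : Fin n) {a b : ℂ} (ha : ‖a‖ ≤ 1) (hb : ‖b‖ ≤ 1) (u : Cn n) :
    ‖rot i₀ a b u‖ ≤ ‖u‖ := by
  have h1 := norm_rot_sq i₀ a b u
  have h2 := norm_sq_eq_add_sum_erase i₀ u
  have h3 : 0 ≤ ∑ i ∈ Finset.univ.erase i₀, ‖u i‖ ^ 2 := Finset.sum_nonneg fun _ _ => sq_nonneg _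
  have h4 : ‖a‖ ^ 2 ≤ 1 := pow_le_one₀ (norm_nonneg _) ha
  have h5 : ‖b‖ ^ 2 ≤ 1 := pow_le_one₀ (norm_nonneg _) hb
  refine le_of_sq_le_sq ?_ (norm_nonneg _)
  rw [h1, h2]
  nlinarith [sq_nonneg ‖u i₀‖]

lemma rot_apply_self (i₀ : Fin n) (a b : ℂ) (u : Cn n) : rot i₀ a b u i₀ = a * u i₀ := by
  simp [rot]

lemma rot_add_smul (i₀ : Fin n) (a b : ℂ) (u : Cn n) :
    rot i₀ a b u = a • rot i₀ 1 0 u + b • rot i₀ 0 1 u := by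
  ext i
  by_cases h : i = i₀ <;> simp [rot, h]

/-- For unimodular `a` and `b`, `rot` is unitary. -/
lemma exists_unitary_eq_rot (i₀ : Fin n) {a b : ℂ} (ha : ‖a‖ = 1) (hb : ‖b‖ = 1) :
    ∃ e : Cn n ≃ₗᵢ[ℂ] Cn n, ∀ u, e u = rot i₀ a b u := by
  let L : Cn n →ₗᵢ[ℂ] Cn n :=
    { toFun := rot i₀ a b
      map_add' := fun u v => by
        ext i; by_cases h : i = i₀ <;> simp [rot, h, mul_add]
      map_smul' := fun c u => by
        ext i; by_cases h : i = i₀ <;> simp [rot, h, mul_left_comm]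
      norm_map' := fun u => by
        have h1 := norm_rot_sq i₀ a b u
        rw [ha, hb, one_pow, one_mul, one_mul, ← norm_sq_eq_add_sum_erase] at h1
        exact (pow_left_inj₀ (norm_nonneg _) (norm_nonneg _) two_ne_zero).1 h1 }
  exact ⟨L.toLinearIsometryEquiv rfl, fun u => rfl⟩

lemma measurable_rot (i₀ : Fin n) : Measurable fun p : (ℂ × ℂ) × Cn n => rot i₀ p.1.1 p.1.2 p.2 := by
  unfold rot
  refine (by fun_prop : Measurable (WithLp.toLp 2 : (Fin n → ℂ) → Cn n)).comp ?_
  refine measurable_pi_iff.2 fun i => ?_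
  split_ifs <;> fun_prop

lemma measurePreserving_rot_prod (i₀ : Fin n) (β : ℝ) {a b : ℝ → ℂ} (τ : Measure ℝ) [SFinite τ]
    (ha : Measurable a) (hb : Measurable b) (ha1 : ∀ θ, ‖a θ‖ = 1)
    (hb1 : ∀ θ, ‖b θ‖ = 1) :
    MeasurePreserving (fun p : ℝ × Cn n => (p.1, rot i₀ (a p.1) (b p.1) p.2))
      (τ.prod (weightedV n β)) (τ.prod (weightedV n β)) := by
  have hgm : Measurable (Function.uncurry fun θ u => rot i₀ (a θ) (b θ) u) := by
    have h1 : Measurable fun p : ℝ × Cn n => (((a p.1, b p.1) : ℂ × ℂ), p.2) := by fun_prop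
    have h2 := (measurable_rot i₀).comp h1
    exact h2
  have hmap : ∀ᵐ θ ∂τ, Measure.map (fun u => rot i₀ (a θ) (b θ) u) (weightedV n β) =
      weightedV n β := by
    refine Filter.Eventually.of_forall fun θ => ?_
    obtain ⟨e, he⟩ := exists_unitary_eq_rot i₀ (ha1 θ) (hb1 θ)
    have h : (fun u => rot i₀ (a θ) (b θ) u) = e := by funext u; exact (he u).symm
    rw [h]
    exact (measurePreserving_weightedV e β).map_eq
  have h := (MeasurePreserving.id τ).skew_product hgm hmap
  exact h

lemma integral_comp_rot (β : ℝ) (i₀ : Fin n) {a b : ℂ} (ha : ‖a‖ = 1) (hb : ‖b‖ = 1)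
    (F : Cn n → ℂ) :
    ∫ u, F (rot i₀ a b u) ∂(weightedV n β) = ∫ u, F u ∂(weightedV n β) := by
  obtain ⟨e, he⟩ := exists_unitary_eq_rot i₀ ha hb
  simp_rw [← he]
  exact (measurePreserving_weightedV e β).integral_comp e.toHomeomorph.measurableEmbedding F

/-- An integral over the ball may be averaged over a family of unimodular rotations. -/
lemma integral_average (hn : 1 ≤ n) {β : ℝ} (hβ : -1 < β) (i₀ : Fin n) {a b : ℝ → ℂ}
    (ha : Measurable a) (hb : Measurable b) (ha1 : ∀ θ, ‖a θ‖ = 1) (hb1 : ∀ θ, ‖b θ‖ = 1)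
    {F : Cn n → ℂ} (hF : Integrable F (weightedV n β)) :
    Integrable (fun u => (2 * Real.pi)⁻¹ • ∫ θ in (0)..(2 * Real.pi), F (rot i₀ (a θ) (b θ) u))
        (weightedV n β) ∧
      ∫ u, ((2 * Real.pi)⁻¹ • ∫ θ in (0)..(2 * Real.pi), F (rot i₀ (a θ) (b θ) u))
        ∂(weightedV n β) = ∫ u, F u ∂(weightedV n β) := by
  have := isFiniteMeasure_weightedV hn hβ
  have hpi : (0 : ℝ) ≤ 2 * Real.pi := by positivity
  have hint : Integrable (Function.uncurry fun θ u => F (rot i₀ (a θ) (b θ) u))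
      ((volume.restrict (Ioc 0 (2 * Real.pi))).prod (weightedV n β)) := by
    have h := (measurePreserving_rot_prod i₀ β (volume.restrict (Ioc 0 (2 * Real.pi))) ha hb
      ha1 hb1).integrable_comp_of_integrable (hF.comp_snd (volume.restrict (Ioc 0 (2 * Real.pi))))
    exact h
  simp_rw [intervalIntegral.integral_of_le hpi]
  constructor
  · have h := hint.integral_prod_right.smul (2 * Real.pi)⁻¹
    exact h
  rw [integral_smul, ← integral_integral_swap hint]
  simp_rw [integral_comp_rot β i₀ (ha1 _) (hb1 _) F]
  rw [integral_const]
  simp only [measureReal_restrict_apply_univ, Real.volume_real_Ioc_of_le hpi, sub_zero]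
  rw [smul_smul, inv_mul_cancel₀ (by positivity), one_smul]

/-! ### The reproducing formula -/

lemma iteratedDeriv_comp_mul {H : ℂ → ℂ} (hH : DifferentiableOn ℂ H (ball 0 1)) (w : ℂ)
    (j : ℕ) : ∀ μ : ℂ, ‖μ * w‖ < 1 →
      iteratedDeriv j (fun μ => H (μ * w)) μ = w ^ j * iteratedDeriv j H (μ * w) := by
  induction j with
  | zero => intro μ _; simp
  | succ j ih =>
    intro μ hμ
    have hopen : IsOpen {μ : ℂ | ‖μ * w‖ < 1} := isOpen_lt (by fun_prop) continuous_const
    have hev : iteratedDeriv j (fun μ => H (μ * w)) =ᶠ[nhds μ]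
        fun μ => w ^ j * iteratedDeriv j H (μ * w) := by
      filter_upwards [hopen.mem_nhds hμ] with ν hν using ih ν hν
    have hd : DifferentiableAt ℂ (iteratedDeriv j H) (μ * w) := by
      have hA : AnalyticAt ℂ H (μ * w) :=
        hH.analyticAt (isOpen_ball.mem_nhds (by simpa using hμ))
      rw [iteratedDeriv_eq_iterate]
      exact (hA.iterated_deriv j).differentiableAt
    rw [iteratedDeriv_succ, hev.deriv_eq, iteratedDeriv_succ]
    have h1 : HasDerivAt (fun μ : ℂ => iteratedDeriv j H (μ * w))
        (deriv (iteratedDeriv j H) (μ * w) * w) μ := by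
      have h0 : HasDerivAt (fun μ : ℂ => μ * w) w μ := by
        simpa using (hasDerivAt_id μ).mul_const w
      exact HasDerivAt.comp μ hd.hasDerivAt h0
    rw [(h1.const_mul (w ^ j)).deriv]
    ring

/-- Taylor coefficients as Fourier coefficients. -/
lemma circle_coeff {H : ℂ → ℂ} (hH : DifferentiableOn ℂ H (ball 0 1)) {w : ℂ} (hw : ‖w‖ < 1)
    (j : ℕ) : (2 * Real.pi)⁻¹ • ∫ θ in (0)..(2 * Real.pi),
      (starRingEnd ℂ) (Complex.exp (θ * Complex.I)) ^ j * H (Complex.exp (θ * Complex.I) * w) =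
        w ^ j * (iteratedDeriv j H 0 / j.factorial) := by
  have hd : DiffContOnCl ℂ (fun μ : ℂ => H (μ * w)) (ball 0 1) := by
    refine DifferentiableOn.diffContOnCl ?_
    rw [closure_ball _ one_ne_zero]
    refine hH.comp (by fun_prop) fun μ hμ => ?_
    rw [mem_closedBall_zero_iff] at hμ
    rw [mem_ball_zero_iff, norm_mul]
    nlinarith [norm_nonneg w, norm_nonneg μ]
  have h := hd.circleIntegral_one_div_sub_center_pow_smul one_pos j
  rw [iteratedDeriv_comp_mul hH w j 0 (by simp)] at h
  have h1 : (∮ z in C(0, 1), (1 / (z - 0) ^ (j + 1)) • H (z * w)) = Complex.I *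
      ∫ θ in (0)..(2 * Real.pi), (starRingEnd ℂ) (Complex.exp (θ * Complex.I)) ^ j *
        H (Complex.exp (θ * Complex.I) * w) := by
    rw [circleIntegral, ← intervalIntegral.integral_const_mul]
    refine intervalIntegral.integral_congr fun θ _ => ?_
    have e0 : Complex.exp (θ * Complex.I) ≠ 0 := Complex.exp_ne_zero _
    have e1 : (starRingEnd ℂ) (Complex.exp (θ * Complex.I)) =
        (Complex.exp (θ * Complex.I))⁻¹ := by
      rw [← Complex.exp_conj, ← Complex.exp_neg]
      simp
    simp only [deriv_circleMap, circleMap, Complex.ofReal_one, one_mul, zero_add, sub_zero,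
      smul_eq_mul, e1, inv_pow]
    field_simp
    ring
  rw [h1] at h
  have hpi : (Real.pi : ℂ) ≠ 0 := by exact_mod_cast Real.pi_ne_zero
  have hI := Complex.I_ne_zero
  have h2 : (∫ θ in (0)..(2 * Real.pi), (starRingEnd ℂ) (Complex.exp (θ * Complex.I)) ^ j *
        H (Complex.exp (θ * Complex.I) * w)) =
      2 * Real.pi * (w ^ j * (iteratedDeriv j H 0 / j.factorial)) := by
    refine mul_left_cancel₀ hI (h.trans ?_)
    rw [zero_mul, smul_eq_mul]
    ring
  rw [h2, Complex.real_smul]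
  push_cast
  field_simp

lemma norm_coord_lt {i₀ : Fin n} {u : Cn n} (hu : u ∈ unitBall n) : ‖u i₀‖ < 1 := by
  have h1 := mem_unitBall.1 hu
  have h2 := norm_rot_le i₀ (a := 1) (b := 0) (by simp) (by simp) u
  have h3 : ‖u i₀‖ ≤ ‖rot i₀ 1 0 u‖ := by
    have := norm_rot_sq i₀ 1 0 u
    simp only [norm_one, norm_zero] at this
    refine le_of_sq_le_sq ?_ (norm_nonneg _)
    rw [this]; simp
  linarith

/-- Averaging over rotations fixing the coordinate `i₀`: against a function of that coordinate, a
holomorphic function may be replaced by its restriction to the coordinate disc. -/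
lemma integral_restrict_coord (hn : 1 ≤ n) {β : ℝ} (hβ : -1 < β) (i₀ : Fin n) {G : Cn n → ℂ}
    (hG : DifferentiableOn ℂ G (unitBall n)) {k : ℂ → ℂ}
    (hint : Integrable (fun u => k (u i₀) * G u) (weightedV n β)) :
    Integrable (fun u => k (u i₀) * G (rot i₀ 1 0 u)) (weightedV n β) ∧
      ∫ u, k (u i₀) * G (rot i₀ 1 0 u) ∂(weightedV n β) =
        ∫ u, k (u i₀) * G u ∂(weightedV n β) := by
  have hb : Measurable fun θ : ℝ => Complex.exp (θ * Complex.I) := by fun_prop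
  obtain ⟨h1, h2⟩ := integral_average hn hβ i₀ (a := fun _ => 1)
    (b := fun θ => Complex.exp (θ * Complex.I)) measurable_const hb (by simp)
    (fun θ => Complex.norm_exp_ofReal_mul_I θ) hint
  -- By the mean value property in the variable multiplying the other coordinates.
  have heq : (fun u => (2 * Real.pi)⁻¹ • ∫ θ in (0)..(2 * Real.pi),
      k (rot i₀ 1 (Complex.exp (θ * Complex.I)) u i₀) *
        G (rot i₀ 1 (Complex.exp (θ * Complex.I)) u)) =ᵐ[weightedV n β]
      fun u => k (u i₀) * G (rot i₀ 1 0 u) := by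
    filter_upwards [ae_weightedV_mem β] with u hu
    simp_rw [rot_apply_self, one_mul]
    rw [intervalIntegral.integral_const_mul, ← mul_smul_comm]
    congr 1
    have hd : DiffContOnCl ℂ (fun μ : ℂ => G (rot i₀ 1 μ u)) (ball 0 |1|) := by
      refine DifferentiableOn.diffContOnCl ?_
      rw [abs_one, closure_ball _ one_ne_zero]
      have hr : DifferentiableOn ℂ (fun μ : ℂ => rot i₀ 1 μ u) (closedBall 0 1) := by
        have : (fun μ : ℂ => rot i₀ 1 μ u) =
            fun μ : ℂ => (1 : ℂ) • rot i₀ 1 0 u + μ • rot i₀ 0 1 u := by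
          funext μ; exact rot_add_smul _ _ _ _
        rw [this]; fun_prop
      refine hG.comp hr fun μ hμ => ?_
      rw [mem_closedBall_zero_iff] at hμ
      exact mem_unitBall.2 ((norm_rot_le i₀ (by simp) hμ u).trans_lt (mem_unitBall.1 hu))
    have := hd.circleAverage
    rw [Real.circleAverage_def] at this
    simpa [circleMap] using this
  exact ⟨h1.congr heq, by rw [← h2]; exact (integral_congr_ae heq).symm⟩

/-- Averaging over rotations of the coordinate `i₀` isolates a Taylor coefficient. -/
lemma integral_conj_pow_mul (hn : 1 ≤ n) {β : ℝ} (hβ : -1 < β) (i₀ : Fin n) {H : ℂ → ℂ}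
    (hH : DifferentiableOn ℂ H (ball 0 1)) (j : ℕ)
    (hint : Integrable (fun u => (starRingEnd ℂ) (u i₀) ^ j * H (u i₀)) (weightedV n β)) :
    ∫ u, (starRingEnd ℂ) (u i₀) ^ j * H (u i₀) ∂(weightedV n β) =
      iteratedDeriv j H 0 / j.factorial * ((n.factorial * j.factorial * Real.Gamma (β + 1) /
        Real.Gamma (n + j + β + 1) : ℝ) : ℂ) := by
  have hb : Measurable fun θ : ℝ => Complex.exp (θ * Complex.I) := by fun_prop
  obtain ⟨-, h2⟩ := integral_average hn hβ i₀ (b := fun _ => 1)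
    (a := fun θ => Complex.exp (θ * Complex.I)) hb measurable_const
    (fun θ => Complex.norm_exp_ofReal_mul_I θ) (by simp) hint
  rw [← h2]
  have heq : (fun u => (2 * Real.pi)⁻¹ • ∫ θ in (0)..(2 * Real.pi),
      (starRingEnd ℂ) (rot i₀ (Complex.exp (θ * Complex.I)) 1 u i₀) ^ j *
        H (rot i₀ (Complex.exp (θ * Complex.I)) 1 u i₀)) =ᵐ[weightedV n β]
      fun u => iteratedDeriv j H 0 / j.factorial * ((‖u i₀‖ ^ (2 * j) : ℝ) : ℂ) := by
    filter_upwards [ae_weightedV_mem β] with u hu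
    simp_rw [rot_apply_self, map_mul, mul_pow]
    have hc := circle_coeff hH (norm_coord_lt (i₀ := i₀) hu) j
    have : ∀ θ : ℝ, (starRingEnd ℂ) (Complex.exp (θ * Complex.I)) ^ j *
        (starRingEnd ℂ) (u i₀) ^ j * H (Complex.exp (θ * Complex.I) * u i₀) =
        (starRingEnd ℂ) (u i₀) ^ j * ((starRingEnd ℂ) (Complex.exp (θ * Complex.I)) ^ j *
          H (Complex.exp (θ * Complex.I) * u i₀)) := fun θ => by ring
    simp_rw [this]
    rw [intervalIntegral.integral_const_mul, ← mul_smul_comm, hc]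
    have e1 : ((‖u i₀‖ ^ (2 * j) : ℝ) : ℂ) = (starRingEnd ℂ) (u i₀) ^ j * (u i₀) ^ j := by
      rw [← mul_pow, mul_comm ((starRingEnd ℂ) (u i₀)), Complex.mul_conj,
        Complex.normSq_eq_norm_sq, pow_mul]
      push_cast; rfl
    rw [e1]; ring
  rw [integral_congr_ae heq, integral_const_mul, integral_complex_ofReal]
  congr 2
  rw [integral_eq_lintegral_of_nonneg_ae (Filter.Eventually.of_forall fun u => by positivity)
    (by fun_prop), ball_moment i₀ j hβ, ENNReal.toReal_ofReal]
  have h1 : 0 < Real.Gamma (β + 1) := Real.Gamma_pos_of_pos (by linarith)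
  have h3 : 0 < Real.Gamma (n + j + β + 1) := by
    refine Real.Gamma_pos_of_pos ?_
    have : (0 : ℝ) ≤ n := Nat.cast_nonneg n
    have : (0 : ℝ) ≤ j := Nat.cast_nonneg j
    linarith
  positivity

/-! ### The reproducing formula -/

lemma toReal_weight_smul {β : ℝ} {u : Cn n} (hu : u ∈ unitBall n) (c : ℂ) :
    (ENNReal.ofReal ((1 - ‖u‖ ^ 2) ^ β)).toReal • c = (((1 - ‖u‖ ^ 2) ^ β : ℝ) : ℂ) * c := by
  have h := one_sub_norm_sq_pos (mem_unitBall.1 hu)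
  rw [ENNReal.toReal_ofReal (by positivity), Complex.real_smul]

lemma bergmanIntegrand_ae_eq (β : ℝ) (f : Cn n → ℂ) (z : Cn n) :
    (fun u => (ENNReal.ofReal ((1 - ‖u‖ ^ 2) ^ β)).toReal •
      (1 / (1 - herm z u) ^ ((1 + n + β : ℝ) : ℂ) * f u)) =ᵐ[V n] bergmanIntegrand n β f z := by
  filter_upwards [ae_V_mem] with u hu
  rw [toReal_weight_smul hu, bergmanIntegrand]
  ring

/-- The Bergman projection as an integral against the weighted measure. -/
lemma bergmanProj_eq (β : ℝ) (f : Cn n → ℂ) (z : Cn n) : bergmanProj n β f z =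
    (cConst n β : ℂ) * ∫ u, 1 / (1 - herm z u) ^ ((1 + n + β : ℝ) : ℂ) * f u
      ∂(weightedV n β) := by
  rw [bergmanProj, weightedV, integral_withDensity_eq_integral_toReal_smul (measurable_weight β)
    (Filter.Eventually.of_forall fun _ => ENNReal.ofReal_lt_top),
    integral_congr_ae (bergmanIntegrand_ae_eq β f z)]

lemma integrable_bergmanIntegrand_iff (β : ℝ) (f : Cn n → ℂ) (z : Cn n) :
    Integrable (bergmanIntegrand n β f z) (V n) ↔
      Integrable (fun u => 1 / (1 - herm z u) ^ ((1 + n + β : ℝ) : ℂ) * f u) (weightedV n β) := by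
  rw [weightedV, integrable_withDensity_iff_integrable_smul' (measurable_weight β)
    (Filter.Eventually.of_forall fun _ => ENNReal.ofReal_lt_top)]
  exact (integrable_congr (bergmanIntegrand_ae_eq β f z)).symm

lemma norm_kernel (p : ℝ) (z u : Cn n) :
    ‖1 / (1 - herm z u) ^ (p : ℂ)‖ = (gauge z u ^ p)⁻¹ := by
  rw [norm_div, norm_one, Complex.norm_cpow_real, one_div]
  rfl

lemma measurable_kernel (p : ℝ) (z : Cn n) :
    Measurable fun u : Cn n => 1 / (1 - herm z u) ^ (p : ℂ) := by
  have h1 : Measurable fun u : Cn n => herm z u := by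
    unfold herm; fun_prop
  fun_prop

/-- For fixed `z` in the ball the kernel is bounded. -/
lemma integrable_kernel_mul {p t : ℝ} (hp : 0 ≤ p) {z : Cn n} (hz : z ∈ unitBall n)
    {f : Cn n → ℂ} (hf : Integrable f (weightedV n t)) :
    Integrable (fun u => 1 / (1 - herm z u) ^ (p : ℂ) * f u) (weightedV n t) := by
  have hz1 : 0 < 1 - ‖z‖ := by linarith [mem_unitBall.1 hz]
  refine hf.bdd_mul (measurable_kernel p z).aestronglyMeasurable (c := ((1 - ‖z‖) ^ p)⁻¹) ?_
  filter_upwards [ae_weightedV_mem t] with u hu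
  rw [norm_kernel]
  gcongr
  exact one_sub_norm_le_gauge (mem_unitBall.1 hu).le

/-- The binomial coefficients of `(1 - x)^{-s}` in terms of the Gamma function. -/
lemma choose_eq_Gamma {s : ℝ} (hs : 0 < s) (j : ℕ) :
    Ring.choose ((s : ℂ) + j - 1) j = ((Real.Gamma (s + j) / (Real.Gamma s * j.factorial) : ℝ) : ℂ) := by
  have h1 := Ring.factorial_nsmul_multichoose_eq_ascPochhammer (s : ℂ) j
  have h2 := Complex.Gamma_add_nat_div_Gamma_eq (n := j) (s : ℂ) (fun k hk => by
    have h3 : s = -k := by exact_mod_cast hk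
    have : (0 : ℝ) ≤ k := Nat.cast_nonneg k
    linarith)
  rw [Polynomial.ascPochhammer_smeval_eq_eval, ← h2, Ring.multichoose_eq, nsmul_eq_mul] at h1
  have h4 : (j.factorial : ℂ) ≠ 0 := by exact_mod_cast j.factorial_ne_zero
  have h5 : (Real.Gamma s : ℂ) ≠ 0 := by exact_mod_cast (Real.Gamma_pos_of_pos hs).ne'
  rw [Complex.Gamma_ofReal, show (s : ℂ) + j = ((s + j : ℝ) : ℂ) by push_cast; rfl,
    Complex.Gamma_ofReal] at h1
  rw [show (s : ℂ) + j - 1 = ((s + j : ℝ) : ℂ) - 1 by push_cast; rfl]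
  push_cast at h1 ⊢
  rw [eq_div_iff (mul_ne_zero h5 h4)]
  rw [eq_div_iff h5] at h1
  linear_combination h1

lemma hasSum_one_div_one_sub_cpow (s : ℂ) {x : ℂ} (hx : ‖x‖ < 1) :
    HasSum (fun j : ℕ => Ring.choose (s + j - 1) j * x ^ j) (1 / (1 - x) ^ s) := by
  have h := (Complex.one_div_one_sub_cpow_hasFPowerSeriesOnBall_zero s).hasSum
    (y := x) (by
      rw [Metric.mem_eball, edist_zero_right, ← ofReal_norm]
      exact ENNReal.ofReal_lt_one.2 hx)
  simpa [FormalMultilinearSeries.ofScalars_apply_eq, smul_eq_mul, mul_comm] using h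

lemma summable_choose_mul_pow (s : ℂ) {r : ℝ} (hr0 : 0 ≤ r) (hr : r < 1) :
    Summable fun j : ℕ => ‖Ring.choose (s + j - 1) j‖ * r ^ j := by
  lift r to ℝ≥0 using hr0
  have h := (Complex.one_div_one_sub_cpow_hasFPowerSeriesOnBall_zero s).r_le
  have h2 : (r : ℝ≥0∞) < 1 := by exact_mod_cast hr
  simpa only [FormalMultilinearSeries.ofScalars_norm] using
    FormalMultilinearSeries.summable_norm_mul_pow _ (h2.trans_le h)

/-- The reproducing formula for functions of one coordinate: the Taylor coefficients of the
function pair with those of the kernel through the moments of the coordinate. -/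
lemma reproducing_coord (hn : 1 ≤ n) {β : ℝ} (hβ : -1 < β) (i₀ : Fin n) {H : ℂ → ℂ}
    (hH : DifferentiableOn ℂ H (ball 0 1))
    (hint : Integrable (fun u : Cn n => H (u i₀)) (weightedV n β)) {ρ : ℂ} (hρ : ‖ρ‖ < 1) :
    (cConst n β : ℂ) * ∫ u, 1 / (1 - ρ * (starRingEnd ℂ) (u i₀)) ^ ((1 + n + β : ℝ) : ℂ) *
      H (u i₀) ∂(weightedV n β) = H ρ := by
  have hn0 : (0 : ℝ) ≤ n := Nat.cast_nonneg n
  have hs : 0 < 1 + n + β := by linarith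
  set s : ℝ := 1 + n + β with hsdef
  set c : ℕ → ℂ := fun j => Ring.choose ((s : ℂ) + j - 1) j with hc
  have hcoord : ∀ᵐ u ∂(weightedV n β), ‖u i₀‖ ≤ 1 := by
    filter_upwards [ae_weightedV_mem β] with u hu using (norm_coord_lt hu).le
  have hpint : ∀ j : ℕ, Integrable (fun u : Cn n => (starRingEnd ℂ) (u i₀) ^ j * H (u i₀))
      (weightedV n β) := by
    intro j
    refine hint.mono ?_ ?_
    · exact ((by fun_prop : Measurable fun u : Cn n =>
        (starRingEnd ℂ) (u i₀) ^ j).aestronglyMeasurable).mul hint.aestronglyMeasurable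
    · filter_upwards [hcoord] with u hu
      rw [norm_mul, norm_pow, RCLike.norm_conj]
      exact mul_le_of_le_one_left (norm_nonneg _) (pow_le_one₀ (norm_nonneg _) hu)
  set F : ℕ → Cn n → ℂ := fun j u =>
    c j * ρ ^ j * ((starRingEnd ℂ) (u i₀) ^ j * H (u i₀)) with hF
  have hFint : ∀ j, Integrable (F j) (weightedV n β) := fun j => (hpint j).const_mul _
  have hsum : Summable fun j => ∫ u, ‖F j u‖ ∂(weightedV n β) := by
    refine Summable.of_nonneg_of_le (fun j => integral_nonneg fun u => norm_nonneg _) (fun j => ?_)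
      ((summable_choose_mul_pow (s : ℂ) (norm_nonneg ρ) hρ).mul_right
        (∫ u, ‖H (u i₀)‖ ∂(weightedV n β)))
    rw [← integral_const_mul]
    refine integral_mono_ae (hFint j).norm (hint.norm.const_mul _) ?_
    filter_upwards [hcoord] with u hu
    simp only [hF, norm_mul, norm_pow, RCLike.norm_conj]
    gcongr
    exact mul_le_of_le_one_left (norm_nonneg _) (pow_le_one₀ (norm_nonneg _) hu)
  have h1 := hasSum_integral_of_summable_integral_norm hFint hsum
  have h2 : ∫ u, ∑' j, F j u ∂(weightedV n β) =
      ∫ u, 1 / (1 - ρ * (starRingEnd ℂ) (u i₀)) ^ ((s : ℝ) : ℂ) * H (u i₀) ∂(weightedV n β) := by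
    refine integral_congr_ae ?_
    filter_upwards [hcoord] with u hu
    have hx : ‖ρ * (starRingEnd ℂ) (u i₀)‖ < 1 := by
      rw [norm_mul, RCLike.norm_conj]
      nlinarith [norm_nonneg (u i₀), norm_nonneg ρ]
    have h3 := (hasSum_one_div_one_sub_cpow (s : ℂ) hx).mul_right (H (u i₀))
    rw [← h3.tsum_eq]
    refine tsum_congr fun j => ?_
    simp only [hF, hc, mul_pow]
    ring
  rw [h2] at h1
  have h4 := h1.mul_left (cConst n β : ℂ)
  have h5 := Complex.hasSum_taylorSeries_on_ball hH (mem_ball_zero_iff.2 hρ)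
  rw [sub_zero] at h5
  refine (h4.congr_fun fun j => ?_).unique h5
  simp only [hF, hc, smul_eq_mul]
  have hG1 : (Real.Gamma (β + 1) : ℂ) ≠ 0 := by
    exact_mod_cast (Real.Gamma_pos_of_pos (by linarith)).ne'
  have hG2 : (Real.Gamma s : ℂ) ≠ 0 := by exact_mod_cast (Real.Gamma_pos_of_pos hs).ne'
  have hG3 : (Real.Gamma (s + j) : ℂ) ≠ 0 := by
    exact_mod_cast (Real.Gamma_pos_of_pos (by positivity)).ne'
  have hj : (j.factorial : ℂ) ≠ 0 := by exact_mod_cast j.factorial_ne_zero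
  have hnf : (n.factorial : ℂ) ≠ 0 := by exact_mod_cast n.factorial_ne_zero
  rw [integral_const_mul, integral_conj_pow_mul hn hβ i₀ hH j (hpint j), choose_eq_Gamma hs, cConst,
    show (n : ℝ) + j + β + 1 = s + j by rw [hsdef]; ring,
    show (n : ℝ) + β + 1 = s by rw [hsdef]; ring]
  push_cast
  field_simp

lemma rot_one_zero (i₀ : Fin n) (u : Cn n) :
    rot i₀ 1 0 u = u i₀ • EuclideanSpace.single i₀ (1 : ℂ) := by
  ext i
  by_cases h : i = i₀
  · subst h; simp [rot]
  · simp [rot, h]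

/-- The Bergman projection reproduces integrable holomorphic functions. A unitary change of
variables puts `z` on a coordinate axis, where averaging over rotations of the other coordinates
reduces the formula to `reproducing_coord`. -/
theorem bergmanProj_eq_self (hn : 1 ≤ n) {β : ℝ} (hβ : -1 < β) {g : Cn n → ℂ}
    (hg : DifferentiableOn ℂ g (unitBall n)) (hint : Integrable g (weightedV n β)) {z : Cn n}
    (hz : z ∈ unitBall n) : bergmanProj n β g z = g z := by
  have i₀ : Fin n := ⟨0, hn⟩
  have hn0 : (0 : ℝ) ≤ n := Nat.cast_nonneg n
  obtain ⟨η, ρ, hη, hzη, hρ⟩ : ∃ (η : Cn n) (ρ : ℝ), ‖η‖ = 1 ∧ z = (ρ : ℂ) • η ∧ ‖(ρ : ℂ)‖ < 1 := by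
    by_cases h0 : z = 0
    · obtain ⟨η, hη⟩ := exists_norm_eq_one hn
      exact ⟨η, 0, hη, by simp [h0], by simp⟩
    · obtain ⟨η, hη, h1, -⟩ := exists_normalize h0
      exact ⟨η, ‖z‖, hη, h1, by simpa using mem_unitBall.1 hz⟩
  obtain ⟨e, he⟩ := exists_unitary_coord i₀ hη
  set G : Cn n → ℂ := fun u => g (e.symm u) with hGdef
  have hball : ∀ u, u ∈ unitBall n → e.symm u ∈ unitBall n := fun u hu => by
    rw [mem_unitBall, LinearIsometryEquiv.norm_map]; exact mem_unitBall.1 hu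
  have hG : DifferentiableOn ℂ G (unitBall n) :=
    hg.comp e.symm.toContinuousLinearEquiv.differentiable.differentiableOn hball
  have hGint : Integrable G (weightedV n β) :=
    (measurePreserving_weightedV e.symm β).integrable_comp_of_integrable hint
  -- the point `e z` lies on the axis of the coordinate `i₀`
  have heη : e.symm (EuclideanSpace.single i₀ (1 : ℂ)) = η := by
    have h1 := he (e.symm (EuclideanSpace.single i₀ (1 : ℂ)))
    rw [e.apply_symm_apply, PiLp.single_apply, if_pos rfl] at h1
    have h2 := (inner_eq_one_iff_of_norm_eq_one (𝕜 := ℂ) hη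
      (show ‖e.symm (EuclideanSpace.single i₀ (1 : ℂ))‖ = 1 by simp)).1 h1.symm
    exact h2.symm
  set H : ℂ → ℂ := fun w => G (w • EuclideanSpace.single i₀ (1 : ℂ)) with hHdef
  have hH : DifferentiableOn ℂ H (ball 0 1) := by
    refine hG.comp (by fun_prop) fun w hw => mem_unitBall.2 ?_
    rw [norm_smul]
    simpa using hw
  have hHz : H ρ = g z := by
    simp only [hHdef, hGdef, map_smul, heη, ← hzη]
  have hHrot : ∀ u : Cn n, G (rot i₀ 1 0 u) = H (u i₀) := fun u => by rw [rot_one_zero]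
  have hHint : Integrable (fun u : Cn n => H (u i₀)) (weightedV n β) := by
    have h1 := (integral_restrict_coord hn hβ i₀ hG (k := fun _ => 1) (by simpa using hGint)).1
    simpa [hHrot] using h1
  set k : ℂ → ℂ := fun w => 1 / (1 - ρ * (starRingEnd ℂ) w) ^ ((1 + n + β : ℝ) : ℂ) with hk
  have hkz : ∀ u, 1 / (1 - herm z u) ^ ((1 + n + β : ℝ) : ℂ) = k ((e u) i₀) := by
    intro u
    simp only [hk]
    rw [he, hzη, herm_smul_left, ← herm_conj]
  have hkG : Integrable (fun u : Cn n => k (u i₀) * G u) (weightedV n β) := by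
    have h1 := (measurePreserving_weightedV e.symm β).integrable_comp_of_integrable
      (integrable_kernel_mul (by linarith : (0 : ℝ) ≤ 1 + n + β) hz hint)
    refine h1.congr (Filter.Eventually.of_forall fun u => ?_)
    simp only [Function.comp_apply, hkz, e.apply_symm_apply, hGdef]
  rw [bergmanProj_eq]
  have h1 : ∫ u, 1 / (1 - herm z u) ^ ((1 + n + β : ℝ) : ℂ) * g u ∂(weightedV n β) =
      ∫ u, k (u i₀) * G u ∂(weightedV n β) := by
    rw [← (measurePreserving_weightedV e β).integral_comp e.toHomeomorph.measurableEmbedding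
      fun u => k (u i₀) * G u]
    refine integral_congr_ae (Filter.Eventually.of_forall fun u => ?_)
    simp only [hkz, hGdef, e.symm_apply_apply]
  rw [h1, ← (integral_restrict_coord hn hβ i₀ hG hkG).2]
  simp_rw [hHrot]
  rw [← hHz]
  exact reproducing_coord hn hβ i₀ hH hHint hρ

/-! ### Holomorphy of the Bergman projection -/

lemma one_sub_herm_mem_slitPlane {z u : Cn n} (hz : ‖z‖ < 1) (hu : ‖u‖ ≤ 1) :
    1 - herm z u ∈ Complex.slitPlane := by
  refine Complex.mem_slitPlane_iff.2 (Or.inl ?_)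
  have h1 := (norm_herm_le z u).trans (mul_le_of_le_one_right (norm_nonneg z) hu)
  have h2 := Complex.re_le_norm (herm z u)
  simp only [Complex.sub_re, Complex.one_re]
  linarith

/-- The derivative of the Bergman kernel in its holomorphic variable. -/
lemma hasFDerivAt_kernel (p : ℝ) {z u : Cn n} (hz : ‖z‖ < 1) (hu : ‖u‖ ≤ 1) (c : ℂ) :
    HasFDerivAt (fun z => 1 / (1 - herm z u) ^ (p : ℂ) * c)
      ((c * (p * (1 - herm z u) ^ (-(p : ℂ) - 1))) • innerSL ℂ u) z := by
  have h1 : HasFDerivAt (fun z : Cn n => 1 - herm z u) (-innerSL ℂ u) z :=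
    ((innerSL ℂ u).hasFDerivAt).const_sub 1
  have h2 := (hasDerivAt_id (1 - herm z u)).cpow_const (c := -(p : ℂ))
    (one_sub_herm_mem_slitPlane hz hu)
  have h3 := (h2.comp_hasFDerivAt z h1).mul_const c
  refine (h3.congr_fderiv ?_).congr_of_eventuallyEq (Filter.Eventually.of_forall fun w => ?_)
  · simp only [id, mul_one, smul_neg, ← neg_smul, smul_smul]
    congr 1
    ring
  · simp only [Function.comp_apply, id, Complex.cpow_neg, one_div]

lemma differentiableOn_bergmanProj {β : ℝ} (hβ : -1 < β) {f : Cn n → ℂ}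
    (hf : Integrable f (weightedV n β)) :
    DifferentiableOn ℂ (bergmanProj n β f) (unitBall n) := by
  have hn0 : (0 : ℝ) ≤ n := Nat.cast_nonneg n
  have hp : 0 ≤ 1 + n + β := by linarith
  set p : ℝ := 1 + n + β with hpdef
  intro z₀ hz₀
  have hz1 := mem_unitBall.1 hz₀
  set ε : ℝ := (1 - ‖z₀‖) / 2 with hε
  have hε0 : 0 < ε := by rw [hε]; linarith
  have hball : ∀ z ∈ ball z₀ ε, ‖z‖ < 1 ∧ ε ≤ 1 - ‖z‖ := by
    intro z hz
    rw [mem_ball, dist_eq_norm] at hz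
    have h1 : ‖z‖ ≤ ‖z - z₀‖ + ‖z₀‖ := by simpa using norm_add_le (z - z₀) z₀
    constructor <;> linarith
  have hmeas : ∀ s : ℂ, Measurable fun u : Cn n => (1 - herm z₀ u) ^ s := fun s => by
    have h1 : Measurable fun u : Cn n => herm z₀ u := by unfold herm; fun_prop
    fun_prop
  have h := hasFDerivAt_integral_of_dominated_of_fderiv_le (𝕜 := ℂ) (μ := weightedV n β)
    (F := fun z u => 1 / (1 - herm z u) ^ (p : ℂ) * f u) (x₀ := z₀) (s := ball z₀ ε)
    (F' := fun z u => (f u * (p * (1 - herm z u) ^ (-(p : ℂ) - 1))) • innerSL ℂ u)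
    (bound := fun u => ‖f u‖ * (p * ε ^ (-p - 1))) (ball_mem_nhds z₀ hε0)
    (Filter.Eventually.of_forall fun z =>
      (measurable_kernel p z).aestronglyMeasurable.mul hf.aestronglyMeasurable)
    (integrable_kernel_mul hp hz₀ hf) ?_ ?_ (hf.norm.mul_const _) ?_
  · have h2 := (h.const_mul (cConst n β : ℂ)).differentiableAt
    have h3 : bergmanProj n β f = fun z => (cConst n β : ℂ) *
        ∫ u, 1 / (1 - herm z u) ^ (p : ℂ) * f u ∂(weightedV n β) := by
      funext z; exact bergmanProj_eq β f z
    rw [h3]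
    exact h2.differentiableWithinAt
  · refine (hf.aestronglyMeasurable.mul ?_).smul ?_
    · exact ((hmeas _).const_mul _).aestronglyMeasurable
    · exact (innerSL ℂ).continuous.aestronglyMeasurable
  · filter_upwards [ae_weightedV_mem β] with u hu z hz
    obtain ⟨h1, h2⟩ := hball z hz
    have hu1 := (mem_unitBall.1 hu).le
    have h3 := one_sub_norm_le_gauge (z := z) hu1
    have h4 : ‖(1 - herm z u) ^ (-(p : ℂ) - 1)‖ = gauge z u ^ (-p - 1) := by
      have : -(p : ℂ) - 1 = ((-p - 1 : ℝ) : ℂ) := by push_cast; rfl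
      rw [this, Complex.norm_cpow_real]; rfl
    rw [norm_smul, norm_mul, norm_mul, h4, innerSL_apply_norm, Complex.norm_real,
      Real.norm_of_nonneg hp]
    have h5 : gauge z u ^ (-p - 1) ≤ ε ^ (-p - 1) :=
      Real.rpow_le_rpow_of_nonpos hε0 (h2.trans h3) (by linarith)
    calc _ ≤ ‖f u‖ * (p * ε ^ (-p - 1)) * 1 := by gcongr
      _ = _ := mul_one _
  · filter_upwards [ae_weightedV_mem β] with u hu z hz
    exact hasFDerivAt_kernel p (hball z hz).1 (mem_unitBall.1 hu).le _

lemma aemeasurable_of_differentiableOn {g : Cn n → ℂ} (hg : DifferentiableOn ℂ g (unitBall n)) :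
    AEMeasurable g (V n) :=
  (hg.continuousOn.aemeasurable measurableSet_unitBall).smul_measure _

/-! ### The tent norms and Carleson measures -/

lemma setLIntegral_wDensity (q β : ℝ) (f : Cn n → ℂ) {A : Set (Cn n)} (hA : MeasurableSet A) :
    ∫⁻ z in A, wDensity q β f z ∂(V n) = ∫⁻ z in A, ‖f z‖ₑ ^ q ∂(weightedV n β) := by
  rw [← lintegral_indicator hA, ← lintegral_indicator hA, lintegral_weightedV]
  refine lintegral_congr fun z => ?_
  by_cases hz : z ∈ A
  · simp only [indicator_of_mem hz, wDensity, mul_comm]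
  · simp only [indicator_of_notMem hz, mul_zero]

lemma tentNorm_one_eq (γ q α : ℝ) (f : Cn n → ℂ) :
    tentNorm n γ 1 q α f = tentOne γ α q fun z => ‖f z‖ₑ := by
  simp only [tentNorm, tentOne, areaPow, div_one, ENNReal.rpow_one,
    setLIntegral_wDensity q α f (measurableSet_korRegion γ _)]

lemma wMeasure_cap (q β : ℝ) (f : Cn n → ℂ) (ζ : Cn n) (δ : ℝ) :
    wMeasure n q β f (cap ζ δ) = ∫⁻ z in cap ζ δ, ‖f z‖ₑ ^ q ∂(weightedV n β) := by
  rw [wMeasure, withDensity_apply _ (measurableSet_cap ζ δ),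
    setLIntegral_wDensity q β f (measurableSet_cap ζ δ)]

lemma isCarleson_wMeasure_iff (q β : ℝ) (f : Cn n → ℂ) : IsCarleson (wMeasure n q β f) ↔
    ∃ K : ℝ≥0, CarlesonBound β q (fun z => ‖f z‖ₑ) K := by
  refine exists_congr fun K => ⟨fun h ζ hζ δ hδ => ?_, fun h ζ hζ δ hδ => ?_⟩
  · rw [← wMeasure_cap]
    exact h ζ (mem_sphere_zero_iff_norm.2 hζ) δ hδ
  · have h1 := h ζ (mem_sphere_zero_iff_norm.1 hζ) δ hδ
    rw [← wMeasure_cap] at h1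
    exact h1

lemma cap_eq_unitBall {ζ : Cn n} (hζ : ‖ζ‖ = 1) {δ : ℝ} (hδ : 2 < δ) : cap ζ δ = unitBall n := by
  refine Subset.antisymm (fun z hz => hz.1) fun z hz => ⟨hz, ?_⟩
  exact (gauge_le_two (mem_unitBall.1 hz).le hζ.le).trans_lt hδ

/-- The gauge is at most `2`, so a gauge ball of radius `3` is the whole ball. -/
lemma CarlesonBound.lintegral_le (hn : 1 ≤ n) {β q : ℝ} {φ : Cn n → ℝ≥0∞} {K : ℝ≥0∞}
    (h : CarlesonBound β q φ K) : ∫⁻ z, φ z ^ q ∂(weightedV n β) ≤ 3 ^ n * K := by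
  obtain ⟨ζ, hζ⟩ := exists_norm_eq_one hn
  have h1 := h ζ hζ 3 (by norm_num)
  rw [cap_eq_unitBall hζ (by norm_num),
    Measure.restrict_eq_self_of_ae_mem (ae_weightedV_mem β)] at h1
  refine h1.trans_eq ?_
  rw [mul_comm, ENNReal.ofReal_pow (by norm_num)]
  norm_num

lemma tent_of_ne_zero {u : Cn n} (hu : u ≠ 0) :
    tent u = cap (((‖u‖⁻¹ : ℝ) : ℂ) • u) (1 - ‖u‖ ^ 2) := by
  rw [tent, if_neg hu]; rfl

lemma norm_normalize {u : Cn n} (hu : u ≠ 0) : ‖((‖u‖⁻¹ : ℝ) : ℂ) • u‖ = 1 := by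
  rw [norm_smul, Complex.norm_real, norm_inv, norm_norm, inv_mul_cancel₀ (norm_ne_zero_iff.2 hu)]

lemma measurableSet_tent (u : Cn n) : MeasurableSet (tent u) := by
  by_cases hu : u = 0
  · rw [tent, if_pos hu]; exact measurableSet_unitBall
  · rw [tent_of_ne_zero hu]; exact measurableSet_cap _ _

/-- The Carleson constant dominates the norm of `T^∞`. -/
lemma tentNormTop_le (hn : 1 ≤ n) {γ q α : ℝ} (hq : 0 < q) {f : Cn n → ℂ} {K : ℝ≥0∞}
    (h : CarlesonBound (n + α) q (fun z => ‖f z‖ₑ) K) :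
    tentNormTop n γ q α f ≤ (3 ^ n * K) ^ (1 / q) := by
  refine essSup_le_of_ae_le _ (Filter.Eventually.of_forall fun ζ => ?_)
  refine ENNReal.rpow_le_rpow (iSup₂_le fun u hu => ?_) (by positivity)
  rw [setLIntegral_wDensity q (n + α) f (measurableSet_tent u)]
  have h3 : (1 : ℝ≥0∞) ≤ 3 ^ n := one_le_pow₀ (by norm_num)
  by_cases hu0 : u = 0
  · rw [hu0, norm_zero]
    simp only [ne_eq, OfNat.ofNat_ne_zero, not_false_eq_true, zero_pow, sub_zero, one_pow,
      ENNReal.ofReal_one, inv_one, one_mul]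
    exact (setLIntegral_le_lintegral _ _).trans (h.lintegral_le hn)
  · have hx := one_sub_norm_sq_pos (mem_unitBall.1 hu.1)
    rw [tent_of_ne_zero hu0]
    have h1 := h _ (norm_normalize hu0) _ hx
    have hx2 : ENNReal.ofReal ((1 - ‖u‖ ^ 2) ^ n) ≠ 0 := by
      rw [ne_eq, ENNReal.ofReal_eq_zero, not_le]; positivity
    calc _ ≤ (ENNReal.ofReal ((1 - ‖u‖ ^ 2) ^ n))⁻¹ *
          (K * ENNReal.ofReal ((1 - ‖u‖ ^ 2) ^ n)) := by gcongr
      _ = K := by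
        rw [mul_comm K, ← mul_assoc, ENNReal.inv_mul_cancel hx2 ENNReal.ofReal_ne_top, one_mul]
      _ ≤ 3 ^ n * K := le_mul_of_one_le_left (zero_le) h3

/-- Since shadows have positive measure, the essential supremum controls every tent. -/
lemma lintegral_tent_le (hn : 1 ≤ n) {γ q α : ℝ} (hγ : 2 ≤ γ) (hq : 0 < q) (f : Cn n → ℂ)
    {u : Cn n} (hu : u ∈ unitBall n) (hu0 : u ≠ 0) :
    ∫⁻ z in tent u, ‖f z‖ₑ ^ q ∂(weightedV n (n + α)) ≤
      tentNormTop n γ q α f ^ q * ENNReal.ofReal ((1 - ‖u‖ ^ 2) ^ n) := by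
  obtain ⟨c, hc0, hc⟩ := le_sigma_shadow hn hγ
  have hpos : σ n (shadow γ u) ≠ 0 := by
    refine (lt_of_lt_of_le ?_ (hc u hu hu0)).ne'
    exact ENNReal.mul_pos (by simpa using hc0) (weight_ne_zero _ hu)
  have hae := ENNReal.ae_le_essSup (μ := σ n) (fun ζ : sphere (0 : Cn n) 1 =>
    (⨆ u ∈ korRegion γ (ζ : Cn n), (ENNReal.ofReal ((1 - ‖u‖ ^ 2) ^ n))⁻¹ *
        ∫⁻ z in tent u, wDensity q (n + α) f z ∂(V n)) ^ (1 / q))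
  obtain ⟨ζ, hζ, hle⟩ : ∃ ζ ∈ shadow γ u, (⨆ u ∈ korRegion γ (ζ : Cn n),
      (ENNReal.ofReal ((1 - ‖u‖ ^ 2) ^ n))⁻¹ *
        ∫⁻ z in tent u, wDensity q (n + α) f z ∂(V n)) ^ (1 / q) ≤ tentNormTop n γ q α f := by
    have h1 := (frequently_ae_iff.2 hpos : ∃ᵐ ζ ∂(σ n), ζ ∈ shadow γ u)
    exact (h1.and_eventually hae).exists
  have hx := one_sub_norm_sq_pos (mem_unitBall.1 hu)
  have hx2 : ENNReal.ofReal ((1 - ‖u‖ ^ 2) ^ n) ≠ 0 := by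
    rw [ne_eq, ENNReal.ofReal_eq_zero, not_le]; positivity
  have h2 := ENNReal.rpow_le_rpow hle hq.le
  rw [← ENNReal.rpow_mul, one_div, inv_mul_cancel₀ hq.ne', ENNReal.rpow_one] at h2
  have h3 := (le_iSup₂_of_le u hζ le_rfl).trans h2
  rw [setLIntegral_wDensity q (n + α) f (measurableSet_tent u), mul_comm,
    ← ENNReal.div_eq_inv_mul.trans (mul_comm _ _), ENNReal.div_le_iff hx2 ENNReal.ofReal_ne_top] at h3
  exact h3

/-- For `u = √(1 - δ) ζ` the tent over `u` is the gauge ball of radius `δ` at `ζ`. -/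
lemma lintegral_cap_le (hn : 1 ≤ n) {γ q α : ℝ} (hγ : 2 ≤ γ) (hq : 0 < q) (f : Cn n → ℂ)
    {ζ : Cn n} (hζ : ‖ζ‖ = 1) {δ : ℝ} (hδ0 : 0 < δ) (hδ : δ < 1) :
    ∫⁻ z in cap ζ δ, ‖f z‖ₑ ^ q ∂(weightedV n (n + α)) ≤
      tentNormTop n γ q α f ^ q * ENNReal.ofReal (δ ^ n) := by
  set r : ℝ := Real.sqrt (1 - δ) with hr
  have hr0 : 0 < r := Real.sqrt_pos.2 (by linarith)
  have hr2 : r ^ 2 = 1 - δ := Real.sq_sqrt (by linarith)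
  have hnorm : ‖(r : ℂ) • ζ‖ = r := by
    rw [norm_smul, hζ, Complex.norm_real, Real.norm_of_nonneg hr0.le, mul_one]
  have h0 : (r : ℂ) • ζ ≠ 0 := norm_ne_zero_iff.1 (by rw [hnorm]; exact hr0.ne')
  have hmem : (r : ℂ) • ζ ∈ unitBall n := mem_unitBall.2 (by rw [hnorm]; nlinarith)
  have h := lintegral_tent_le (α := α) hn hγ hq f hmem h0
  have h1 : ((r⁻¹ : ℝ) : ℂ) • (r : ℂ) • ζ = ζ := by
    rw [smul_smul, ← Complex.ofReal_mul, inv_mul_cancel₀ hr0.ne', Complex.ofReal_one, one_smul]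
  rw [tent_of_ne_zero h0, hnorm, h1, hr2, sub_sub_cancel] at h
  exact h

lemma lintegral_cap_one_le (hn : 1 ≤ n) {γ q α : ℝ} (hγ : 2 ≤ γ) (hq : 0 < q) (f : Cn n → ℂ)
    {ζ : Cn n} (hζ : ‖ζ‖ = 1) :
    ∫⁻ z in cap ζ 1, ‖f z‖ₑ ^ q ∂(weightedV n (n + α)) ≤ tentNormTop n γ q α f ^ q := by
  have hδ : ∀ k : ℕ, 0 < 1 - 1 / ((k : ℝ) + 2) ∧ 1 - 1 / ((k : ℝ) + 2) < 1 := fun k => by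
    have hk : (0 : ℝ) ≤ k := Nat.cast_nonneg k
    have h1 : 1 / ((k : ℝ) + 2) < 1 := by rw [div_lt_one (by positivity)]; linarith
    have h2 : 0 < 1 / ((k : ℝ) + 2) := by positivity
    constructor <;> linarith
  have hmono : Monotone fun k : ℕ => cap ζ (1 - 1 / ((k : ℝ) + 2)) := by
    intro j k hjk z hz
    refine ⟨hz.1, hz.2.trans_le ?_⟩
    have : (j : ℝ) ≤ k := by exact_mod_cast hjk
    gcongr
  have hU : cap ζ 1 = ⋃ k : ℕ, cap ζ (1 - 1 / ((k : ℝ) + 2)) := by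
    ext z
    simp only [mem_iUnion]
    constructor
    · rintro ⟨h1, h2⟩
      obtain ⟨k, hk⟩ := exists_nat_one_div_lt (sub_pos.2 h2)
      refine ⟨k, h1, ?_⟩
      have : 1 / ((k : ℝ) + 2) ≤ 1 / ((k : ℝ) + 1) := by gcongr; norm_num
      linarith
    · rintro ⟨k, h1, h2⟩
      exact ⟨h1, h2.trans (hδ k).2⟩
  rw [← wMeasure_cap, hU, hmono.measure_iUnion]
  refine iSup_le fun k => ?_
  rw [wMeasure_cap]
  refine (lintegral_cap_le hn hγ hq f hζ (hδ k).1 (hδ k).2).trans ?_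
  refine mul_le_of_le_one_right zero_le ?_
  exact ENNReal.ofReal_le_one.2 (pow_le_one₀ (hδ k).1.le (hδ k).2.le)

/-- Some quarter turn brings `c` close enough to the positive axis to lie in the unit disc
centred at `1`. -/
lemma exists_norm_one_sub_mul_lt {c : ℂ} (h0 : c ≠ 0) (h1 : ‖c‖ < 1) :
    ∃ k : Fin 4, ‖1 - (starRingEnd ℂ) (Complex.I ^ (k : ℕ)) * c‖ < 1 := by
  have hsq : ‖c‖ ^ 2 = c.re ^ 2 + c.im ^ 2 := by
    rw [← Complex.normSq_eq_norm_sq, Complex.normSq_apply]; ring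
  have hpos : 0 < c.re ^ 2 + c.im ^ 2 := by rw [← hsq]; positivity
  have hre : |c.re| < 1 := (Complex.abs_re_le_norm c).trans_lt h1
  have him : |c.im| < 1 := (Complex.abs_im_le_norm c).trans_lt h1
  have key : ∀ d : ℂ, (1 - d.re) ^ 2 + d.im ^ 2 < 1 → ‖1 - d‖ < 1 := fun d hd => by
    have h2 : ‖1 - d‖ ^ 2 < 1 := by
      rw [← Complex.normSq_eq_norm_sq, Complex.normSq_apply]
      simp only [Complex.sub_re, Complex.one_re, Complex.sub_im, Complex.one_im]
      linarith
    exact (sq_lt_one_iff₀ (norm_nonneg _)).1 h2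
  rw [abs_lt] at hre him
  rcases le_total |c.im| |c.re| with h | h
  · rcases le_total 0 c.re with h2 | h2
    · refine ⟨0, key _ ?_⟩
      rw [abs_of_nonneg h2, abs_le] at h
      simp
      nlinarith
    · refine ⟨2, key _ ?_⟩
      rw [abs_of_nonpos h2, abs_le] at h
      simp
      nlinarith
  · rcases le_total 0 c.im with h2 | h2
    · refine ⟨1, key _ ?_⟩
      rw [abs_of_nonneg h2, abs_le] at h
      simp
      nlinarith
    · refine ⟨3, key _ ?_⟩
      rw [abs_of_nonpos h2, abs_le] at h
      simp [pow_succ]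
      nlinarith

/-- The punctured ball is covered by the `4n` nonisotropic balls of radius one centred at the
points `i^k e_j`. -/
lemma lintegral_ball_le (hn : 1 ≤ n) {γ q α : ℝ} (hγ : 2 ≤ γ) (hq : 0 < q) (f : Cn n → ℂ) :
    ∫⁻ z, ‖f z‖ₑ ^ q ∂(weightedV n (n + α)) ≤ 4 * n * tentNormTop n γ q α f ^ q := by
  set ζ : Fin n × Fin 4 → Cn n := fun p =>
    Complex.I ^ (p.2 : ℕ) • EuclideanSpace.single p.1 (1 : ℂ) with hζdef
  have hζ : ∀ p, ‖ζ p‖ = 1 := fun p => by simp [hζdef, norm_smul]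
  have hcover : ∀ᵐ z ∂(weightedV n (n + α)), z ∈ ⋃ p, cap (ζ p) 1 := by
    filter_upwards [ae_weightedV_mem _, ae_weightedV_ne_zero hn _] with z hz hz0
    obtain ⟨i, hi⟩ : ∃ i, z i ≠ 0 := by
      by_contra! h
      exact hz0 (by ext i; simpa using h i)
    obtain ⟨k, hk⟩ := exists_norm_one_sub_mul_lt hi (norm_coord_lt hz)
    refine mem_iUnion.2 ⟨(i, k), hz, ?_⟩
    have : herm z (EuclideanSpace.single i (1 : ℂ)) = z i := by
      simp [herm, EuclideanSpace.inner_single_left]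
    rw [gauge, hζdef]
    simp only
    rwa [herm_smul_right, this]
  calc ∫⁻ z, ‖f z‖ₑ ^ q ∂(weightedV n (n + α))
      = ∫⁻ z in ⋃ p, cap (ζ p) 1, ‖f z‖ₑ ^ q ∂(weightedV n (n + α)) := by
        rw [Measure.restrict_eq_self_of_ae_mem hcover]
    _ ≤ ∑ p, ∫⁻ z in cap (ζ p) 1, ‖f z‖ₑ ^ q ∂(weightedV n (n + α)) := by
        refine (lintegral_iUnion_le _ _).trans_eq (tsum_fintype _)
    _ ≤ ∑ _p : Fin n × Fin 4, tentNormTop n γ q α f ^ q :=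
        Finset.sum_le_sum fun p _ => lintegral_cap_one_le hn hγ hq f (hζ p)
    _ = 4 * n * tentNormTop n γ q α f ^ q := by
        simp [mul_comm]

/-- The norm of `T^∞` dominates the Carleson constant: balls of radius less than one are tents, and
for larger radii the total mass suffices. -/
lemma carlesonBound_tentNormTop (hn : 1 ≤ n) {γ q α : ℝ} (hγ : 2 ≤ γ) (hq : 0 < q)
    (f : Cn n → ℂ) : CarlesonBound (n + α) q (fun z => ‖f z‖ₑ)
      (4 * n * tentNormTop n γ q α f ^ q) := by
  intro ζ hζ δ hδ
  have hn1 : (1 : ℝ≥0∞) ≤ 4 * n := by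
    have h : 1 ≤ 4 * n := by omega
    exact_mod_cast h
  rcases lt_or_ge δ 1 with h1 | h1
  · refine (lintegral_cap_le hn hγ hq f hζ hδ h1).trans ?_
    gcongr
    exact le_mul_of_one_le_left zero_le hn1
  · refine (setLIntegral_le_lintegral _ _).trans ((lintegral_ball_le hn hγ hq f).trans ?_)
    refine le_mul_of_one_le_right zero_le ?_
    rw [← ENNReal.ofReal_one]
    exact ENNReal.ofReal_le_ofReal (one_le_pow₀ h1)

/-! ### The Bergman projection on tent spaces -/

lemma CarlesonBound.congr_ae {β q : ℝ} {φ ψ : Cn n → ℝ≥0∞} {K : ℝ≥0∞} (h : CarlesonBound β q φ K)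
    (hφψ : φ =ᵐ[V n] ψ) : CarlesonBound β q ψ K := by
  intro ζ hζ δ hδ
  refine (lintegral_congr_ae ?_).trans_le (h ζ hζ δ hδ)
  refine ae_restrict_of_ae ((weightedV_absolutelyContinuous β).ae_le ?_)
  filter_upwards [hφψ] with z hz
  rw [hz]

lemma tentOne_congr_ae (γ α q : ℝ) {φ ψ : Cn n → ℝ≥0∞} (h : φ =ᵐ[V n] ψ) :
    tentOne γ α q φ = tentOne γ α q ψ := by
  refine lintegral_congr fun ζ => ?_
  rw [areaPow, areaPow]
  congr 1
  refine lintegral_congr_ae (ae_restrict_of_ae ((weightedV_absolutelyContinuous α).ae_le ?_))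
  filter_upwards [h] with z hz
  rw [hz]

lemma posBergman_congr_ae (β : ℝ) {φ ψ : Cn n → ℝ≥0∞} (h : φ =ᵐ[V n] ψ) :
    posBergman β φ = posBergman β ψ := by
  funext z
  refine lintegral_congr_ae ((weightedV_absolutelyContinuous β).ae_le ?_)
  filter_upwards [h] with u hu
  rw [hu]

/-- The positive operator dominates the Bergman projection. -/
lemma enorm_bergmanProj_le (β : ℝ) (f : Cn n → ℂ) (z : Cn n) :
    ‖bergmanProj n β f z‖ₑ ≤ ‖cConst n β‖ₑ * posBergman β (fun u => ‖f u‖ₑ) z := by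
  rw [bergmanProj_eq, enorm_mul]
  have h1 : ‖(cConst n β : ℂ)‖ₑ = ‖cConst n β‖ₑ := by
    rw [← ofReal_norm, ← ofReal_norm, Complex.norm_real]
  rw [h1]
  gcongr
  refine (enorm_integral_le_lintegral_enorm _).trans_eq (lintegral_congr fun u => ?_)
  rw [enorm_mul, mul_comm]
  congr 1
  rw [← ofReal_norm, norm_kernel, kern, Real.rpow_neg (gauge_nonneg z u)]

lemma CarlesonBound.of_le_const_mul {β q : ℝ} (hq : 0 ≤ q) {φ ψ : Cn n → ℝ≥0∞} {K c : ℝ≥0∞}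
    (hc : c ≠ ∞) (h : CarlesonBound β q ψ K) (hle : ∀ z, φ z ≤ c * ψ z) :
    CarlesonBound β q φ (c ^ q * K) := by
  intro ζ hζ δ hδ
  calc ∫⁻ z in cap ζ δ, φ z ^ q ∂(weightedV n β)
      ≤ ∫⁻ z in cap ζ δ, c ^ q * ψ z ^ q ∂(weightedV n β) := by
        refine lintegral_mono fun z => ?_
        rw [← ENNReal.mul_rpow_of_nonneg _ _ hq]
        exact ENNReal.rpow_le_rpow (hle z) hq
    _ = c ^ q * ∫⁻ z in cap ζ δ, ψ z ^ q ∂(weightedV n β) :=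
        lintegral_const_mul' _ _ (ENNReal.rpow_ne_top_of_nonneg hq hc)
    _ ≤ c ^ q * (K * ENNReal.ofReal (δ ^ n)) := by gcongr; exact h ζ hζ δ hδ
    _ = _ := (mul_assoc _ _ _).symm

lemma tentOne_le_const_mul (γ α : ℝ) {q : ℝ} (hq : 0 < q) {φ ψ : Cn n → ℝ≥0∞} {c : ℝ≥0∞}
    (hc : c ≠ ∞) (hle : ∀ z, φ z ≤ c * ψ z) : tentOne γ α q φ ≤ c * tentOne γ α q ψ := by
  rw [tentOne, tentOne, ← lintegral_const_mul' _ _ hc]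
  refine lintegral_mono fun ζ => ?_
  have h1 : areaPow γ α q φ ζ ≤ c ^ q * areaPow γ α q ψ ζ := by
    refine (areaPow_mono hq.le (fun z _ => hle z) _).trans_eq ?_
    rw [areaPow, areaPow, ← lintegral_const_mul' _ _ (ENNReal.rpow_ne_top_of_nonneg hq.le hc)]
    exact lintegral_congr fun z => ENNReal.mul_rpow_of_nonneg _ _ hq.le
  refine (ENNReal.rpow_le_rpow h1 (by positivity)).trans_eq ?_
  rw [ENNReal.mul_rpow_of_nonneg _ _ (by positivity), ← ENNReal.rpow_mul,
    mul_one_div_cancel hq.ne', ENNReal.rpow_one]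

lemma integrable_of_carlesonBound (hn : 1 ≤ n) {β q : ℝ} (hβ : -1 < β) (hq : 1 < q)
    {f : Cn n → ℂ} (hf : AEMeasurable f (V n)) {K : ℝ≥0}
    (h : CarlesonBound β q (fun z => ‖f z‖ₑ) K) : Integrable f (weightedV n β) := by
  have := isFiniteMeasure_weightedV hn hβ
  refine ⟨(hf.mono_ac (weightedV_absolutelyContinuous β)).aestronglyMeasurable, ?_⟩
  have hle : ∀ x : ℝ≥0∞, x ≤ 1 + x ^ q := fun x => by
    rcases le_total x 1 with hx | hx
    · exact hx.trans le_self_add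
    · refine le_trans ?_ le_add_self
      simpa using ENNReal.rpow_le_rpow_of_exponent_le hx hq.le
  calc ∫⁻ z, ‖f z‖ₑ ∂(weightedV n β) ≤ ∫⁻ z, (1 + ‖f z‖ₑ ^ q) ∂(weightedV n β) :=
        lintegral_mono fun z => hle _
    _ = weightedV n β univ + ∫⁻ z, ‖f z‖ₑ ^ q ∂(weightedV n β) := by
        rw [lintegral_add_left measurable_const, lintegral_one]
    _ < ∞ := by
        refine ENNReal.add_lt_top.2 ⟨measure_lt_top _ _, (h.lintegral_le hn).trans_lt ?_⟩
        exact ENNReal.mul_lt_top (ENNReal.pow_lt_top (by norm_num)) ENNReal.coe_lt_top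

/-- The constant function `1` satisfies a Carleson condition: `δ^{n+1+β} ≤ δⁿ` for `δ ≤ 1`, and the
total mass is finite. -/
lemma exists_carlesonBound_one (hn : 1 ≤ n) {β : ℝ} (hβ : -1 < β) (q : ℝ) :
    ∃ K : ℝ≥0, K ≠ 0 ∧ CarlesonBound (n := n) β q (fun _ => 1) K := by
  have := isFiniteMeasure_weightedV hn hβ
  obtain ⟨C, hC⟩ := weightedV_cap_le hn hβ
  refine ⟨C + (weightedV n β univ).toNNReal + 1, by positivity, fun ζ hζ δ hδ => ?_⟩
  have hM : ((weightedV n β univ).toNNReal : ℝ≥0∞) = weightedV n β univ :=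
    ENNReal.coe_toNNReal (measure_ne_top _ _)
  simp only [ENNReal.one_rpow, lintegral_one, Measure.restrict_apply_univ]
  push_cast
  rw [hM]
  rcases le_total δ 1 with h1 | h1
  · refine (hC ζ hζ δ hδ).trans ?_
    gcongr
    · rw [add_assoc]; exact le_self_add
    · rw [← Real.rpow_natCast]
      exact Real.rpow_le_rpow_of_exponent_ge hδ h1 (by linarith)
  · refine (measure_mono (subset_univ _)).trans ?_
    calc weightedV n β univ ≤ (C + weightedV n β univ + 1) * 1 := by
          rw [mul_one, add_right_comm]; exact le_add_self
      _ ≤ _ := by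
        gcongr
        rw [← ENNReal.ofReal_one]
        exact ENNReal.ofReal_le_ofReal (one_le_pow₀ h1)

/-- Functions of `T^1` are integrable, by the pairing inequality with the constant function `1`. -/
lemma integrable_of_memT (hn : 1 ≤ n) {γ q α : ℝ} (hγ : 2 ≤ γ) (hq : 1 < q)
    (hα : -(n : ℝ) - 1 < α) {f : Cn n → ℂ} (hf : MemT n γ 1 q α f) :
    Integrable f (weightedV n (n + α)) := by
  have hβ : -1 < n + α := by linarith
  obtain ⟨q', hqq⟩ : ∃ q', q.HolderConjugate q' := ⟨_, Real.HolderConjugate.conjExponent hq⟩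
  obtain ⟨K, hK0, hK⟩ := exists_carlesonBound_one hn hβ q'
  obtain ⟨C, hC⟩ := lintegral_mul_le_tentOne (α := α) hn hγ hqq hK0
  obtain ⟨hm, hfin⟩ := hf
  rw [tentNorm_one_eq] at hfin
  have hae : (fun z => ‖f z‖ₑ) =ᵐ[V n] fun z => ‖hm.mk f z‖ₑ := by
    filter_upwards [hm.ae_eq_mk] with z hz
    rw [hz]
  refine ⟨(hm.mono_ac (weightedV_absolutelyContinuous _)).aestronglyMeasurable, ?_⟩
  have h1 := hC _ _ hm.measurable_mk.enorm measurable_const hK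
  simp only [mul_one] at h1
  rw [← tentOne_congr_ae γ α q hae] at h1
  refine lt_of_le_of_lt ?_ (ENNReal.mul_lt_top ENNReal.coe_lt_top hfin : C * _ < ∞)
  exact (lintegral_congr_ae ((weightedV_absolutelyContinuous _).ae_le hae)).trans_le h1

lemma exists_carlesonBound_bergmanProj (hn : 1 ≤ n) {β q : ℝ} (hβ : -1 < β) (hq : 1 < q) :
    ∃ C : ℝ≥0, ∀ f : Cn n → ℂ, AEMeasurable f (V n) → ∀ K : ℝ≥0∞,
      CarlesonBound β q (fun z => ‖f z‖ₑ) K →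
        CarlesonBound β q (fun z => ‖bergmanProj n β f z‖ₑ) (C * K) := by
  obtain ⟨C, hC⟩ := CarlesonBound.posBergman hn hβ hq
  have hq0 : 0 < q := by linarith
  have htop : ‖cConst n β‖ₑ ^ q ≠ ∞ := ENNReal.rpow_ne_top_of_nonneg hq0.le enorm_ne_top
  refine ⟨(‖cConst n β‖ₑ ^ q).toNNReal * C, fun f hm K hK => ?_⟩
  have hae : (fun z => ‖f z‖ₑ) =ᵐ[V n] fun z => ‖hm.mk f z‖ₑ := by
    filter_upwards [hm.ae_eq_mk] with z hz
    rw [hz]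
  have h1 := hC _ hm.measurable_mk.enorm K (hK.congr_ae hae)
  rw [← posBergman_congr_ae β hae] at h1
  have h2 := h1.of_le_const_mul hq0.le enorm_ne_top (enorm_bergmanProj_le β f)
  push_cast
  rwa [ENNReal.coe_toNNReal htop, mul_assoc]

lemma exists_carlesonBound_of_memTTop (hn : 1 ≤ n) {γ q α : ℝ} (hγ : 2 ≤ γ) (hq : 1 < q)
    {f : Cn n → ℂ} (hf : MemTTop n γ q α f) :
    ∃ K : ℝ≥0, CarlesonBound (n + α) q (fun z => ‖f z‖ₑ) K := by
  have hq0 : 0 < q := by linarith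
  have h := carlesonBound_tentNormTop (α := α) hn hγ hq0 f
  have htop : 4 * n * tentNormTop n γ q α f ^ q ≠ ∞ :=
    ENNReal.mul_ne_top (ENNReal.mul_ne_top (by norm_num) (ENNReal.natCast_ne_top n))
      (ENNReal.rpow_ne_top_of_nonneg hq0.le hf.2.ne)
  refine ⟨(4 * n * tentNormTop n γ q α f ^ q).toNNReal, ?_⟩
  rwa [ENNReal.coe_toNNReal htop]

lemma tentNormTop_lt_top (hn : 1 ≤ n) {γ q α : ℝ} (hq : 0 < q) {f : Cn n → ℂ} {K : ℝ≥0}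
    (h : CarlesonBound (n + α) q (fun z => ‖f z‖ₑ) K) : tentNormTop n γ q α f < ∞ :=
  (tentNormTop_le hn hq h).trans_lt (ENNReal.rpow_lt_top_of_nonneg (by positivity)
    (ENNReal.mul_ne_top (ENNReal.pow_ne_top (by norm_num)) ENNReal.coe_ne_top))

lemma integrable_of_memTTop (hn : 1 ≤ n) {γ q α : ℝ} (hγ : 2 ≤ γ) (hq : 1 < q)
    (hα : -(n : ℝ) - 1 < α) {f : Cn n → ℂ} (hf : MemTTop n γ q α f) :
    Integrable f (weightedV n (n + α)) := by
  obtain ⟨K, hK⟩ := exists_carlesonBound_of_memTTop hn hγ hq hf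
  exact integrable_of_carlesonBound hn (by linarith) hq hf.1 hK

lemma integrable_bergmanIntegrand (hn : 1 ≤ n) {β : ℝ} (hβ : -1 < β) {f : Cn n → ℂ}
    (hf : Integrable f (weightedV n β)) {z : Cn n} (hz : z ∈ unitBall n) :
    Integrable (bergmanIntegrand n β f z) (V n) := by
  have hn0 : (1 : ℝ) ≤ n := by exact_mod_cast hn
  exact (integrable_bergmanIntegrand_iff β f z).2 (integrable_kernel_mul (by linarith) hz hf)

theorem exists_tentNormTop_bergmanProj_le (hn : 1 ≤ n) {γ q α : ℝ} (hγ : 2 ≤ γ) (hq : 1 < q)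
    (hα : -(n : ℝ) - 1 < α) : ∃ C : ℝ≥0, ∀ f : Cn n → ℂ, AEMeasurable f (V n) →
      tentNormTop n γ q α (bergmanProj n (n + α) f) ≤ C * tentNormTop n γ q α f := by
  have hq0 : 0 < q := by linarith
  obtain ⟨C, hC⟩ := exists_carlesonBound_bergmanProj hn (β := n + α) (by linarith) hq
  have htop : (3 ^ n * (C * (4 * n)) : ℝ≥0∞) ^ (1 / q) ≠ ∞ := by
    refine ENNReal.rpow_ne_top_of_nonneg (by positivity) ?_
    exact ENNReal.mul_ne_top (ENNReal.pow_ne_top (by norm_num)) (ENNReal.mul_ne_top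
      ENNReal.coe_ne_top (ENNReal.mul_ne_top (by norm_num) (ENNReal.natCast_ne_top n)))
  refine ⟨((3 ^ n * (C * (4 * n)) : ℝ≥0∞) ^ (1 / q)).toNNReal, fun f hf => ?_⟩
  rw [ENNReal.coe_toNNReal htop]
  refine (tentNormTop_le hn hq0 (hC f hf _ (carlesonBound_tentNormTop hn hγ hq0 f))).trans_eq ?_
  rw [← mul_assoc (C : ℝ≥0∞), ← mul_assoc (3 ^ n : ℝ≥0∞),
    ENNReal.mul_rpow_of_nonneg _ _ (by positivity), ← ENNReal.rpow_mul, mul_one_div_cancel hq0.ne',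
    ENNReal.rpow_one]

theorem exists_tentNorm_bergmanProj_le (hn : 1 ≤ n) {γ q α : ℝ} (hγ : 2 ≤ γ) (hq : 1 < q)
    (hα : -(n : ℝ) - 1 < α) : ∃ C : ℝ≥0, ∀ f : Cn n → ℂ, AEMeasurable f (V n) →
      tentNorm n γ 1 q α (bergmanProj n (n + α) f) ≤ C * tentNorm n γ 1 q α f := by
  have hq0 : 0 < q := by linarith
  obtain ⟨C, hC⟩ := tentOne_posBergman_le hn hγ hq hα
  refine ⟨‖cConst n (n + α)‖₊ * C, fun f hm => ?_⟩
  have hae : (fun z => ‖f z‖ₑ) =ᵐ[V n] fun z => ‖hm.mk f z‖ₑ := by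
    filter_upwards [hm.ae_eq_mk] with z hz
    rw [hz]
  have h1 := hC _ hm.measurable_mk.enorm
  rw [← posBergman_congr_ae _ hae, ← tentOne_congr_ae γ α q hae] at h1
  rw [tentNorm_one_eq, tentNorm_one_eq]
  refine (tentOne_le_const_mul γ α hq0 enorm_ne_top (enorm_bergmanProj_le (n + α) f)).trans ?_
  push_cast
  rw [mul_assoc]
  exact mul_le_mul_right h1 _

end TentBall

theorem mainTheorem6 (n : ℕ) (hn : 1 ≤ n) (γ : ℝ) (hγ : 2 ≤ γ) (q α : ℝ) (hq : 1 < q)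
    (hα : -(n : ℝ) - 1 < α) :
    -- the projection is well defined, bounded and onto from `T^∞_{q,α}` to `CT_{q,α}`
    ((∀ f : TentBall.Cn n → ℂ, TentBall.MemTTop n γ q α f →
        ∀ z ∈ TentBall.unitBall n,
          Integrable (TentBall.bergmanIntegrand n (n + α) f z) (TentBall.V n)) ∧
      (∃ C : ℝ≥0, ∀ f : TentBall.Cn n → ℂ, TentBall.MemTTop n γ q α f →
        TentBall.MemCT n γ q α (TentBall.bergmanProj n (n + α) f) ∧
        TentBall.tentNormTop n γ q α (TentBall.bergmanProj n (n + α) f) ≤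
          C * TentBall.tentNormTop n γ q α f) ∧
      (∀ g : TentBall.Cn n → ℂ, TentBall.MemCT n γ q α g →
        ∃ f : TentBall.Cn n → ℂ, TentBall.MemTTop n γ q α f ∧
          EqOn (TentBall.bergmanProj n (n + α) f) g (TentBall.unitBall n))) ∧
    -- membership in `T^∞_{q,α}` is the Carleson condition, which the projection preserves
    ((∀ f : TentBall.Cn n → ℂ, AEMeasurable f (TentBall.V n) →
        (TentBall.MemTTop n γ q α f ↔
          TentBall.IsCarleson (TentBall.wMeasure n q (n + α) f))) ∧
      (∀ f : TentBall.Cn n → ℂ, AEMeasurable f (TentBall.V n) →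
        TentBall.IsCarleson (TentBall.wMeasure n q (n + α) f) →
        TentBall.IsCarleson
          (TentBall.wMeasure n q (n + α) (TentBall.bergmanProj n (n + α) f)))) ∧
    -- the projection is well defined, bounded and onto from `T^1_{q,α}` to `HT^1_{q,α}`
    ((∀ f : TentBall.Cn n → ℂ, TentBall.MemT n γ 1 q α f →
        ∀ z ∈ TentBall.unitBall n,
          Integrable (TentBall.bergmanIntegrand n (n + α) f z) (TentBall.V n)) ∧
      (∃ C : ℝ≥0, ∀ f : TentBall.Cn n → ℂ, TentBall.MemT n γ 1 q α f →
        TentBall.MemHT n γ 1 q α (TentBall.bergmanProj n (n + α) f) ∧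
        TentBall.tentNorm n γ 1 q α (TentBall.bergmanProj n (n + α) f) ≤
          C * TentBall.tentNorm n γ 1 q α f) ∧
      (∀ g : TentBall.Cn n → ℂ, TentBall.MemHT n γ 1 q α g →
        ∃ f : TentBall.Cn n → ℂ, TentBall.MemT n γ 1 q α f ∧
          EqOn (TentBall.bergmanProj n (n + α) f) g (TentBall.unitBall n))) := by
  have hβ : -1 < n + α := by linarith
  have hq0 : 0 < q := by linarith
  -- By the reproducing formula, a holomorphic `g` is its own preimage.
  refine ⟨⟨fun f hf z hz => ?_, ?_, fun g hg => ⟨g, hg.2, fun z hz => ?_⟩⟩,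
    ⟨fun f hm => ?_, fun f hm hf => ?_⟩,
    fun f hf z hz => ?_, ?_, fun g hg => ⟨g, hg.2, fun z hz => ?_⟩⟩
  · exact TentBall.integrable_bergmanIntegrand hn hβ
      (TentBall.integrable_of_memTTop hn hγ hq hα hf) hz
  · obtain ⟨C, hC⟩ := TentBall.exists_tentNormTop_bergmanProj_le hn hγ hq hα
    refine ⟨C, fun f hf => ?_⟩
    have hd := TentBall.differentiableOn_bergmanProj hβ
      (TentBall.integrable_of_memTTop hn hγ hq hα hf)
    have hle := hC f hf.1
    exact ⟨⟨hd, TentBall.aemeasurable_of_differentiableOn hd,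
      hle.trans_lt (ENNReal.mul_lt_top ENNReal.coe_lt_top hf.2)⟩, hle⟩
  · exact TentBall.bergmanProj_eq_self hn hβ hg.1
      (TentBall.integrable_of_memTTop hn hγ hq hα hg.2) hz
  · rw [TentBall.isCarleson_wMeasure_iff]
    refine ⟨fun hf => TentBall.exists_carlesonBound_of_memTTop hn hγ hq hf, ?_⟩
    rintro ⟨K, hK⟩
    exact ⟨hm, TentBall.tentNormTop_lt_top hn hq0 hK⟩
  · rw [TentBall.isCarleson_wMeasure_iff] at hf ⊢
    obtain ⟨K, hK⟩ := hf
    obtain ⟨C, hC⟩ := TentBall.exists_carlesonBound_bergmanProj hn hβ hq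
    exact ⟨C * K, by simpa using hC f hm K hK⟩
  · exact TentBall.integrable_bergmanIntegrand hn hβ
      (TentBall.integrable_of_memT hn hγ hq hα hf) hz
  · obtain ⟨C, hC⟩ := TentBall.exists_tentNorm_bergmanProj_le hn hγ hq hα
    refine ⟨C, fun f hf => ?_⟩
    have hd := TentBall.differentiableOn_bergmanProj hβ
      (TentBall.integrable_of_memT hn hγ hq hα hf)
    have hle := hC f hf.1
    exact ⟨⟨hd, TentBall.aemeasurable_of_differentiableOn hd,
      hle.trans_lt (ENNReal.mul_lt_top ENNReal.coe_lt_top hf.2)⟩, hle⟩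
  · exact TentBall.bergmanProj_eq_self hn hβ hg.1
      (TentBall.integrable_of_memT hn hγ hq hα hg.2) hz
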